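/- Lemma ($V$-semicompactness for Schrödinger operators). Let $d\in\mathbb N$ and let $v,w:\mathbb R^d\to\mathbb R$ be functions with $v=f_1+f_2$ and $w=f_3+f_4$ almost everywhere, where for each $i$ either $f_i\in L^{p_i}(\mathbb R^d)$ for some $p_i$ with $\max(1,d/2)<p_i<\infty$, or $f_i\in L^\infty(\mathbb R^d)$ and $f_i\to0$ at infinity (up to null sets); the $f_i$ are real valued. Assume that $w$ is even, i.e. $w(-x)=w(x)$ for almost every $x$. Let $e\in\mathbb R$ and let $h=-\Delta+v+e$ on $L^2(\mathbb R^d)$ be the operator associated with the quadratic form $q(u)=\int|\nabla u|^2+\int v|u|^2+e\int|u|^2$ with form domain $H^1(\mathbb R^d)$: $u\in D(h)$ and $hu=g$ if and only if $u\in H^1(\mathbb R^d)$ and $q(\varphi,u)=\langle\varphi,g\rangle$ for all $\varphi\in H^1(\mathbb R^d)$. Assume that $e$ is such that $h\ge1$, i.e. $\langle u,hu\rangle\ge\|u\|^2$ for all $u\in D(h)$. On $L^2(\mathbb R^{2d})=L^2(\mathbb R^d)\otimes L^2(\mathbb R^d)$ let $h_1+h_2$ be the closure of $h\otimes1+1\otimes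 h$ defined on the span of $\{f\otimes g: f,g\in D(h)\}$. Then $h_1+h_2$ has an everywhere defined, bounded, positive inverse; let $R=(h_1+h_2)^{-1/2}$ be the positive square root of this inverse. There is a bounded operator $T=(h_1+h_2)^{-1/2}\,w\,(h_1+h_2)^{-1/2}$ on $L^2(\mathbb R^{2d})$, i.e. for all $\varphi,\psi\in L^2(\mathbb R^{2d})$, $$\langle\varphi,T\psi\rangle=\int_{\mathbb R^d\times\mathbb R^d}w(x_1-x_2)\,\overline{(R\varphi)(x_1,x_2)}\,(R\psi)(x_1,x_2)\,dx_1\,dx_2$$ with an absolutely convergent integral. With $V=\{(x_1,x_2)\in\mathbb R^d\times\mathbb R^d: x_1+x_2=0\}$, the operator $T$ is $V$-semicompact: there are compact operators $K_j$ on $L^2(V)$ and bounded operators $B_j$ on $L^2(V^\perp)$, $j\ge1$, such that $$(h_1+h_2)^{-1/2}\,w\,(h_1+h_2)^{-1/2}=\sum_{j=1}^\infty K_j\otimes_V B_j,$$ where the partial sums converge in the operator norm. Here $K\otimes_V B$ is the tensor product of operators induced by $L^2(\mathbb R^{2d})=L^2(V)\otimes L^2(V^\perp)$, i.e. the bounded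 operator with $(K\otimes_V B)(f\otimes g)=Kf\otimes Bg$, where $(f\otimes g)(x)=f(x_V)\,g(x_{V^\perp})$ for the orthogonal projections $x_V,x_{V^\perp}$ of $x$. -/

import Mathlib

open MeasureTheory Filter Topology
open scoped ComplexConjugate TensorProduct LineDeriv SchwartzMap InnerProductSpace

namespace ManyBody

noncomputable section

section Tensor

/-- The complex Hilbert space `L²(E)` of a finite-dimensional Euclidean space `E`, with respect to
the Lebesgue measure given by the inner product of `E`. -/
abbrev L2 (E : Type*) [NormedAddCommGroup E] [InnerProductSpace ℝ E] [FiniteDimensional ℝ E]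
    [MeasurableSpace E] [BorelSpace E] : Type _ :=
  Lp ℂ 2 (volume : Measure E)

variable {E F P : Type*}
  [NormedAddCommGroup E] [InnerProductSpace ℝ E] [FiniteDimensional ℝ E]
  [MeasurableSpace E] [BorelSpace E]
  [NormedAddCommGroup F] [InnerProductSpace ℝ F] [FiniteDimensional ℝ F]
  [MeasurableSpace F] [BorelSpace F]
  [NormedAddCommGroup P] [InnerProductSpace ℝ P] [FiniteDimensional ℝ P]
  [MeasurableSpace P] [BorelSpace P]

/-- An orthogonal splitting `P ≅ E × F` preserves the Lebesgue measure. -/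
theorem measurePreserving_split (s : P ≃ₗᵢ[ℝ] WithLp 2 (E × F)) :
    MeasurePreserving (fun x : P => WithLp.ofLp (s x)) volume
      ((volume : Measure E).prod (volume : Measure F)) :=
  (WithLp.volume_preserving_ofLp E F).comp s.measurePreserving

theorem memLp_mul_prod (f : L2 E) (g : L2 F) :
    MemLp (fun z : E × F => f z.1 * g z.2) 2
      ((volume : Measure E).prod (volume : Measure F)) := by
  have hf := Lp.memLp f
  have hg := Lp.memLp g
  have hm : AEStronglyMeasurable (fun z : E × F => f z.1 * g z.2)
      ((volume : Measure E).prod (volume : Measure F)) :=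
    hf.1.comp_fst.mul hg.1.comp_snd
  rw [memLp_two_iff_integrable_sq_norm hm]
  have := ((memLp_two_iff_integrable_sq_norm hf.1).1 hf).mul_prod
    ((memLp_two_iff_integrable_sq_norm hg.1).1 hg)
  simpa [mul_pow] using this

/-- For an orthogonal splitting `x ↦ (x_E, x_F)` of `P`, the elementary tensor `f ⊗ g` is the
function `x ↦ f(x_E) g(x_F)` in `L²(P)`. -/
def elemTensor (s : P ≃ₗᵢ[ℝ] WithLp 2 (E × F)) (f : L2 E) (g : L2 F) : L2 P :=
  MemLp.toLp (fun x : P => f (s x).fst * g (s x).snd)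
    ((memLp_mul_prod f g).comp_measurePreserving (measurePreserving_split s))

theorem coeFn_elemTensor (s : P ≃ₗᵢ[ℝ] WithLp 2 (E × F)) (f : L2 E) (g : L2 F) :
    elemTensor s f g =ᵐ[volume] fun x => f (s x).fst * g (s x).snd :=
  MemLp.coeFn_toLp _

theorem ae_fst (s : P ≃ₗᵢ[ℝ] WithLp 2 (E × F)) {p : E → Prop} (h : ∀ᵐ y, p y) :
    ∀ᵐ x : P, p (s x).fst :=
  (Measure.quasiMeasurePreserving_fst.comp
    (measurePreserving_split s).quasiMeasurePreserving).ae h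

theorem ae_snd (s : P ≃ₗᵢ[ℝ] WithLp 2 (E × F)) {p : F → Prop} (h : ∀ᵐ y, p y) :
    ∀ᵐ x : P, p (s x).snd :=
  (Measure.quasiMeasurePreserving_snd.comp
    (measurePreserving_split s).quasiMeasurePreserving).ae h

/-- The linear map `L²(E) ⊗ L²(F) → L²(P)` on the algebraic tensor product that is induced by the
elementary tensors; it is isometric and has dense range, see below. -/
def tensorEmb (s : P ≃ₗᵢ[ℝ] WithLp 2 (E × F)) : L2 E ⊗[ℂ] L2 F →ₗ[ℂ] L2 P :=
  TensorProduct.lift (LinearMap.mk₂ ℂ (elemTensor s)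
    (fun f₁ f₂ g => by
      apply Lp.ext
      filter_upwards [coeFn_elemTensor s (f₁ + f₂) g, coeFn_elemTensor s f₁ g,
        coeFn_elemTensor s f₂ g, Lp.coeFn_add (elemTensor s f₁ g) (elemTensor s f₂ g),
        ae_fst s (Lp.coeFn_add f₁ f₂)] with x h1 h2 h3 h4 h5
      rw [h1, h4, Pi.add_apply, h2, h3, h5, Pi.add_apply, add_mul])
    (fun c f g => by
      apply Lp.ext
      filter_upwards [coeFn_elemTensor s (c • f) g, coeFn_elemTensor s f g,
        Lp.coeFn_smul c (elemTensor s f g), ae_fst s (Lp.coeFn_smul c f)] with x h1 h2 h3 h4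
      rw [h1, h3, Pi.smul_apply, h2, h4, Pi.smul_apply, smul_mul_assoc])
    (fun f g₁ g₂ => by
      apply Lp.ext
      filter_upwards [coeFn_elemTensor s f (g₁ + g₂), coeFn_elemTensor s f g₁,
        coeFn_elemTensor s f g₂, Lp.coeFn_add (elemTensor s f g₁) (elemTensor s f g₂),
        ae_snd s (Lp.coeFn_add g₁ g₂)] with x h1 h2 h3 h4 h5
      rw [h1, h4, Pi.add_apply, h2, h3, h5, Pi.add_apply, mul_add])
    (fun c f g => by
      apply Lp.ext
      filter_upwards [coeFn_elemTensor s f (c • g), coeFn_elemTensor s f g,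
        Lp.coeFn_smul c (elemTensor s f g), ae_snd s (Lp.coeFn_smul c g)] with x h1 h2 h3 h4
      rw [h1, h3, Pi.smul_apply, h2, h4, Pi.smul_apply, mul_smul_comm]))

@[simp] theorem tensorEmb_tmul (s : P ≃ₗᵢ[ℝ] WithLp 2 (E × F)) (f : L2 E) (g : L2 F) :
    tensorEmb s (f ⊗ₜ g) = elemTensor s f g := by
  simp [tensorEmb]

theorem inner_elemTensor (s : P ≃ₗᵢ[ℝ] WithLp 2 (E × F)) (f f' : L2 E) (g g' : L2 F) :
    ⟪elemTensor s f g, elemTensor s f' g'⟫_ℂ = ⟪f, f'⟫_ℂ * ⟪g, g'⟫_ℂ := by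
  have hs : MeasurableEmbedding (fun x : P => WithLp.ofLp (s x)) :=
    (s.toHomeomorph.toMeasurableEquiv.trans
      (MeasurableEquiv.toLp 2 (E × F)).symm).measurableEmbedding
  rw [L2.inner_def, L2.inner_def, L2.inner_def, ← integral_prod_mul,
    ← (measurePreserving_split s).integral_comp hs]
  apply integral_congr_ae
  filter_upwards [coeFn_elemTensor s f g, coeFn_elemTensor s f' g'] with x h1 h2
  simp only [h1, h2, RCLike.inner_apply, map_mul]
  exact mul_mul_mul_comm _ _ _ _

theorem norm_tensorEmb (s : P ≃ₗᵢ[ℝ] WithLp 2 (E × F)) (z : L2 E ⊗[ℂ] L2 F) :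
    ‖tensorEmb s z‖ = ‖z‖ := by
  have key : ∀ x y : L2 E ⊗[ℂ] L2 F, ⟪tensorEmb s x, tensorEmb s y⟫_ℂ = ⟪x, y⟫_ℂ := by
    intro x y
    induction x with
    | zero => simp
    | add a b ha hb => simp only [map_add, inner_add_left, ha, hb]
    | tmul f g =>
      induction y with
      | zero => simp
      | add a b ha hb => simp only [map_add, inner_add_right, ha, hb]
      | tmul f' g' => simp [inner_elemTensor]
  rw [@norm_eq_sqrt_re_inner ℂ, @norm_eq_sqrt_re_inner ℂ, key]

/-- A square integrable function on `E × F` whose integral over all rectangles of finite measure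
vanishes is zero almost everywhere. -/
theorem ae_eq_zero_of_rectangles {G : E × F → ℂ}
    (hG : MemLp G 2 ((volume : Measure E).prod (volume : Measure F)))
    (h : ∀ (A : Set E) (B : Set F), MeasurableSet A → MeasurableSet B → volume A ≠ ⊤ →
      volume B ≠ ⊤ → ∫ z in A ×ˢ B, G z ∂((volume : Measure E).prod (volume : Measure F)) = 0) :
    G =ᵐ[(volume : Measure E).prod (volume : Measure F)] 0 := by
  set μ := (volume : Measure E).prod (volume : Measure F) with hμ
  let Q : ℕ → Set (E × F) := fun n => Metric.ball 0 n ×ˢ Metric.ball 0 n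
  have hQm : ∀ n, MeasurableSet (Q n) := fun n => measurableSet_ball.prod measurableSet_ball
  have hQf : ∀ n, μ (Q n) ≠ ⊤ := fun n => by
    rw [hμ, Measure.prod_prod]
    exact ENNReal.mul_ne_top measure_ball_lt_top.ne measure_ball_lt_top.ne
  have hQi : ∀ n, IntegrableOn G (Q n) μ := fun n => by
    have : IsFiniteMeasure (μ.restrict (Q n)) := isFiniteMeasure_restrict.2 (hQf n)
    exact (hG.restrict (Q n)).integrable (by norm_num)
  have key : ∀ n, G =ᵐ[μ.restrict (Q n)] 0 := fun n => by
    refine Integrable.ae_eq_zero_of_forall_setIntegral_eq_zero (hQi n) fun t ht _ => ?_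
    have hu : ∫ z, G z ∂(μ.restrict (Q n)) = 0 :=
      h _ _ measurableSet_ball measurableSet_ball measure_ball_lt_top.ne measure_ball_lt_top.ne
    induction t, ht using MeasurableSpace.induction_on_inter generateFrom_prod.symm
      isPiSystem_prod with
    | empty => simp
    | basic t ht =>
      obtain ⟨A, hA, B, hB, rfl⟩ := ht
      rw [Measure.restrict_restrict (hA.prod hB), Set.prod_inter_prod]
      exact h _ _ (hA.inter measurableSet_ball) (hB.inter measurableSet_ball)
        (measure_ne_top_of_subset Set.inter_subset_right measure_ball_lt_top.ne)
        (measure_ne_top_of_subset Set.inter_subset_right measure_ball_lt_top.ne)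
    | compl t ht ih =>
      have := integral_add_compl ht (hQi n)
      rw [hu, ih (lt_of_le_of_lt (measure_mono (Set.subset_univ _)) (by
        rw [Measure.restrict_apply_univ]; exact (hQf n).lt_top)), zero_add] at this
      exact this
    | iUnion t hd ht ih =>
      rw [integral_iUnion ht hd (hQi n).integrableOn]
      have : ∀ i, ∫ z in t i, G z ∂(μ.restrict (Q n)) = 0 := fun i =>
        ih i (lt_of_le_of_lt (measure_mono (Set.subset_univ _)) (by
          rw [Measure.restrict_apply_univ]; exact (hQf n).lt_top))
      simp [this]
  have hcover : (⋃ n, Q n) = Set.univ := by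
    refine Set.eq_univ_of_forall fun z => ?_
    obtain ⟨n, hn⟩ := exists_nat_gt ‖z‖
    refine Set.mem_iUnion.2 ⟨n, ?_⟩
    exact ⟨by simpa using (norm_fst_le z).trans_lt hn, by simpa using (norm_snd_le z).trans_lt hn⟩
  have := (ae_restrict_iUnion_iff Q (fun z => G z = 0)).2 key
  rwa [hcover, Measure.restrict_univ] at this

theorem denseRange_tensorEmb (s : P ≃ₗᵢ[ℝ] WithLp 2 (E × F)) : DenseRange (tensorEmb s) := by
  have hs : MeasurableEmbedding (fun x : P => WithLp.ofLp (s x)) :=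
    (s.toHomeomorph.toMeasurableEquiv.trans
      (MeasurableEquiv.toLp 2 (E × F)).symm).measurableEmbedding
  have hmp := measurePreserving_split s
  suffices h : (LinearMap.range (tensorEmb s)).topologicalClosure = ⊤ by
    have := (Submodule.dense_iff_topologicalClosure_eq_top).2 h
    exact this
  rw [Submodule.topologicalClosure_eq_top_iff, Submodule.eq_bot_iff]
  intro Φ hΦ
  have hinv : MeasurePreserving (fun z : E × F => s.symm (WithLp.toLp 2 z))
      ((volume : Measure E).prod (volume : Measure F)) volume :=
    s.symm.measurePreserving.comp (WithLp.volume_preserving_toLp E F)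
  have hG := (Lp.memLp Φ).comp_measurePreserving hinv
  have hzero := ae_eq_zero_of_rectangles hG fun A B hA hB hAf hBf => by
    have h0 := (Submodule.mem_orthogonal _ _).1 hΦ _
      ⟨indicatorConstLp 2 hA hAf (1 : ℂ) ⊗ₜ indicatorConstLp 2 hB hBf (1 : ℂ), rfl⟩
    rw [tensorEmb_tmul, L2.inner_def] at h0
    rw [← hmp.setIntegral_preimage_emb hs, ← integral_indicator (hmp.measurable (hA.prod hB)),
      ← h0]
    apply integral_congr_ae
    filter_upwards [coeFn_elemTensor s (indicatorConstLp 2 hA hAf (1 : ℂ))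
      (indicatorConstLp 2 hB hBf (1 : ℂ)),
      ae_fst s (indicatorConstLp_coeFn (p := 2) (hs := hA) (hμs := hAf) (c := (1 : ℂ))),
      ae_snd s (indicatorConstLp_coeFn (p := 2) (hs := hB) (hμs := hBf) (c := (1 : ℂ)))]
      with x h1 h2 h3
    rw [h1, h2, h3]
    by_cases ha : (s x).fst ∈ A <;> by_cases hb : (s x).snd ∈ B <;>
      simp [Set.indicator, ha, hb]
  apply Lp.ext
  filter_upwards [hmp.quasiMeasurePreserving.ae hzero, Lp.coeFn_zero ℂ 2 (volume : Measure P)]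
    with x h1 h2
  rw [h2]
  simpa using h1

/-- For an orthogonal splitting `P ≅ E × F`, the tensor product `K ⊗ B` of bounded operators on
`L²(E)` and `L²(F)`, as a bounded operator on `L²(P) = L²(E) ⊗ L²(F)`: the continuous extension of
`f ⊗ g ↦ K f ⊗ B g`. -/
def tensorOp (s : P ≃ₗᵢ[ℝ] WithLp 2 (E × F)) (K : L2 E →L[ℂ] L2 E) (B : L2 F →L[ℂ] L2 F) :
    L2 P →L[ℂ] L2 P :=
  LinearMap.extendOfNorm (tensorEmb s ∘ₗ (TensorProduct.mapL K B).toLinearMap) (tensorEmb s)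

theorem tensorOp_elemTensor (s : P ≃ₗᵢ[ℝ] WithLp 2 (E × F)) (K : L2 E →L[ℂ] L2 E)
    (B : L2 F →L[ℂ] L2 F) (f : L2 E) (g : L2 F) :
    tensorOp s K B (elemTensor s f g) = elemTensor s (K f) (B g) := by
  have h := LinearMap.extendOfNorm_eq
    (f := tensorEmb s ∘ₗ (TensorProduct.mapL K B).toLinearMap) (e := tensorEmb s)
    (denseRange_tensorEmb s) ⟨‖TensorProduct.mapL K B‖, fun z => by
      rw [LinearMap.comp_apply, norm_tensorEmb, norm_tensorEmb]
      exact (TensorProduct.mapL K B).le_opNorm z⟩ (f ⊗ₜ g)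
  rw [tensorEmb_tmul] at h
  exact h.trans (tensorEmb_tmul s (K f) (B g))

end Tensor

section Schrodinger

/-- The configuration space `ℝ^d` of one particle. -/
abbrev Conf (d : ℕ) : Type := EuclideanSpace ℝ (Fin d)

/-- The configuration space `ℝ^d × ℝ^d = ℝ^{2d}` of two particles, with its Euclidean structure. -/
abbrev TwoConf (d : ℕ) : Type := WithLp 2 (Conf d × Conf d)

/-- The class of functions from which the potentials are built: `f ∈ L^p(ℝ^d)` for some
`max(1, d/2) < p < ∞`, or `f ∈ L^∞(ℝ^d)` and `f → 0` at infinity (up to null sets). -/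
def IsAdmissible {d : ℕ} (f : Conf d → ℝ) : Prop :=
  (∃ p : ℝ, max 1 ((d : ℝ) / 2) < p ∧ MemLp f (ENNReal.ofReal p) volume) ∨
    (MemLp f ⊤ volume ∧ Tendsto f (cocompact (Conf d) ⊓ ae volume) (𝓝 0))

/-- `g = ∇u` in the sense of distributions. Thus `u ∈ H¹(ℝ^d)` iff `u` has some weak gradient
with components in `L²`. -/
def IsWeakGradient {d : ℕ} (u : L2 (Conf d)) (g : Fin d → L2 (Conf d)) : Prop :=
  ∀ i, ∂_{(EuclideanSpace.single i 1 : Conf d)} (u : 𝓢'(Conf d, ℂ)) = (g i : 𝓢'(Conf d, ℂ))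

/-- The graph of the one-particle operator `h = -Δ + V + e` on `L²(ℝ^d)`, the operator associated
with the quadratic form `∫ |∇u|² + ∫ V |u|² + e ∫ |u|²` with form domain `H¹(ℝ^d)`:
`u ∈ D(h)` and `h u = v` iff `u ∈ H¹` and `q(φ, u) = ⟨φ, v⟩` for all `φ ∈ H¹`. -/
def hGraph {d : ℕ} (V : Conf d → ℝ) (e : ℝ) : Set (L2 (Conf d) × L2 (Conf d)) :=
  {p | ∃ g, IsWeakGradient p.1 g ∧ ∀ φ G, IsWeakGradient φ G →
    Integrable (fun x => (V x : ℂ) * (conj (φ x) * p.1 x)) ∧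
    (∑ i, ⟪G i, g i⟫_ℂ) + (∫ x, (V x : ℂ) * (conj (φ x) * p.1 x)) + (e : ℂ) * ⟪φ, p.1⟫_ℂ
      = ⟪φ, p.2⟫_ℂ}

/-- The splitting of `ℝ^d × ℝ^d` into the two factors, for which `L²(ℝ^{2d}) = L²(ℝ^d) ⊗ L²(ℝ^d)`
with `(f ⊗ g)(x₁, x₂) = f(x₁) g(x₂)`. -/
abbrev particleSplit (d : ℕ) : TwoConf d ≃ₗᵢ[ℝ] WithLp 2 (Conf d × Conf d) :=
  LinearIsometryEquiv.refl ℝ (TwoConf d)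

/-- The graph of `h₁ + h₂` on `L²(ℝ^{2d})`, where `h₁ = h ⊗ 1` and `h₂ = 1 ⊗ h`: the closure of
`h ⊗ 1 + 1 ⊗ h` defined on the span of the `f ⊗ g` with `f, g ∈ D(h)`. -/
def hSumGraph {d : ℕ} (V : Conf d → ℝ) (e : ℝ) :
    Submodule ℂ (L2 (TwoConf d) × L2 (TwoConf d)) :=
  (Submodule.span ℂ {q | ∃ f hf g hg, (f, hf) ∈ hGraph V e ∧ (g, hg) ∈ hGraph V e ∧
    q = (elemTensor (particleSplit d) f g,
      elemTensor (particleSplit d) hf g + elemTensor (particleSplit d) f hg)}).topologicalClosure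

/-- `R = A^{-1/2}` for the operator `A` with the given graph: `R` is the bounded positive operator
whose square is the everywhere defined inverse of `A`, that is, `(u, v) ∈ A ↔ u = R² v`. -/
def IsInvSqrt {H : Type*} [NormedAddCommGroup H] [InnerProductSpace ℂ H]
    (A : Submodule ℂ (H × H)) (R : H →L[ℂ] H) : Prop :=
  R.IsPositive ∧ ∀ u v, (u, v) ∈ A ↔ u = R (R v)

/-- `T = R w R` for the multiplication operator `w` by the function `w(x₁ - x₂)`, understood as a
quadratic form on the range of `R`: `⟨φ, T ψ⟩ = ∫ conj(Rφ) w(x₁ - x₂) Rψ`, with absolutely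
convergent integrals, for all `φ, ψ ∈ L²(ℝ^{2d})`. -/
def IsSandwich {d : ℕ} (w : Conf d → ℝ) (R T : L2 (TwoConf d) →L[ℂ] L2 (TwoConf d)) : Prop :=
  ∀ φ ψ : L2 (TwoConf d),
    Integrable (fun x : TwoConf d => (w (x.fst - x.snd) : ℂ) * (conj (R φ x) * R ψ x)) ∧
    ⟪φ, T ψ⟫_ℂ = ∫ x : TwoConf d, (w (x.fst - x.snd) : ℂ) * (conj (R φ x) * R ψ x)

/-- The subspace `{(x₁, x₂) : x₁ + x₂ = 0}` of `ℝ^d × ℝ^d`. -/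
def relSubspace (d : ℕ) : Submodule ℝ (TwoConf d) where
  carrier := {x | x.fst + x.snd = 0}
  zero_mem' := by simp
  add_mem' {x y} hx hy := by
    simp only [Set.mem_ofPred_eq, WithLp.add_fst, WithLp.add_snd] at *
    rw [add_add_add_comm, hx, hy, add_zero]
  smul_mem' c x hx := by
    simp only [Set.mem_ofPred_eq, WithLp.smul_fst, WithLp.smul_snd] at *
    rw [← smul_add, hx, smul_zero]

/-- `T` is `U`-semicompact for a subspace `U` of `ℝ^{2d}`: there are compact operators `K_j` on
`L²(U)` and bounded operators `B_j` on `L²(U^⊥)` such that `T = ∑_{j ≥ 0} K_j ⊗_U B_j`, the series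
converging in the operator norm. Here `⊗_U` refers to `L²(ℝ^{2d}) = L²(U) ⊗ L²(U^⊥)`. -/
def IsSemicompact {d : ℕ} (U : Submodule ℝ (TwoConf d))
    (T : L2 (TwoConf d) →L[ℂ] L2 (TwoConf d)) : Prop :=
  ∃ (K : ℕ → L2 U →L[ℂ] L2 U) (B : ℕ → L2 Uᗮ →L[ℂ] L2 Uᗮ),
    (∀ j, IsCompactOperator (K j)) ∧
    Tendsto (fun n => ∑ j ∈ Finset.range n, tensorOp U.orthogonalDecomposition (K j) (B j))
      atTop (𝓝 T)

end Schrodinger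

end

end ManyBody

/-! Write `J = (1 - Δ)^{-1/2}`, `G = h⁻¹`, and let `τ_v` and `e_v` be the translation and the plane
wave with vector `v`. The core is a compactness criterion of Kolmogorov–Riesz type along a subspace
`U`, `exists_compact_approx`. If `τ_v T → T` and `e_v T → T` in norm as `v → 0` in `U`, then up to
small norm error `T` lives on bounded momenta and bounded positions along `U`, so it is a norm limit
of operators `(K ⊗ 1) T` with `K` compact on `L²(U)`. If `T` is also selfadjoint, finite rank
operators `p_n → 1` on `L²(U)` give `p_n T p_n → T`, and each `p_n T p_n` is a finite sum of terms
(rank one) `⊗` (bounded); see `exists_hasSum_tensorOp`.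

It remains to check the two limits for `T = R w R` and `U = {x₁ + x₂ = 0}`. Translations are
absorbed by the left factor `R`. Indeed `G = J (1 + J V J + (e - 1) J²)⁻¹ J` gains a derivative, and
`(h₁ + h₂)⁻¹` factors through both `G ⊗ 1` and `1 ⊗ G`, so one particle can be translated at a time;
the C⋆-identity passes the limit on to `R`.

Plane waves are not absorbed by `R`, but they commute with it asymptotically in norm. This holds for
`J` because its symbol is Lipschitz, and it survives sums, products, bounded inverses, norm limits
and square roots of positive operators. Once `e_v` has been moved past `R` it meets `w`. For `v =
(a, -a)` it is a function of `x₁ - x₂` alone, and it is uniformly close to one where `x₁ - x₂` is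
bounded. This settles bounded `w` of bounded support.

General `w` are reached by approximation in the form sense. A Sobolev bound `∫ |f| |u|² ≤ C ‖f‖_p
‖u‖²_{H¹}` for `p > max(1, d/2)` makes every admissible potential a limit of bounded functions of
bounded support, relative to `J`. Freezing the second particle lifts the bound to `w(x₁ - x₂)`, and
`h₁ ≤ h₁ + h₂` replaces `J` by `R`. Hence the operators `R g R` converge to `T` in norm, and both
limits pass to `T`.

Unbounded operators never appear. Coercivity of `1 + J V J + (e - 1) J²` comes from `h ≥ 1` and the
relative smallness of `V`, so `G` is bounded. With `G₁ = G ⊗ 1`, `G₂ = 1 ⊗ G` and `N = G₁ + G₂`, the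
inverse of `h₁ + h₂` is `S = G₁ G₂ N⁻¹`. The pairs generating the graph are the `(S N z, N z)` with
`z` an elementary tensor, and `N` has dense range. -/

namespace ManyBody

open scoped FourierTransform ENNReal

noncomputable section

/-! ### Multiplication, plane wave and translation operators -/

section Operators

variable {P : Type*} [NormedAddCommGroup P] [InnerProductSpace ℝ P] [FiniteDimensional ℝ P]
  [MeasurableSpace P] [BorelSpace P]

/-- Multiplication by an essentially bounded function (zero for other functions). -/
def mulOp (m : P → ℂ) : L2 P →L[ℂ] L2 P :=
  open Classical in
  if hm : MemLp m ⊤ volume then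
    (ContinuousLinearMap.mul ℂ ℂ).holderL volume ⊤ 2 2 (hm.toLp m) else 0

theorem coeFn_mulOp {m : P → ℂ} (hm : MemLp m ⊤ volume) (f : L2 P) :
    mulOp m f =ᵐ[volume] fun x => m x * f x := by
  rw [mulOp, dif_pos hm]
  filter_upwards [ContinuousLinearMap.coeFn_holder (r := 2) (ContinuousLinearMap.mul ℂ ℂ)
    (hm.toLp m) f, hm.coeFn_toLp] with x h1 h2
  rw [← h2]
  exact h1

theorem norm_le_of_ae_norm_le {f g : L2 P} {c : ℝ} (hc : 0 ≤ c)
    (h : ∀ᵐ x, ‖f x‖ ≤ c * ‖g x‖) : ‖f‖ ≤ c * ‖g‖ := by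
  have := Lp.norm_le_mul_norm_of_ae_le_mul h
  exact this

theorem norm_mulOp_apply_le {m : P → ℂ} (hm : MemLp m ⊤ volume) {c : ℝ} (hc : 0 ≤ c)
    (h : ∀ᵐ x, ‖m x‖ ≤ c) (f : L2 P) : ‖mulOp m f‖ ≤ c * ‖f‖ := by
  refine norm_le_of_ae_norm_le hc ?_
  filter_upwards [coeFn_mulOp hm f, h] with x h1 h2
  rw [h1, norm_mul]
  gcongr

theorem norm_mulOp_le {m : P → ℂ} (hm : MemLp m ⊤ volume) {c : ℝ} (hc : 0 ≤ c)
    (h : ∀ᵐ x, ‖m x‖ ≤ c) : ‖mulOp m‖ ≤ c :=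
  ContinuousLinearMap.opNorm_le_bound _ hc (norm_mulOp_apply_le hm hc h)

theorem inner_mulOp_left {m : P → ℂ} (hm : MemLp m ⊤ volume) (f g : L2 P) :
    ⟪mulOp m f, g⟫_ℂ = ⟪f, mulOp (fun x => conj (m x)) g⟫_ℂ := by
  have hm' : MemLp (fun x => conj (m x)) ⊤ volume := hm.star
  rw [L2.inner_def, L2.inner_def]
  apply integral_congr_ae
  filter_upwards [coeFn_mulOp hm f, coeFn_mulOp hm' g] with x h1 h2
  rw [h1, h2]
  simp only [RCLike.inner_apply, map_mul]
  ring

theorem mulOp_comp {m n : P → ℂ} (hm : MemLp m ⊤ volume) (hn : MemLp n ⊤ volume)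
    (hmn : MemLp (fun x => m x * n x) ⊤ volume) :
    mulOp m ∘L mulOp n = mulOp fun x => m x * n x := by
  ext1 f
  apply Lp.ext
  filter_upwards [coeFn_mulOp hm (mulOp n f), coeFn_mulOp hn f, coeFn_mulOp hmn f] with x h1 h2 h3
  rw [ContinuousLinearMap.comp_apply, h1, h2, h3, mul_assoc]

theorem mulOp_sub {m n : P → ℂ} (hm : MemLp m ⊤ volume) (hn : MemLp n ⊤ volume) :
    mulOp m - mulOp n = mulOp fun x => m x - n x := by
  ext1 f
  apply Lp.ext
  rw [_root_.sub_apply]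
  filter_upwards [coeFn_mulOp hm f, coeFn_mulOp hn f, coeFn_mulOp (hm.sub hn) f,
    Lp.coeFn_sub (mulOp m f) (mulOp n f)] with x h1 h2 h3 h4
  rw [h4, Pi.sub_apply, h1, h2]
  erw [h3]
  rw [Pi.sub_apply, sub_mul]

theorem mulOp_one : mulOp (fun _ : P => (1 : ℂ)) = ContinuousLinearMap.id ℂ (L2 P) := by
  ext1 f
  apply Lp.ext
  filter_upwards [coeFn_mulOp (memLp_top_const (1 : ℂ)) f] with x h1
  rw [h1, one_mul, ContinuousLinearMap.id_apply]

/-- The plane wave `x ↦ exp(2πi⟨v, x⟩)`. -/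
def phase (v x : P) : ℂ := (Real.fourierChar ⟪v, x⟫_ℝ : ℂ)

theorem norm_phase (v x : P) : ‖phase v x‖ = 1 :=
  Circle.norm_coe _

theorem continuous_phase (v : P) : Continuous (phase v) := by
  unfold phase
  fun_prop

theorem memLp_phase (v : P) : MemLp (phase v) ⊤ volume :=
  memLp_top_of_bound (continuous_phase v).aestronglyMeasurable 1
    (Eventually.of_forall fun x => (norm_phase v x).le)

theorem norm_phase_sub_one_le (v x : P) : ‖phase v x - 1‖ ≤ 2 * Real.pi * ‖v‖ * ‖x‖ := by
  have h : phase v x = Complex.exp (Complex.I * ((2 * Real.pi * ⟪v, x⟫_ℝ : ℝ) : ℂ)) := by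
    rw [phase, Real.fourierChar_apply, mul_comm Complex.I]
  rw [h]
  refine (Real.norm_exp_I_mul_ofReal_sub_one_le).trans ?_
  rw [Real.norm_eq_abs, abs_mul, abs_of_pos (by positivity : 0 < 2 * Real.pi), mul_assoc (2 * Real.pi) ‖v‖]
  exact mul_le_mul_of_nonneg_left (abs_real_inner_le_norm v x) (by positivity)

/-- Multiplication by the plane wave `exp(2πi⟨v, x⟩)`. -/
def phaseOp (v : P) : L2 P →L[ℂ] L2 P := mulOp (phase v)

theorem coeFn_phaseOp (v : P) (f : L2 P) : phaseOp v f =ᵐ[volume] fun x => phase v x * f x :=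
  coeFn_mulOp (memLp_phase v) f

theorem norm_phaseOp_apply (v : P) (f : L2 P) : ‖phaseOp v f‖ = ‖f‖ := by
  have h : eLpNorm (phaseOp v f) 2 volume = eLpNorm f 2 volume := by
    refine eLpNorm_congr_norm_ae ?_
    filter_upwards [coeFn_phaseOp v f] with x h1
    rw [h1, norm_mul, norm_phase, one_mul]
  rw [Lp.norm_def, Lp.norm_def, h]

theorem norm_phaseOp_le (v : P) : ‖phaseOp v‖ ≤ 1 :=
  ContinuousLinearMap.opNorm_le_bound _ zero_le_one fun f => by rw [norm_phaseOp_apply, one_mul]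

/-- Translation `f ↦ f(· + v)`. -/
def transOp (v : P) : L2 P →L[ℂ] L2 P :=
  (Lp.compMeasurePreservingₗᵢ ℂ (fun x : P => x + v)
    (measurePreserving_add_right volume v)).toContinuousLinearMap

theorem coeFn_transOp (v : P) (f : L2 P) : transOp v f =ᵐ[volume] fun x => f (x + v) :=
  Lp.coeFn_compMeasurePreserving f (measurePreserving_add_right volume v)

theorem norm_transOp_apply (v : P) (f : L2 P) : ‖transOp v f‖ = ‖f‖ :=
  LinearIsometry.norm_map _ f

theorem norm_transOp_le (v : P) : ‖transOp v‖ ≤ 1 :=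
  ContinuousLinearMap.opNorm_le_bound _ zero_le_one fun f => by rw [norm_transOp_apply, one_mul]

end Operators

/-! ### Algebra of tensor products of operators -/

section TensorAlgebra

variable {E F P : Type*}
  [NormedAddCommGroup E] [InnerProductSpace ℝ E] [FiniteDimensional ℝ E]
  [MeasurableSpace E] [BorelSpace E]
  [NormedAddCommGroup F] [InnerProductSpace ℝ F] [FiniteDimensional ℝ F]
  [MeasurableSpace F] [BorelSpace F]
  [NormedAddCommGroup P] [InnerProductSpace ℝ P] [FiniteDimensional ℝ P]
  [MeasurableSpace P] [BorelSpace P]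
  (s : P ≃ₗᵢ[ℝ] WithLp 2 (E × F))

theorem norm_elemTensor (f : L2 E) (g : L2 F) : ‖elemTensor s f g‖ = ‖f‖ * ‖g‖ := by
  rw [← tensorEmb_tmul, norm_tensorEmb, TensorProduct.norm_tmul]

theorem elemTensor_add_left (f f' : L2 E) (g : L2 F) :
    elemTensor s (f + f') g = elemTensor s f g + elemTensor s f' g := by
  simp only [← tensorEmb_tmul, TensorProduct.add_tmul, map_add]

theorem elemTensor_add_right (f : L2 E) (g g' : L2 F) :
    elemTensor s f (g + g') = elemTensor s f g + elemTensor s f g' := by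
  simp only [← tensorEmb_tmul, TensorProduct.tmul_add, map_add]

theorem elemTensor_smul_left (c : ℂ) (f : L2 E) (g : L2 F) :
    elemTensor s (c • f) g = c • elemTensor s f g := by
  simp only [← tensorEmb_tmul, ← TensorProduct.smul_tmul', map_smul]

theorem elemTensor_smul_right (c : ℂ) (f : L2 E) (g : L2 F) :
    elemTensor s f (c • g) = c • elemTensor s f g := by
  simp only [← tensorEmb_tmul, TensorProduct.tmul_smul, map_smul]

theorem elemTensor_sub_left (f f' : L2 E) (g : L2 F) :
    elemTensor s (f - f') g = elemTensor s f g - elemTensor s f' g := by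
  simp only [← tensorEmb_tmul, TensorProduct.sub_tmul, map_sub]

theorem tensorOp_tensorEmb (K : L2 E →L[ℂ] L2 E) (B : L2 F →L[ℂ] L2 F) (z : L2 E ⊗[ℂ] L2 F) :
    tensorOp s K B (tensorEmb s z) = tensorEmb s (TensorProduct.mapL K B z) := by
  induction z with
  | zero => simp
  | add a b ha hb => simp only [map_add, ha, hb]
  | tmul f g =>
    rw [tensorEmb_tmul, tensorOp_elemTensor]
    exact (tensorEmb_tmul s (K f) (B g)).symm

variable {s} in
-- Elementary tensors span a dense subspace. Most operator identities on `L2 P` below are reduced to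
-- elementary tensors by this.
theorem ext_elemTensor {X : Type*} [NormedAddCommGroup X] [NormedSpace ℂ X]
    {A B : L2 P →L[ℂ] X} (h : ∀ f g, A (elemTensor s f g) = B (elemTensor s f g)) : A = B := by
  ext1 x
  refine (denseRange_tensorEmb s).induction_on (p := fun x => A x = B x) x
    (isClosed_eq A.continuous B.continuous) fun z => ?_
  induction z with
  | zero => simp
  | add a b ha hb => simp only [map_add, ha, hb]
  | tmul f g => rw [tensorEmb_tmul, h]

/-- The bound holds on the algebraic tensor product with its Hilbert norm, which `tensorEmb` embeds
isometrically with dense range. -/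
theorem norm_tensorOp_le (K : L2 E →L[ℂ] L2 E) (B : L2 F →L[ℂ] L2 F) :
    ‖tensorOp s K B‖ ≤ ‖K‖ * ‖B‖ := by
  refine ContinuousLinearMap.opNorm_le_bound _ (by positivity) fun x => ?_
  refine (denseRange_tensorEmb s).induction_on
    (p := fun x => ‖tensorOp s K B x‖ ≤ ‖K‖ * ‖B‖ * ‖x‖) x
    (isClosed_le (by fun_prop) (by fun_prop)) fun z => ?_
  rw [tensorOp_tensorEmb, norm_tensorEmb, norm_tensorEmb]
  exact ((TensorProduct.mapL K B).le_opNorm z).trans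
    (mul_le_mul_of_nonneg_right (TensorProduct.norm_mapL_le K B) (norm_nonneg z))

theorem tensorOp_comp (K K' : L2 E →L[ℂ] L2 E) (B B' : L2 F →L[ℂ] L2 F) :
    tensorOp s K B ∘L tensorOp s K' B' = tensorOp s (K ∘L K') (B ∘L B') := by
  apply ext_elemTensor (s := s)
  intro f g
  simp only [ContinuousLinearMap.comp_apply, tensorOp_elemTensor]

theorem tensorOp_id : tensorOp s (.id ℂ (L2 E)) (.id ℂ (L2 F)) = .id ℂ (L2 P) := by
  apply ext_elemTensor (s := s)
  intro f g
  simp only [ContinuousLinearMap.id_apply, tensorOp_elemTensor]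

theorem tensorOp_sub_left (K K' : L2 E →L[ℂ] L2 E) (B : L2 F →L[ℂ] L2 F) :
    tensorOp s (K - K') B = tensorOp s K B - tensorOp s K' B := by
  apply ext_elemTensor (s := s)
  intro f g
  simp only [_root_.sub_apply, tensorOp_elemTensor, elemTensor_sub_left]

theorem tensorOp_sub_right (K : L2 E →L[ℂ] L2 E) (B B' : L2 F →L[ℂ] L2 F) :
    tensorOp s K (B - B') = tensorOp s K B - tensorOp s K B' := by
  apply ext_elemTensor (s := s)
  intro f g
  simp only [_root_.sub_apply, tensorOp_elemTensor]
  simp only [← tensorEmb_tmul, TensorProduct.tmul_sub, map_sub]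

theorem inner_tensorOp (K : L2 E →L[ℂ] L2 E) (B : L2 F →L[ℂ] L2 F) (x y : L2 P) :
    ⟪tensorOp s K B x, y⟫_ℂ = ⟪x, tensorOp s K.adjoint B.adjoint y⟫_ℂ := by
  rw [← ContinuousLinearMap.adjoint_inner_right]
  congr 1
  refine DFunLike.congr_fun (F := L2 P →L[ℂ] L2 P) ?_ y
  apply ext_elemTensor (s := s)
  intro f g
  refine ext_inner_left ℂ fun x => ?_
  rw [ContinuousLinearMap.adjoint_inner_right]
  -- The right argument is already an elementary tensor; here the left one is reduced as well, by
  -- comparing the two bounded functionals obtained after conjugation.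
  have := ext_elemTensor (s := s)
    (A := (innerSL ℂ (elemTensor s f g)) ∘L tensorOp s K B)
    (B := innerSL ℂ (tensorOp s K.adjoint B.adjoint (elemTensor s f g))) (fun f' g' => by
      simp only [ContinuousLinearMap.comp_apply, innerSL_apply_apply, tensorOp_elemTensor,
        inner_elemTensor, ContinuousLinearMap.adjoint_inner_left])
  have h := DFunLike.congr_fun this x
  simp only [ContinuousLinearMap.comp_apply, innerSL_apply_apply] at h
  rw [← inner_conj_symm, h, inner_conj_symm]

theorem adjoint_tensorOp (K : L2 E →L[ℂ] L2 E) (B : L2 F →L[ℂ] L2 F) :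
    (tensorOp s K B).adjoint = tensorOp s K.adjoint B.adjoint := by
  symm
  rw [ContinuousLinearMap.eq_adjoint_iff]
  intro x y
  rw [inner_tensorOp, ContinuousLinearMap.adjoint_adjoint, ContinuousLinearMap.adjoint_adjoint]

theorem mulOp_comp_fst {m : E → ℂ} (hm : MemLp m ⊤ volume) :
    mulOp (fun x : P => m (s x).fst) = tensorOp s (mulOp m) (.id ℂ (L2 F)) := by
  have hm' : MemLp (fun x : P => m (s x).fst) ⊤ volume := by
    obtain ⟨hm1, hm2⟩ := hm
    refine memLp_top_of_bound (hm1.comp_fst.comp_quasiMeasurePreserving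
      (measurePreserving_split s).quasiMeasurePreserving) (eLpNorm m ⊤ volume).toReal ?_
    exact ae_fst s (p := fun y => ‖m y‖ ≤ (eLpNorm m ⊤ volume).toReal) (by
      rw [eLpNorm_exponent_top] at hm2 ⊢
      filter_upwards [ae_le_eLpNormEssSup (f := m) (μ := volume)] with y hy
      rw [← toReal_enorm]
      exact ENNReal.toReal_mono hm2.ne hy)
  apply ext_elemTensor (s := s)
  intro f g
  rw [tensorOp_elemTensor]
  apply Lp.ext
  filter_upwards [coeFn_mulOp hm' (elemTensor s f g), coeFn_elemTensor s f g,
    coeFn_elemTensor s (mulOp m f) g, ae_fst s (coeFn_mulOp hm f)] with x h1 h2 h3 h4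
  rw [h1, h2, ContinuousLinearMap.id_apply, h3, h4, mul_assoc]

/-- The inner product is additive along an orthogonal splitting, so the character factors. For `v`
in the first subspace the second factor is trivial, which is how plane waves along `U` become
`phaseOp ⊗ 1`. -/
theorem phaseOp_eq_tensorOp (v : P) :
    phaseOp v = tensorOp s (phaseOp (s v).fst) (phaseOp (s v).snd) := by
  apply ext_elemTensor (s := s)
  intro f g
  rw [tensorOp_elemTensor]
  apply Lp.ext
  filter_upwards [coeFn_phaseOp v (elemTensor s f g), coeFn_elemTensor s f g,
    coeFn_elemTensor s (phaseOp (s v).fst f) (phaseOp (s v).snd g),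
    ae_fst s (coeFn_phaseOp (s v).fst f), ae_snd s (coeFn_phaseOp (s v).snd g)]
    with x h1 h2 h3 h4 h5
  have hp : phase v x = phase (s v).fst (s x).fst * phase (s v).snd (s x).snd := by
    unfold phase
    rw [← s.inner_map_map v x, WithLp.prod_inner_apply, AddChar.map_add_eq_mul, Circle.coe_mul]
    rfl
  rw [h1, h2, h3, h4, h5, hp]
  ring

theorem transOp_eq_tensorOp (v : P) :
    transOp v = tensorOp s (transOp (s v).fst) (transOp (s v).snd) := by
  apply ext_elemTensor (s := s)
  intro f g
  rw [tensorOp_elemTensor]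
  apply Lp.ext
  have hv := (measurePreserving_add_right (volume : Measure P) v).quasiMeasurePreserving
  filter_upwards [coeFn_transOp v (elemTensor s f g), hv.ae (coeFn_elemTensor s f g),
    coeFn_elemTensor s (transOp (s v).fst f) (transOp (s v).snd g),
    ae_fst s (coeFn_transOp (s v).fst f), ae_snd s (coeFn_transOp (s v).snd g)]
    with x h1 h2 h3 h4 h5
  rw [h1, h2, h3, h4, h5, map_add, WithLp.add_fst, WithLp.add_snd]

theorem phaseOp_zero : phaseOp (0 : P) = .id ℂ (L2 P) := by
  rw [phaseOp, ← mulOp_one]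
  congr 1
  ext x
  simp [phase]

theorem transOp_zero : transOp (0 : P) = .id ℂ (L2 P) := by
  ext1 f
  apply Lp.ext
  filter_upwards [coeFn_transOp (0 : P) f] with x h
  rw [h, add_zero, ContinuousLinearMap.id_apply]

end TensorAlgebra

end

end ManyBody

namespace ManyBody

open scoped FourierTransform ENNReal

noncomputable section

/-! ### The Fourier transform on `L²` -/

section FourierL2

variable {E : Type*} [NormedAddCommGroup E] [InnerProductSpace ℝ E] [FiniteDimensional ℝ E]
  [MeasurableSpace E] [BorelSpace E]

/-- Smooth compactly supported functions are Schwartz functions and already separate locally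
integrable functions. This turns distributional statements about Fourier transforms into pointwise
ones. -/
theorem ae_eq_of_forall_schwartz {f g : E → ℂ} (hf : LocallyIntegrable f volume)
    (hg : LocallyIntegrable g volume) (h : ∀ φ : 𝓢(E, ℂ), ∫ x, φ x * f x = ∫ x, φ x * g x) :
    f =ᵐ[volume] g := by
  refine ae_eq_of_integral_contDiff_smul_eq hf hg fun φ hφ hc => ?_
  have h1 : HasCompactSupport (Complex.ofRealCLM ∘ φ) := hc.comp_left rfl
  have h2 : ContDiff ℝ (⊤ : ℕ∞) (Complex.ofRealCLM ∘ φ) := Complex.ofRealCLM.contDiff.comp hφ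
  have := h (h1.toSchwartzMap h2)
  simpa using this

theorem locallyIntegrable_L2 (f : L2 E) : LocallyIntegrable f volume :=
  (Lp.memLp f).locallyIntegrable (by norm_num)

theorem integral_schwartz_mul_fourier (f : L2 E) (φ : 𝓢(E, ℂ)) :
    ∫ x, φ x * (𝓕 f : L2 E) x = ∫ x, (𝓕 φ) x * f x := by
  have h := DFunLike.congr_fun (Lp.fourier_toTemperedDistribution_eq f) φ
  rw [TemperedDistribution.fourier_apply] at h
  simp only [Lp.toTemperedDistribution_apply, smul_eq_mul] at h
  exact h.symm

theorem integral_schwartz_mul_fourierInv (f : L2 E) (φ : 𝓢(E, ℂ)) :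
    ∫ x, φ x * (𝓕⁻ f : L2 E) x = ∫ x, (𝓕⁻ φ) x * f x := by
  have h := DFunLike.congr_fun (Lp.fourierInv_toTemperedDistribution_eq f) φ
  rw [TemperedDistribution.fourierInv_apply] at h
  simp only [Lp.toTemperedDistribution_apply, smul_eq_mul] at h
  exact h.symm

/-- On `L¹ ∩ L²` the Fourier transform of `L²` is given by the Fourier integral. -/
theorem coeFn_fourier_of_integrable {f : L2 E} (hf : Integrable f volume) :
    (𝓕 f : L2 E) =ᵐ[volume] 𝓕 (f : E → ℂ) := by
  have hc : Continuous (𝓕 (f : E → ℂ)) :=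
    VectorFourier.fourierIntegral_continuous Real.continuous_fourierChar continuous_inner hf
  refine ae_eq_of_forall_schwartz (locallyIntegrable_L2 _) hc.locallyIntegrable fun φ => ?_
  rw [integral_schwartz_mul_fourier, SchwartzMap.fourier_coe]
  have := VectorFourier.integral_fourierIntegral_smul_eq_flip (L := innerₗ E) (f := (φ : E → ℂ))
    (g := (f : E → ℂ)) (μ := volume) (ν := volume) Real.continuous_fourierChar continuous_inner
    φ.integrable hf
  simp only [smul_eq_mul, flip_innerₗ] at this
  exact this

theorem coeFn_fourierInv_of_integrable {f : L2 E} (hf : Integrable f volume) :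
    (𝓕⁻ f : L2 E) =ᵐ[volume] 𝓕⁻ (f : E → ℂ) := by
  have hL : Continuous fun p : E × E => (-innerₗ E) p.1 p.2 := by
    simp only [LinearMap.neg_apply, innerₗ_apply_apply]
    fun_prop
  have hc : Continuous (𝓕⁻ (f : E → ℂ)) :=
    VectorFourier.fourierIntegral_continuous Real.continuous_fourierChar hL hf
  refine ae_eq_of_forall_schwartz (locallyIntegrable_L2 _) hc.locallyIntegrable fun φ => ?_
  rw [integral_schwartz_mul_fourierInv, SchwartzMap.fourierInv_coe]
  have := VectorFourier.integral_fourierIntegral_smul_eq_flip (L := -innerₗ E) (f := (φ : E → ℂ))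
    (g := (f : E → ℂ)) (μ := volume) (ν := volume) Real.continuous_fourierChar hL
    φ.integrable hf
  have hfl : (-innerₗ E).flip = -innerₗ E := by
    ext x y
    simp [real_inner_comm]
  rw [hfl] at this
  simp only [smul_eq_mul] at this
  exact this

/-- The Fourier transform as a bounded operator on `L²`. -/
def fourierOp (E : Type*) [NormedAddCommGroup E] [InnerProductSpace ℝ E] [FiniteDimensional ℝ E]
    [MeasurableSpace E] [BorelSpace E] : L2 E →L[ℂ] L2 E :=
  (Lp.fourierTransformₗᵢ E ℂ).toContinuousLinearEquiv.toContinuousLinearMap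

theorem fourierOp_apply (f : L2 E) : fourierOp E f = 𝓕 f := rfl

theorem adjoint_fourierOp_comp : (fourierOp E).adjoint ∘L fourierOp E = .id ℂ (L2 E) := by
  ext1 f
  refine ext_inner_left ℂ fun g => ?_
  rw [ContinuousLinearMap.comp_apply, ContinuousLinearMap.adjoint_inner_right]
  exact (Lp.fourierTransformₗᵢ E ℂ).inner_map_map g f

theorem transOp_toLp (h : E) (φ : 𝓢(E, ℂ)) :
    transOp h (φ.toLp 2 volume) = (φ.compSubConstCLM ℂ (-h)).toLp 2 volume := by
  apply Lp.ext
  have hq := (measurePreserving_add_right (volume : Measure E) h).quasiMeasurePreserving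
  filter_upwards [coeFn_transOp h (φ.toLp 2 volume), hq.ae (φ.coeFn_toLp 2 volume),
    (φ.compSubConstCLM ℂ (-h)).coeFn_toLp 2 volume] with x h1 h2 h3
  rw [h1, h2, h3, SchwartzMap.compSubConstCLM_apply, sub_neg_eq_add]

/-- The Fourier transform turns translations into plane waves. -/
theorem fourierOp_comp_transOp (h : E) :
    fourierOp E ∘L transOp h = phaseOp h ∘L fourierOp E := by
  ext1 f
  refine (SchwartzMap.denseRange_toLpCLM (p := 2) (μ := (volume : Measure E)) (F := ℂ)
    ENNReal.ofNat_ne_top).induction_on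
    (p := fun f => (fourierOp E ∘L transOp h) f = (phaseOp h ∘L fourierOp E) f) f
    (isClosed_eq (by fun_prop) (by fun_prop)) fun φ => ?_
  simp only [ContinuousLinearMap.comp_apply, SchwartzMap.toLpCLM_apply, fourierOp_apply]
  rw [transOp_toLp, SchwartzMap.toLp_fourier_eq, SchwartzMap.toLp_fourier_eq]
  apply Lp.ext
  filter_upwards [(𝓕 (φ.compSubConstCLM ℂ (-h))).coeFn_toLp 2 volume, (𝓕 φ).coeFn_toLp 2 volume,
    coeFn_phaseOp h ((𝓕 φ).toLp 2 volume)] with x h1 h2 h3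
  rw [h1, h3, h2, SchwartzMap.fourier_coe, SchwartzMap.fourier_coe]
  have := congrFun (VectorFourier.fourierIntegral_comp_add_right Real.fourierChar volume
    (innerₗ E) (φ : E → ℂ) h) x
  have he : ⇑(φ.compSubConstCLM ℂ (-h)) = (φ : E → ℂ) ∘ fun v => v + h := by
    ext v
    simp
  rw [he]
  exact this

end FourierL2

/-! ### Operators with square integrable kernels -/

section Kernel

variable {E : Type*} [NormedAddCommGroup E] [InnerProductSpace ℝ E] [FiniteDimensional ℝ E]
  [MeasurableSpace E] [BorelSpace E]

/-- Both sides are the bilinear pairing `∫ g u`. It makes the rank one operator with kernel `f(x)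
g(y)` linear in `g`, so that `finiteRank` is defined on the complex tensor product. -/
theorem inner_star_left (g u : L2 E) : ⟪star g, u⟫_ℂ = ⟪star u, g⟫_ℂ := by
  rw [L2.inner_def, L2.inner_def]
  apply integral_congr_ae
  filter_upwards [Lp.coeFn_star g, Lp.coeFn_star u] with x h1 h2
  rw [h1, h2]
  simp [mul_comm]

theorem norm_star_L2 (g : L2 E) : ‖star g‖ = ‖g‖ := by
  rw [Lp.norm_def, Lp.norm_def]
  congr 1
  refine eLpNorm_congr_norm_ae ?_
  filter_upwards [Lp.coeFn_star g] with x h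
  rw [h, Pi.star_apply, norm_star]

/-- The finite rank operator with the kernel `z`. -/
def finiteRank : L2 E ⊗[ℂ] L2 E →ₗ[ℂ] L2 E →L[ℂ] L2 E :=
  TensorProduct.lift (LinearMap.mk₂ ℂ
    (fun f g => ((innerSL ℂ (star g)).smulRight f : L2 E →L[ℂ] L2 E))
    (fun f f' g => by ext1 u; simp)
    (fun c f g => by
      ext1 u
      simp only [ContinuousLinearMap.smulRight_apply, _root_.smul_apply]
      rw [smul_comm])
    (fun f g g' => by
      ext1 u
      simp only [ContinuousLinearMap.smulRight_apply, _root_.add_apply, innerSL_apply_apply,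
        inner_star_left _ u, inner_add_right, add_smul])
    (fun c f g => by
      ext1 u
      simp only [ContinuousLinearMap.smulRight_apply, _root_.smul_apply, innerSL_apply_apply,
        inner_star_left _ u, inner_smul_right, mul_smul]))

theorem finiteRank_tmul (f g u : L2 E) : finiteRank (f ⊗ₜ g) u = ⟪star g, u⟫_ℂ • f := by
  simp [finiteRank]

/-- Matrix elements of an operator are pairings of its kernel with `φ(x) conj(u(y))`; this is the
convention in which kernels are compared below. -/
theorem inner_finiteRank (s : WithLp 2 (E × E) ≃ₗᵢ[ℝ] WithLp 2 (E × E)) (z : L2 E ⊗[ℂ] L2 E)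
    (φ u : L2 E) : ⟪φ, finiteRank z u⟫_ℂ = ⟪elemTensor s φ (star u), tensorEmb s z⟫_ℂ := by
  induction z with
  | zero => simp
  | add a b ha hb => simp only [map_add, _root_.add_apply, inner_add_right, ha, hb]
  | tmul f g =>
    rw [finiteRank_tmul, tensorEmb_tmul, inner_elemTensor, inner_smul_right, inner_star_left,
      mul_comm]

theorem isCompactOperator_finiteRank (z : L2 E ⊗[ℂ] L2 E) : IsCompactOperator (finiteRank z) := by
  induction z with
  | zero => rw [map_zero]; exact isCompactOperator_zero
  | add a b ha hb => rw [map_add]; exact ha.add hb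
  | tmul f g =>
    have : (finiteRank (f ⊗ₜ[ℂ] g) : L2 E → L2 E) =
        (ContinuousLinearMap.toSpanSingleton ℂ f) ∘ (innerSL ℂ (star g)) := by
      ext1 u
      simp [finiteRank_tmul]
    rw [this]
    have hc : IsCompactOperator (innerSL ℂ (star g)) :=
      isCompactOperator_of_locallyCompactSpace_dom (innerSL ℂ (star g))
    exact hc.clm_comp (ContinuousLinearMap.toSpanSingleton ℂ f)

/-- Operators with a square integrable kernel are compact. -/
theorem isCompactOperator_of_kernel (s : WithLp 2 (E × E) ≃ₗᵢ[ℝ] WithLp 2 (E × E))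
    (A : L2 E →L[ℂ] L2 E) (k : L2 (WithLp 2 (E × E)))
    (h : ∀ φ u, ⟪φ, A u⟫_ℂ = ⟪elemTensor s φ (star u), k⟫_ℂ) : IsCompactOperator A := by
  have hcl : IsClosed {A : L2 E →L[ℂ] L2 E | IsCompactOperator A} :=
    isClosed_setOfPred_isCompactOperator
  refine hcl.closure_subset (Metric.mem_closure_iff.2 fun ε hε => ?_)
  obtain ⟨z, hz⟩ := (Metric.denseRange_iff.1 (denseRange_tensorEmb s)) k (ε / 2) (by positivity)
  refine ⟨finiteRank z, isCompactOperator_finiteRank z, ?_⟩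
  rw [dist_eq_norm]
  refine lt_of_le_of_lt (ContinuousLinearMap.opNorm_le_bound _ (by positivity) fun u => ?_)
    (half_lt_self hε)
  rw [← sq_le_sq₀ (norm_nonneg _) (by positivity)]
  set φ := (A - finiteRank z) u with hφ
  -- Testing the difference against its own value `φ` bounds the operator norm by the `L²` norm of
  -- the difference of the kernels.
  have h1 : ⟪φ, φ⟫_ℂ = ⟪elemTensor s φ (star u), k - tensorEmb s z⟫_ℂ := by
    conv_lhs => rw [show ⟪φ, φ⟫_ℂ = ⟪φ, A u - finiteRank z u⟫_ℂ from rfl]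
    rw [inner_sub_right, inner_sub_right, h, inner_finiteRank s]
  have h2 : ‖φ‖ ^ 2 ≤ ‖φ‖ * ‖u‖ * (ε / 2) := by
    have h3 : ‖(⟪φ, φ⟫_ℂ)‖ = ‖φ‖ ^ 2 := by rw [inner_self_eq_norm_sq_to_K]; simp
    rw [← h3, h1]
    refine (norm_inner_le_norm _ _).trans ?_
    rw [norm_elemTensor, norm_star_L2]
    rw [dist_eq_norm] at hz
    gcongr
  rcases (norm_nonneg φ).eq_or_lt with h0 | h0
  · rw [← h0, sq, zero_mul]
    exact sq_nonneg _
  · have : ‖φ‖ ≤ ε / 2 * ‖u‖ := by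
      rw [sq, mul_assoc] at h2
      linarith [le_of_mul_le_mul_left h2 h0]
    gcongr

end Kernel

end

end ManyBody

namespace ManyBody

open scoped FourierTransform ENNReal

noncomputable section

/-! ### Localization in phase space -/

section Cutoff

variable {E F P : Type*}
  [NormedAddCommGroup E] [InnerProductSpace ℝ E] [FiniteDimensional ℝ E]
  [MeasurableSpace E] [BorelSpace E]
  [NormedAddCommGroup F] [InnerProductSpace ℝ F] [FiniteDimensional ℝ F]
  [MeasurableSpace F] [BorelSpace F]
  [NormedAddCommGroup P] [InnerProductSpace ℝ P] [FiniteDimensional ℝ P]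
  [MeasurableSpace P] [BorelSpace P]

/-- The indicator function of the closed ball of radius `N`. -/
def ballInd (E : Type*) [NormedAddCommGroup E] (N : ℝ) : E → ℂ :=
  (Metric.closedBall (0 : E) N).indicator 1

theorem norm_ballInd_le (N : ℝ) (x : E) : ‖ballInd E N x‖ ≤ 1 := by
  by_cases h : x ∈ Metric.closedBall (0 : E) N <;> simp [ballInd, h]

theorem measurable_ballInd (N : ℝ) : Measurable (ballInd E N) :=
  measurable_one.indicator measurableSet_closedBall

theorem memLp_ballInd (N : ℝ) : MemLp (ballInd E N) ⊤ volume :=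
  memLp_top_of_bound (measurable_ballInd N).aestronglyMeasurable 1
    (Eventually.of_forall (norm_ballInd_le N))

theorem memLp_two_ballInd (N : ℝ) : MemLp (ballInd E N) 2 volume :=
  memLp_indicator_const 2 measurableSet_closedBall (1 : ℂ) (Or.inr measure_closedBall_lt_top.ne)

/-- Multiplication by the indicator function of a ball. -/
def ballOp (E : Type*) [NormedAddCommGroup E] [InnerProductSpace ℝ E] [FiniteDimensional ℝ E]
    [MeasurableSpace E] [BorelSpace E] (N : ℝ) : L2 E →L[ℂ] L2 E := mulOp (ballInd E N)

theorem coeFn_ballOp (N : ℝ) (f : L2 E) :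
    ballOp E N f =ᵐ[volume] fun x => ballInd E N x * f x := coeFn_mulOp (memLp_ballInd N) f

theorem norm_ballOp_le (N : ℝ) : ‖ballOp E N‖ ≤ 1 :=
  norm_mulOp_le (memLp_ballInd N) zero_le_one (Eventually.of_forall (norm_ballInd_le N))

theorem integrable_ballOp (N : ℝ) (f : L2 E) : Integrable (ballOp E N f) volume :=
  ((memLp_two_ballInd N).integrable_mul (Lp.memLp f)).congr (coeFn_ballOp N f).symm

theorem inner_ballOp_left (N : ℝ) (f g : L2 E) : ⟪ballOp E N f, g⟫_ℂ = ⟪f, ballOp E N g⟫_ℂ := by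
  have h : (fun x => conj (ballInd E N x)) = ballInd E N := by
    ext x
    by_cases h : x ∈ Metric.closedBall (0 : E) N <;> simp [ballInd, h]
  rw [ballOp, inner_mulOp_left (memLp_ballInd N), h]

/-- Cutting off in position and in momentum gives a compact operator. -/
theorem isCompactOperator_ballOp_fourierOp_ballOp (N : ℝ) :
    IsCompactOperator (ballOp E N ∘L fourierOp E ∘L ballOp E N) := by
  -- The kernel `exp(-2πi⟨y, x⟩)` of the Fourier transform, restricted to a product of two balls and
  -- therefore square integrable.
  let k : WithLp 2 (E × E) → ℂ := fun z =>
    ballInd E N z.fst * ballInd E N z.snd * phase (-z.snd) z.fst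
  have hsp := measurePreserving_split (LinearIsometryEquiv.refl ℝ (WithLp 2 (E × E)))
  have hk : MemLp k 2 volume := by
    have h1 : MemLp (fun z : WithLp 2 (E × E) => ballInd E N z.fst * ballInd E N z.snd) 2
        volume := by
      have h0 : MemLp (fun z : E × E => ballInd E N z.1 * ballInd E N z.2) 2
          ((volume : Measure E).prod volume) := by
        have := memLp_mul_prod ((memLp_two_ballInd (E := E) N).toLp _)
          ((memLp_two_ballInd (E := E) N).toLp _)
        refine (memLp_congr_ae ?_).1 this
        filter_upwards [Measure.quasiMeasurePreserving_fst.ae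
          (memLp_two_ballInd (E := E) N).coeFn_toLp, Measure.quasiMeasurePreserving_snd.ae
          (memLp_two_ballInd (E := E) N).coeFn_toLp] with z h1 h2
        rw [h1, h2]
      exact h0.comp_measurePreserving hsp
    have hph : Continuous fun z : WithLp 2 (E × E) => phase (-z.snd) z.fst := by
      unfold phase
      fun_prop
    refine h1.of_le (h1.1.mul hph.aestronglyMeasurable) (Eventually.of_forall fun z => ?_)
    rw [norm_mul, norm_phase, mul_one]
  refine isCompactOperator_of_kernel (LinearIsometryEquiv.refl ℝ _) _ (hk.toLp k) fun φ u => ?_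
  have hF : ((fourierOp E (ballOp E N u) : L2 E) : E → ℂ) =ᵐ[volume]
      𝓕 (ballOp E N u : E → ℂ) := coeFn_fourier_of_integrable (integrable_ballOp N u)
  rw [ContinuousLinearMap.comp_apply, ContinuousLinearMap.comp_apply, ← inner_ballOp_left,
    L2.inner_def, L2.inner_def]
  have hem : MeasurableEmbedding (fun x : WithLp 2 (E × E) =>
      WithLp.ofLp (LinearIsometryEquiv.refl ℝ (WithLp 2 (E × E)) x)) :=
    (MeasurableEquiv.toLp 2 (E × E)).symm.measurableEmbedding
  have hR : ∫ z : WithLp 2 (E × E), ⟪elemTensor (LinearIsometryEquiv.refl ℝ _) φ (star u) z,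
      (hk.toLp k) z⟫_ℂ = ∫ z : E × E, conj (ballOp E N φ z.1) *
        ((Real.fourierChar (-⟪z.2, z.1⟫_ℝ) : ℂ) * ballOp E N u z.2)
          ∂((volume : Measure E).prod volume) := by
    rw [← hsp.integral_comp hem]
    apply integral_congr_ae
    filter_upwards [coeFn_elemTensor (LinearIsometryEquiv.refl ℝ _) φ (star u), hk.coeFn_toLp,
      ae_fst (LinearIsometryEquiv.refl ℝ (WithLp 2 (E × E))) (coeFn_ballOp N φ),
      ae_snd (LinearIsometryEquiv.refl ℝ (WithLp 2 (E × E))) (coeFn_ballOp N u),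
      ae_snd (LinearIsometryEquiv.refl ℝ (WithLp 2 (E × E))) (Lp.coeFn_star u)]
      with z h1 h2 h3 h4 h5
    simp only [LinearIsometryEquiv.coe_refl, id_eq] at h1 h2 h3 h4 h5 ⊢
    have hreal : conj (ballInd E N z.fst) = ballInd E N z.fst := by
      by_cases h : z.fst ∈ Metric.closedBall (0 : E) N <;> simp [ballInd, h]
    have h3' : (ballOp E N φ) z.ofLp.1 = ballInd E N z.fst * φ z.fst := h3
    have h4' : (ballOp E N u) z.ofLp.2 = ballInd E N z.snd * u z.snd := h4
    rw [h1, h2, h3', h4', h5]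
    simp only [RCLike.inner_apply, map_mul, hreal, k, phase, inner_neg_left, Pi.star_apply,
      RCLike.star_def, Complex.conj_conj]
    have : (⟪z.snd, z.fst⟫_ℝ) = ⟪z.ofLp.2, z.ofLp.1⟫_ℝ := rfl
    rw [this]
    ring
  rw [hR, integral_prod]
  · apply integral_congr_ae
    filter_upwards [hF] with x hx
    rw [hx, RCLike.inner_apply, integral_const_mul, mul_comm]
    congr 1
  · have hp : Integrable (fun z : E × E => conj (ballOp E N φ z.1) * ballOp E N u z.2)
        ((volume : Measure E).prod volume) :=
      Integrable.mul_prod (f := fun x => conj (ballOp E N φ x)) (Complex.conjCLE.integrable_comp_iff.2 (integrable_ballOp N φ))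
        (integrable_ballOp N u)
    have hc : Continuous fun z : E × E => (Real.fourierChar (-⟪z.2, z.1⟫_ℝ) : ℂ) := by fun_prop
    refine hp.mono (hp.1.mul hc.aestronglyMeasurable |>.congr ?_)
      (Eventually.of_forall fun z => ?_)
    · refine Eventually.of_forall fun z => ?_
      simp only [Pi.mul_apply]
      ring
    · simp only [norm_mul, RCLike.norm_conj, Circle.norm_coe, one_mul, le_refl]

/-- The mean of `|exp(2πi⟨k, y⟩) - 1|²` over small `k` is bounded below for large `y`. -/
theorem exists_volume_le_lintegral_phase {δ : ℝ} :
    ∃ N : ℝ, ∀ y : E, N < ‖y‖ → volume (Metric.ball (0 : E) δ) ≤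
      ∫⁻ k in Metric.ball (0 : E) δ, ‖phase k y - 1‖ₑ ^ 2 := by
  set B := Metric.ball (0 : E) δ
  have hBf : volume B ≠ ⊤ := measure_ball_lt_top.ne
  have hrl := (tendsto_integral_exp_inner_smul_cocompact (B.indicator (1 : E → ℂ)))
  by_cases h0 : volume B = 0
  · exact ⟨0, fun y _ => by rw [h0]; exact zero_le⟩
  have hpos : 0 < (volume B).toReal := ENNReal.toReal_pos h0 hBf
  -- By the Riemann–Lebesgue lemma the integral of the character over the ball tends to zero. Half
  -- the volume suffices: `|phase - 1|² = 2 - 2 Re c`, so the integral is at least `2 vol - vol`.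
  have hev := (Metric.tendsto_nhds.1 hrl) ((volume B).toReal / 2) (by positivity)
  obtain ⟨t, ht, hts⟩ := mem_cocompact.1 hev
  obtain ⟨N, hN⟩ := ht.isBounded.exists_norm_le
  refine ⟨N, fun y hy => ?_⟩
  have hy' : y ∈ tᶜ := fun h => (hN y h).not_gt hy
  have hsm := hts hy'
  rw [Set.mem_ofPred_eq, dist_zero_right] at hsm
  have hBm : MeasurableSet B := measurableSet_ball
  have hfin : IsFiniteMeasure (volume.restrict B) := isFiniteMeasure_restrict.2 hBf
  let c : E → ℂ := fun k => (Real.fourierChar (-⟪k, y⟫_ℝ) : ℂ)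
  have hc : Continuous c := by fun_prop
  have hc1 : ∀ k, ‖c k‖ = 1 := fun k => Circle.norm_coe _
  have hci : Integrable c (volume.restrict B) :=
    Integrable.of_bound hc.aestronglyMeasurable 1 (Eventually.of_forall fun k => (hc1 k).le)
  have hint : ∫ v, Real.fourierChar (-⟪v, y⟫_ℝ) • B.indicator (1 : E → ℂ) v = ∫ k in B, c k := by
    rw [← integral_indicator hBm]
    congr 1
    ext k
    by_cases hk : k ∈ B <;> simp [hk, c, Circle.smul_def]
  rw [hint] at hsm
  have hpt : ∀ k, ‖phase k y - 1‖ₑ ^ 2 = ENNReal.ofReal (2 - 2 * (c k).re) := fun k => by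
    have h1 : phase k y = conj (c k) := by
      simp only [phase, c, AddChar.map_neg_eq_inv, Circle.coe_inv_eq_conj, Complex.conj_conj]
    have h2 : ‖phase k y - 1‖ ^ 2 = 2 - 2 * (c k).re := by
      have h3 := hc1 k
      have h4 : (c k).re * (c k).re + (c k).im * (c k).im = 1 := by
        rw [← Complex.normSq_apply, Complex.normSq_eq_norm_sq, h3, one_pow]
      rw [h1, ← Complex.normSq_eq_norm_sq, Complex.normSq_apply]
      simp only [Complex.sub_re, Complex.sub_im, Complex.conj_re, Complex.conj_im, Complex.one_re,
        Complex.one_im]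
      linear_combination h4
    rw [← h2, ENNReal.ofReal_pow (norm_nonneg _), ofReal_norm]
  simp_rw [hpt]
  have hre : Integrable (fun k => 2 - 2 * (c k).re) (volume.restrict B) :=
    (integrable_const _).sub (hci.re.const_mul 2)
  rw [← ofReal_integral_eq_lintegral_ofReal hre (Eventually.of_forall fun k => by
    have := (Complex.re_le_norm (c k)).trans_eq (hc1 k)
    simp only [Pi.zero_apply]
    linarith), ← ENNReal.ofReal_toReal hBf]
  apply ENNReal.ofReal_le_ofReal
  have hsum : ∫ k in B, (2 - 2 * (c k).re) = 2 * (volume B).toReal - 2 * (∫ k in B, c k).re := by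
    have hr : ∫ k in B, (c k).re = (∫ k in B, c k).re := integral_re hci
    have hcr : Integrable (fun k => 2 * (c k).re) (volume.restrict B) := hci.re.const_mul 2
    rw [integral_sub (integrable_const _) hcr, integral_const_mul, ← hr]
    simp [Measure.real, mul_comm]
  rw [hsum]
  have := (Complex.re_le_norm (∫ k in B, c k))
  linarith

theorem enorm_sq_eq_lintegral (f : L2 P) : ‖f‖ₑ ^ 2 = ∫⁻ x, ‖f x‖ₑ ^ 2 := by
  rw [Lp.enorm_def]
  have := eLpNorm_nnreal_pow_eq_lintegral (μ := (volume : Measure P)) (f := f) (p := 2) (by simp)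
  simpa using this

/-- If `(e^{2πi⟨k, ·⟩} ⊗ 1) X → X` in norm as `k → 0`, then `X` is concentrated on bounded sets in
the first variable, up to an error that is small in norm. -/
theorem exists_ballOp_approx (s : P ≃ₗᵢ[ℝ] WithLp 2 (E × F)) {X : L2 P →L[ℂ] L2 P}
    (hX : ∀ ε > 0, ∃ δ > 0, ∀ k : E, ‖k‖ < δ →
      ‖tensorOp s (phaseOp k) (.id ℂ (L2 F)) ∘L X - X‖ ≤ ε) {ε : ℝ} (hε : 0 < ε) :
    ∃ N₀ : ℝ, ∀ N ≥ N₀, ‖tensorOp s (ballOp E N) (.id ℂ (L2 F)) ∘L X - X‖ ≤ ε := by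
  obtain ⟨δ, hδ, hk⟩ := hX ε hε
  obtain ⟨N₀, hN₀⟩ := exists_volume_le_lintegral_phase (E := E) (δ := δ)
  refine ⟨N₀, fun N hN => ContinuousLinearMap.opNorm_le_bound _ hε.le fun u => ?_⟩
  set B := Metric.ball (0 : E) δ
  have hB0 : volume B ≠ 0 := (Metric.measure_ball_pos _ _ hδ).ne'
  have hBf : volume B ≠ ⊤ := measure_ball_lt_top.ne
  rw [_root_.sub_apply, ContinuousLinearMap.comp_apply]
  set η := X u with hη
  set A := tensorOp s (ballOp E N) (.id ℂ (L2 F)) η - η with hA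
  have hAae : ∀ᵐ x, A x = (ballInd E N (s x).fst - 1) * η x := by
    have hm : MemLp (fun x : P => ballInd E N (s x).fst) ⊤ volume :=
      memLp_top_of_bound ((measurable_ballInd N).comp (measurable_fst.comp
        (measurePreserving_split s).measurable)).aestronglyMeasurable 1
        (Eventually.of_forall fun x => norm_ballInd_le N _)
    have h1 := coeFn_mulOp hm η
    rw [mulOp_comp_fst s (memLp_ballInd N)] at h1
    filter_upwards [h1, Lp.coeFn_sub (tensorOp s (ballOp E N) (.id ℂ (L2 F)) η) η] with x h1 h2
    rw [h2, Pi.sub_apply, sub_mul, one_mul]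
    exact congrArg (· - η x) h1
  have hphase : ∀ k ∈ B, ∫⁻ x, ‖phase k (s x).fst - 1‖ₑ ^ 2 * ‖η x‖ₑ ^ 2 ≤
      ENNReal.ofReal ((ε * ‖u‖) ^ 2) := fun k hkB => by
    have h1 : ‖tensorOp s (phaseOp k) (.id ℂ (L2 F)) η - η‖ ≤ ε * ‖u‖ :=
      ((tensorOp s (phaseOp k) (.id ℂ (L2 F)) ∘L X - X).le_opNorm u).trans
        (mul_le_mul_of_nonneg_right (hk k (by simpa [B] using hkB)) (norm_nonneg u))
    have h2 : ∫⁻ x, ‖phase k (s x).fst - 1‖ₑ ^ 2 * ‖η x‖ₑ ^ 2 =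
        ‖tensorOp s (phaseOp k) (.id ℂ (L2 F)) η - η‖ₑ ^ 2 := by
      rw [enorm_sq_eq_lintegral]
      apply lintegral_congr_ae
      have hm : MemLp (fun x : P => phase k (s x).fst) ⊤ volume :=
        memLp_top_of_bound ((continuous_phase k).measurable.comp (measurable_fst.comp
          (measurePreserving_split s).measurable)).aestronglyMeasurable 1
          (Eventually.of_forall fun x => (norm_phase k _).le)
      have h1 := coeFn_mulOp hm η
      rw [mulOp_comp_fst s (memLp_phase k)] at h1
      filter_upwards [h1, Lp.coeFn_sub (tensorOp s (phaseOp k) (.id ℂ (L2 F)) η) η] with x h1 h2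
      rw [h2, Pi.sub_apply]
      erw [h1]
      rw [← sub_one_mul, enorm_mul, mul_pow]
    rw [h2, ← ofReal_norm, ← ENNReal.ofReal_pow (norm_nonneg _)]
    gcongr
  have hmeas : Measurable fun z : E × P => ‖phase z.1 (s z.2).fst - 1‖ₑ ^ 2 := by
    have : Continuous fun z : E × P => phase z.1 (s z.2).fst - 1 := by
      unfold phase
      fun_prop
    exact this.enorm.measurable.pow_const 2
  have hηm : AEMeasurable (fun x => ‖η x‖ₑ ^ 2) (volume : Measure P) :=
    (Lp.memLp η).1.enorm.pow_const 2
  -- Average the hypothesis over `k ∈ B` and exchange the integrals. Outside the ball of radius `N`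
  -- the mean of `|phase - 1|²` is at least one, so it dominates the indicator of the part cut away.
  have key : volume B * ‖A‖ₑ ^ 2 ≤ volume B * ENNReal.ofReal ((ε * ‖u‖) ^ 2) := by
    calc volume B * ‖A‖ₑ ^ 2
        ≤ ∫⁻ x, (∫⁻ k in B, ‖phase k (s x).fst - 1‖ₑ ^ 2 * ‖η x‖ₑ ^ 2) := by
          rw [enorm_sq_eq_lintegral, ← lintegral_const_mul' _ _ hBf]
          apply lintegral_mono_ae
          filter_upwards [hAae] with x hx
          rw [hx, enorm_mul, mul_pow, ← mul_assoc,
            lintegral_mul_const' _ _ (by finiteness)]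
          gcongr
          by_cases hb : (s x).fst ∈ Metric.closedBall (0 : E) N
          · simp [ballInd, hb]
          · have hN' : N₀ < ‖(s x).fst‖ := by
              rw [mem_closedBall_zero_iff, not_le] at hb
              exact hN.trans_lt hb
            simpa [ballInd, hb] using hN₀ _ hN'
      _ = ∫⁻ k in B, (∫⁻ x, ‖phase k (s x).fst - 1‖ₑ ^ 2 * ‖η x‖ₑ ^ 2) := by
          rw [lintegral_lintegral_swap]
          exact ((hmeas.comp measurable_swap).aemeasurable.mul hηm.comp_fst)
      _ ≤ ∫⁻ k in B, ENNReal.ofReal ((ε * ‖u‖) ^ 2) :=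
          setLIntegral_mono measurable_const hphase
      _ = volume B * ENNReal.ofReal ((ε * ‖u‖) ^ 2) := by
          rw [setLIntegral_const, mul_comm]
  rw [ENNReal.mul_le_mul_iff_right hB0 hBf, ← ofReal_norm, ← ENNReal.ofReal_pow (norm_nonneg _),
    ENNReal.ofReal_le_ofReal_iff (by positivity)] at key
  exact (sq_le_sq₀ (norm_nonneg _) (by positivity)).1 key

/-- If `(e^{2πi⟨k, ·⟩} ⊗ 1) X → X` and `(τ_h ⊗ 1) X → X` in norm as `k, h → 0`, then `X` is
approximated in norm by the operators `(K ⊗ 1) X` with `K` compact. -/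
theorem exists_compact_approx (s : P ≃ₗᵢ[ℝ] WithLp 2 (E × F)) {X : L2 P →L[ℂ] L2 P}
    (hX : ∀ ε > 0, ∃ δ > 0, ∀ k : E, ‖k‖ < δ →
      ‖tensorOp s (phaseOp k) (.id ℂ (L2 F)) ∘L X - X‖ ≤ ε)
    (hX' : ∀ ε > 0, ∃ δ > 0, ∀ h : E, ‖h‖ < δ →
      ‖tensorOp s (transOp h) (.id ℂ (L2 F)) ∘L X - X‖ ≤ ε) {ε : ℝ} (hε : 0 < ε) :
    ∃ K : L2 E →L[ℂ] L2 E, IsCompactOperator K ∧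
      ‖tensorOp s K (.id ℂ (L2 F)) ∘L X - X‖ ≤ ε := by
  -- Conjugation by the Fourier transform turns translations into plane waves, so the position
  -- cutoff lemma applied to `W ∘L X` gives a momentum cutoff of `X`.
  set W := tensorOp s (fourierOp E) (.id ℂ (L2 F)) with hW
  set W' := tensorOp s (fourierOp E).adjoint (.id ℂ (L2 F)) with hW'
  have hF1 : ‖fourierOp E‖ ≤ 1 :=
    ContinuousLinearMap.opNorm_le_bound _ zero_le_one fun f => by
      rw [one_mul]; exact ((Lp.fourierTransformₗᵢ E ℂ).norm_map f).le
  have hW1 : ‖W‖ ≤ 1 := (norm_tensorOp_le s _ _).trans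
    (mul_le_one₀ hF1 (norm_nonneg _) ContinuousLinearMap.norm_id_le)
  have hW'1 : ‖W'‖ ≤ 1 := (norm_tensorOp_le s _ _).trans
    (mul_le_one₀ ((LinearIsometryEquiv.norm_map _ _).trans_le hF1) (norm_nonneg _)
      ContinuousLinearMap.norm_id_le)
  have hWW : W' ∘L W = .id ℂ (L2 P) := by
    rw [hW, hW', tensorOp_comp, adjoint_fourierOp_comp, ContinuousLinearMap.id_comp, tensorOp_id]
  obtain ⟨N₁, hN₁⟩ := exists_ballOp_approx s hX (half_pos hε)
  have hWX : ∀ ε > 0, ∃ δ > 0, ∀ k : E, ‖k‖ < δ →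
      ‖tensorOp s (phaseOp k) (.id ℂ (L2 F)) ∘L (W ∘L X) - W ∘L X‖ ≤ ε := by
    intro ε hε
    obtain ⟨δ, hδ, h⟩ := hX' ε hε
    refine ⟨δ, hδ, fun k hk => ?_⟩
    have : tensorOp s (phaseOp k) (.id ℂ (L2 F)) ∘L (W ∘L X) - W ∘L X =
        W ∘L (tensorOp s (transOp k) (.id ℂ (L2 F)) ∘L X - X) := by
      rw [ContinuousLinearMap.comp_sub, ← ContinuousLinearMap.comp_assoc,
        ← ContinuousLinearMap.comp_assoc, hW, tensorOp_comp, tensorOp_comp, fourierOp_comp_transOp]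
    rw [this]
    refine (ContinuousLinearMap.opNorm_comp_le _ _).trans ?_
    exact (mul_le_of_le_one_left (norm_nonneg _) hW1).trans (h k hk)
  obtain ⟨N₂, hN₂⟩ := exists_ballOp_approx s hWX (half_pos hε)
  set N := max N₁ N₂
  set b := tensorOp s (ballOp E N) (.id ℂ (L2 F)) with hb
  have hb1 : ‖b‖ ≤ 1 := (norm_tensorOp_le s _ _).trans
    (mul_le_one₀ (norm_ballOp_le N) (norm_nonneg _) ContinuousLinearMap.norm_id_le)
  -- Cut off in position, pass to momentum, cut off there, and return. Each cutoff costs at most `ε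
  -- / 2`, since all factors are contractions.
  refine ⟨(fourierOp E).adjoint ∘L (ballOp E N ∘L fourierOp E ∘L ballOp E N),
    IsCompactOperator.clm_comp (isCompactOperator_ballOp_fourierOp_ballOp N)
      (fourierOp E).adjoint, ?_⟩
  have hK : tensorOp s ((fourierOp E).adjoint ∘L (ballOp E N ∘L fourierOp E ∘L ballOp E N))
      (.id ℂ (L2 F)) = W' ∘L (b ∘L W ∘L b) := by
    simp only [hW, hW', hb, tensorOp_comp, ContinuousLinearMap.id_comp]
  have hdec : W' ∘L (b ∘L W ∘L b) ∘L X - X =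
      W' ∘L (b ∘L (W ∘L (b ∘L X - X))) + W' ∘L (b ∘L (W ∘L X) - W ∘L X) := by
    ext1 u
    have h1 := DFunLike.congr_fun hWW (X u)
    simp only [ContinuousLinearMap.comp_apply, _root_.sub_apply, _root_.add_apply, map_sub,
      ContinuousLinearMap.id_apply] at h1 ⊢
    rw [h1]
    abel
  rw [hK, ContinuousLinearMap.comp_assoc, hdec]
  refine (norm_add_le _ _).trans ?_
  rw [← add_halves ε]
  gcongr
  · refine (ContinuousLinearMap.opNorm_comp_le _ _).trans ?_
    refine (mul_le_of_le_one_left (norm_nonneg _) hW'1).trans ?_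
    refine (ContinuousLinearMap.opNorm_comp_le _ _).trans ?_
    refine (mul_le_of_le_one_left (norm_nonneg _) hb1).trans ?_
    refine (ContinuousLinearMap.opNorm_comp_le _ _).trans ?_
    exact (mul_le_of_le_one_left (norm_nonneg _) hW1).trans (hN₁ N (le_max_left _ _))
  · refine (ContinuousLinearMap.opNorm_comp_le _ _).trans ?_
    exact (mul_le_of_le_one_left (norm_nonneg _) hW'1).trans (hN₂ N (le_max_right _ _))

end Cutoff

end

end ManyBody

namespace ManyBody

open scoped FourierTransform ENNReal

noncomputable section

/-! ### Double series, compactness and orthonormal bases -/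

section Summation

/-- If `∑ Q i` acts from both sides on `T` as an approximate identity, then `T` is the sum of the
series of all `Q a * T * Q b`, ordered by squares. -/
theorem tendsto_sum_unpair {A : Type*} [NormedRing A] (Q : ℕ → A) (T : A) {C : ℝ}
    (hC : ∀ n, ‖∑ i ∈ Finset.range n, Q i‖ ≤ C)
    (hl : Tendsto (fun n => (∑ i ∈ Finset.range n, Q i) * T) atTop (𝓝 T))
    (hr : Tendsto (fun n => T * ∑ i ∈ Finset.range n, Q i) atTop (𝓝 T)) :
    Tendsto (fun N => ∑ j ∈ Finset.range N, Q j.unpair.1 * T * Q j.unpair.2) atTop (𝓝 T) := by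
  set p : ℕ → A := fun n => ∑ i ∈ Finset.range n, Q i with hp
  have hps : ∀ n, p (n + 1) = p n + Q n := fun n => Finset.sum_range_succ _ _
  have hC0 : 0 ≤ C := (norm_nonneg _).trans (hC 0)
  set S : ℕ → A := fun N => ∑ j ∈ Finset.range N, Q j.unpair.1 * T * Q j.unpair.2 with hS
  have hSs : ∀ N, S (N + 1) = S N + Q N.unpair.1 * T * Q N.unpair.2 :=
    fun N => Finset.sum_range_succ _ _
  -- `Nat.unpair` enumerates pairs square by square. After the first `n * n` terms come `(0, n), …,
  -- (n - 1, n)` and then `(n, 0), …, (n, n)`, so every partial sum is a full square plus part of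
  -- one column and one row.
  have hlow : ∀ n m, S (n * n) = p n * T * p n → m ≤ n →
      S (n * n + m) = p n * T * p n + p m * T * Q n := by
    intro n m h0 hm
    induction m with
    | zero => simp [h0, hp]
    | succ m ih =>
      have hu : (n * n + m).unpair = (m, n) := by
        rw [← Nat.unpair_pair m n, Nat.pair, if_pos (by omega)]
      rw [← add_assoc, hSs, ih (by omega), hu, hps]
      noncomm_ring
  have hhigh : ∀ n m, S (n * n) = p n * T * p n → m ≤ n + 1 →
      S (n * n + n + m) = p n * T * p n + p n * T * Q n + Q n * T * p m := by
    intro n m h0 hm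
    induction m with
    | zero => simp [hlow n n h0 le_rfl, hp]
    | succ m ih =>
      have hu : (n * n + n + m).unpair = (n, m) := by
        rw [← Nat.unpair_pair n m, Nat.pair, if_neg (by omega)]
      rw [← add_assoc, hSs, ih (by omega), hu, hps]
      noncomm_ring
  have hsq : ∀ n, S (n * n) = p n * T * p n := by
    intro n
    induction n with
    | zero => simp [hS, hp]
    | succ n ih =>
      rw [show (n + 1) * (n + 1) = n * n + n + (n + 1) by ring, hhigh n (n + 1) ih le_rfl, hps]
      noncomm_ring
  -- Differences of consecutive terms of a convergent sequence; they control the incomplete column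
  -- and row.
  have hQl : Tendsto (fun n => Q n * T) atTop (𝓝 0) := by
    have := (hl.comp (tendsto_add_atTop_nat 1)).sub hl
    rw [sub_self] at this
    refine this.congr fun n => ?_
    simp only [Function.comp_apply]
    rw [← sub_mul]
    exact congrArg (· * T) (by rw [Finset.sum_range_succ, add_sub_cancel_left])
  have hQr : Tendsto (fun n => T * Q n) atTop (𝓝 0) := by
    have := (hr.comp (tendsto_add_atTop_nat 1)).sub hr
    rw [sub_self] at this
    refine this.congr fun n => ?_
    simp only [Function.comp_apply]
    rw [← mul_sub]
    exact congrArg (T * ·) (by rw [Finset.sum_range_succ, add_sub_cancel_left])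
  have hb : Tendsto (fun n => ‖p n * T - T‖ + C * ‖T * p n - T‖ + C * ‖T * Q n‖ + C * ‖Q n * T‖)
      atTop (𝓝 0) := by
    have h1 := (tendsto_iff_norm_sub_tendsto_zero.1 hl)
    have h2 := (tendsto_iff_norm_sub_tendsto_zero.1 hr).const_mul C
    have h3 := hQr.norm.const_mul C
    have h4 := hQl.norm.const_mul C
    simpa using ((h1.add h2).add h3).add h4
  have hsqrt : Tendsto Nat.sqrt atTop atTop :=
    tendsto_atTop_atTop.2 fun b => ⟨b * b, fun a ha => Nat.le_sqrt.2 ha⟩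
  rw [tendsto_iff_norm_sub_tendsto_zero]
  refine squeeze_zero (fun _ => norm_nonneg _) (fun N => ?_) (hb.comp hsqrt)
  simp only [Function.comp_apply]
  set n := N.sqrt with hn
  have h1 : n * n ≤ N := Nat.sqrt_le N
  have h2 : N < (n + 1) * (n + 1) := Nat.sqrt_lt.1 (Nat.lt_succ_self _)
  have hbound : ∀ a b, ‖p n * T * p n + p a * T * Q n + Q n * T * p b - T‖ ≤
      ‖p n * T - T‖ + C * ‖T * p n - T‖ + C * ‖T * Q n‖ + C * ‖Q n * T‖ := by
    intro a b
    have hd : p n * T * p n + p a * T * Q n + Q n * T * p b - T =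
        (p n * T - T) + p n * (T * p n - T) + p a * (T * Q n) + Q n * T * p b := by noncomm_ring
    rw [hd]
    refine norm_add₄_le.trans ?_
    gcongr
    · exact (norm_mul_le _ _).trans (mul_le_mul_of_nonneg_right (hC n) (norm_nonneg _))
    · exact (norm_mul_le _ _).trans (mul_le_mul_of_nonneg_right (hC a) (norm_nonneg _))
    · rw [mul_comm C]
      exact (norm_mul_le _ _).trans (mul_le_mul_of_nonneg_left (hC b) (norm_nonneg _))
  rcases le_or_gt N (n * n + n) with h | h
  · obtain ⟨m, hm⟩ := Nat.exists_eq_add_of_le h1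
    have := hlow n m (hsq n) (by omega)
    -- The row has not been started here: `p 0 = 0` removes its term.
    have h0 := hbound m 0
    rw [← hm] at this
    change ‖S N - T‖ ≤ _
    rw [this]
    simpa [hp] using h0
  · obtain ⟨m, hm⟩ := Nat.exists_eq_add_of_lt h
    have := hhigh n (m + 1) (hsq n) (by nlinarith)
    have hN : n * n + n + (m + 1) = N := by omega
    rw [hN] at this
    have h0 := hbound n (m + 1)
    rw [← this] at h0
    exact h0

/-- A strongly null sequence composed with a compact operator is a null sequence in norm. -/
theorem tendsto_comp_compact {H : Type*} [NormedAddCommGroup H] [NormedSpace ℂ H]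
    {p : ℕ → H →L[ℂ] H} {C : ℝ} (hC : ∀ n, ‖p n‖ ≤ C)
    (hp : ∀ x, Tendsto (fun n => p n x) atTop (𝓝 0)) {K : H →L[ℂ] H} (hK : IsCompactOperator K) :
    Tendsto (fun n => p n ∘L K) atTop (𝓝 0) := by
  have hC0 : 0 ≤ C := (norm_nonneg _).trans (hC 0)
  have htb : TotallyBounded (K '' Metric.closedBall 0 1) :=
    (hK.isCompact_closure_image_closedBall 1).totallyBounded.subset subset_closure
  rw [Metric.tendsto_atTop]
  intro ε hε
  obtain ⟨t, htf, ht⟩ := Metric.totallyBounded_iff.1 htb (ε / (4 * (C + 1))) (by positivity)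
  have hev : ∀ᶠ n in atTop, ∀ y ∈ t, ‖p n y‖ < ε / 4 := by
    rw [htf.eventually_all]
    intro y _
    have := (hp y).norm
    rw [norm_zero] at this
    exact this.eventually_lt_const (by positivity)
  obtain ⟨N, hN⟩ := eventually_atTop.1 hev
  refine ⟨N, fun n hn => ?_⟩
  rw [dist_zero_right]
  refine lt_of_le_of_lt (ContinuousLinearMap.opNorm_le_of_unit_norm (C := ε / 2)
    (by positivity) fun x hx => ?_) (half_lt_self hε)
  have hxm : K x ∈ K '' Metric.closedBall 0 1 := ⟨x, by simp [hx], rfl⟩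
  obtain ⟨y, hy, hxy⟩ := Set.mem_iUnion₂.1 (ht hxm)
  rw [Metric.mem_ball, dist_eq_norm] at hxy
  have h1 : (p n ∘L K) x = p n (K x - y) + p n y := by simp
  rw [h1]
  refine (norm_add_le _ _).trans ?_
  have h2 : ‖p n (K x - y)‖ ≤ ε / 4 := by
    refine ((p n).le_opNorm _).trans ?_
    calc ‖p n‖ * ‖K x - y‖ ≤ (C + 1) * (ε / (4 * (C + 1))) := by
          gcongr
          linarith [hC n]
      _ = ε / 4 := by field_simp
  linarith [hN n hn y hy]

/-- A separable Hilbert space has an orthonormal basis enumerated by `ℕ`, with zeros allowed. -/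
theorem exists_basis_sequence (H : Type*) [NormedAddCommGroup H] [InnerProductSpace ℂ H]
    [CompleteSpace H] [TopologicalSpace.SeparableSpace H] :
    ∃ b : ℕ → H, ∀ x, Tendsto (fun n => ∑ i ∈ Finset.range n, ⟪b i, x⟫_ℂ • b i) atTop (𝓝 x) := by
  obtain ⟨w, b, hb⟩ := exists_hilbertBasis ℂ H
  -- Distinct orthonormal vectors have distance `√2`, so the balls of radius `1/2` around them are
  -- disjoint open sets in a separable space.
  have hw : Countable w := by
    rw [Set.countable_coe_iff]
    refine Set.PairwiseDisjoint.countable_of_isOpen (s := fun x : H => Metric.ball x (1 / 2))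
      (fun x hx y hy hxy => ?_) (fun _ _ => Metric.isOpen_ball)
      (fun x _ => Metric.nonempty_ball.2 (by norm_num))
    refine Metric.ball_disjoint_ball ?_
    have ho := b.orthonormal
    have h1 : ‖x‖ = 1 := by simpa [hb] using ho.1 ⟨x, hx⟩
    have h2 : ‖y‖ = 1 := by simpa [hb] using ho.1 ⟨y, hy⟩
    have h3 : ⟪x, y⟫_ℂ = 0 := by
      simpa [hb] using ho.2 (i := ⟨x, hx⟩) (j := ⟨y, hy⟩) (by simpa using hxy)
    have h4 := @norm_sub_sq ℂ _ _ _ _ x y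
    rw [h3, h1, h2] at h4
    simp only [map_zero, mul_zero, sub_zero, one_pow] at h4
    rw [dist_eq_norm]
    nlinarith [norm_nonneg (x - y)]
  obtain ⟨f, hf⟩ := hw.exists_injective_nat
  refine ⟨Function.extend f (fun i => b i) 0, fun x => ?_⟩
  have h1 : HasSum (fun i : w => ⟪b i, x⟫_ℂ • b i) x := by
    simpa only [b.repr_apply_apply] using b.hasSum_repr x
  have h2 : HasSum (fun n => ⟪Function.extend f (fun i => b i) 0 n, x⟫_ℂ •
      Function.extend f (fun i => b i) 0 n) x := by
    refine (hf.hasSum_iff ?_).1 ?_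
    · intro n hn
      rw [Function.extend_apply' _ _ _ (by simpa using hn)]
      simp
    · simpa only [Function.comp_def, hf.extend_apply] using h1
  exact h2.tendsto_sum_nat

end Summation

/-! ### From approximation by compact operators to a series -/

section Semicompact

variable {E F P : Type*}
  [NormedAddCommGroup E] [InnerProductSpace ℝ E] [FiniteDimensional ℝ E]
  [MeasurableSpace E] [BorelSpace E]
  [NormedAddCommGroup F] [InnerProductSpace ℝ F] [FiniteDimensional ℝ F]
  [MeasurableSpace F] [BorelSpace F]
  [NormedAddCommGroup P] [InnerProductSpace ℝ P] [FiniteDimensional ℝ P]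
  [MeasurableSpace P] [BorelSpace P]
  (s : P ≃ₗᵢ[ℝ] WithLp 2 (E × F))

/-- The operator `g ↦ f ⊗ g`. -/
def tensorLeft (f : L2 E) : L2 F →L[ℂ] L2 P :=
  LinearMap.mkContinuous
    { toFun := fun g => elemTensor s f g
      map_add' := elemTensor_add_right s f
      map_smul' := fun c g => elemTensor_smul_right s c f g } ‖f‖
    (fun g => (norm_elemTensor s f g).le)

theorem tensorLeft_apply (f : L2 E) (g : L2 F) : tensorLeft s f g = elemTensor s f g := rfl

theorem adjoint_tensorLeft_elemTensor (f f' : L2 E) (g : L2 F) :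
    (tensorLeft s f).adjoint (elemTensor s f' g) = ⟪f, f'⟫_ℂ • g := by
  refine ext_inner_left ℂ fun x => ?_
  rw [ContinuousLinearMap.adjoint_inner_right, tensorLeft_apply, inner_elemTensor,
    inner_smul_right]

/-- The rank one operator `x ↦ ⟨g, x⟩ f`. -/
def rankOne (f g : L2 E) : L2 E →L[ℂ] L2 E := (innerSL ℂ g).smulRight f

theorem rankOne_apply (f g x : L2 E) : rankOne f g x = ⟪g, x⟫_ℂ • f := rfl

theorem isCompactOperator_rankOne (f g : L2 E) : IsCompactOperator (rankOne f g) := by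
  have hc : IsCompactOperator (innerSL ℂ g) :=
    isCompactOperator_of_locallyCompactSpace_dom (innerSL ℂ g)
  exact hc.clm_comp (ContinuousLinearMap.toSpanSingleton ℂ f)

theorem tensorOp_rankOne_eq (f g : L2 E) :
    tensorOp s (rankOne f g) (.id ℂ (L2 F)) = tensorLeft s f ∘L (tensorLeft s g).adjoint := by
  apply ext_elemTensor (s := s)
  intro f' g'
  rw [tensorOp_elemTensor, ContinuousLinearMap.comp_apply, adjoint_tensorLeft_elemTensor,
    tensorLeft_apply, rankOne_apply, elemTensor_smul_left, elemTensor_smul_right,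
    ContinuousLinearMap.id_apply]

/-- A rank one factor makes the operator pass through `L2 F`. Read backwards, this identifies the
`B` in a compression of `T` between two basis vectors. -/
theorem tensorOp_rankOne (f g : L2 E) (B : L2 F →L[ℂ] L2 F) :
    tensorOp s (rankOne f g) B = tensorLeft s f ∘L B ∘L (tensorLeft s g).adjoint := by
  apply ext_elemTensor (s := s)
  intro f' g'
  rw [tensorOp_elemTensor, ContinuousLinearMap.comp_apply, ContinuousLinearMap.comp_apply,
    adjoint_tensorLeft_elemTensor, tensorLeft_apply, rankOne_apply, elemTensor_smul_left, map_smul,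
    elemTensor_smul_right]

/-- A self-adjoint operator that is approximated by the operators `(K ⊗ 1) T` with `K` compact is a
norm convergent sum of operators `K ⊗ B` with `K` compact. -/
theorem exists_hasSum_tensorOp {T : L2 P →L[ℂ] L2 P} (hT : IsSelfAdjoint T)
    (h : ∀ ε > 0, ∃ K : L2 E →L[ℂ] L2 E, IsCompactOperator K ∧
      ‖tensorOp s K (.id ℂ (L2 F)) ∘L T - T‖ ≤ ε) :
    ∃ (K : ℕ → L2 E →L[ℂ] L2 E) (B : ℕ → L2 F →L[ℂ] L2 F), (∀ j, IsCompactOperator (K j)) ∧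
      Tendsto (fun n => ∑ j ∈ Finset.range n, tensorOp s (K j) (B j)) atTop (𝓝 T) := by
  -- Required by the instance giving separability of `L2 E`.
  have : Fact ((2 : ENNReal) ≠ ⊤) := ⟨ENNReal.ofNat_ne_top⟩
  obtain ⟨b, hb⟩ := exists_basis_sequence (L2 E)
  let q : ℕ → L2 E →L[ℂ] L2 E := fun i => rankOne (b i) (b i)
  let Q : ℕ → L2 P →L[ℂ] L2 P := fun i => tensorOp s (q i) (.id ℂ (L2 F))
  have hqa : ∀ i, (q i).adjoint = q i := fun i => by
    symm
    rw [ContinuousLinearMap.eq_adjoint_iff]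
    intro x y
    simp only [q, rankOne_apply, inner_smul_left, inner_smul_right, inner_conj_symm]
    ring
  have hsum : ∀ n, ∑ i ∈ Finset.range n, Q i =
      tensorOp s (∑ i ∈ Finset.range n, q i) (.id ℂ (L2 F)) := fun n => by
    apply ext_elemTensor (s := s)
    intro f g
    simp only [Q, _root_.sum_apply, tensorOp_elemTensor]
    simp only [← tensorEmb_tmul, TensorProduct.sum_tmul, map_sum]
  have hq : ∀ x, Tendsto (fun n => (∑ i ∈ Finset.range n, q i) x) atTop (𝓝 x) := fun x => by
    simpa only [_root_.sum_apply, q, rankOne_apply] using hb x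
  -- Only strong convergence of the partial sums is known from `exists_basis_sequence`; uniform
  -- boundedness supplies the constant that orthogonality would give.
  obtain ⟨C, hC⟩ := banach_steinhaus (g := fun n => ∑ i ∈ Finset.range n, q i) fun x => by
    obtain ⟨C, hC⟩ := (Metric.isBounded_range_of_tendsto _ (hq x)).exists_norm_le
    exact ⟨C, fun n => hC _ ⟨n, rfl⟩⟩
  have hidn : ‖ContinuousLinearMap.id ℂ (L2 F)‖ ≤ 1 := ContinuousLinearMap.norm_id_le
  have hCP : ∀ n, ‖∑ i ∈ Finset.range n, Q i‖ ≤ C := fun n => by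
    rw [hsum]
    exact (norm_tensorOp_le s _ _).trans
      ((mul_le_of_le_one_right (norm_nonneg _) hidn).trans (hC n))
  have hC0 : 0 ≤ C := (norm_nonneg _).trans (hC 0)
  -- Strong convergence `p_n → 1` becomes norm convergence after composition with a compact `K`, and
  -- `(K ⊗ 1) T` is close to `T`.
  have hl : Tendsto (fun n => (∑ i ∈ Finset.range n, Q i) * T) atTop (𝓝 T) := by
    rw [Metric.tendsto_atTop]
    intro ε hε
    obtain ⟨K, hK, hKT⟩ := h (ε / (2 * (C + 2))) (by positivity)
    have hpk : Tendsto (fun n => (∑ i ∈ Finset.range n, q i - .id ℂ (L2 E)) ∘L K) atTop (𝓝 0) := by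
      refine tendsto_comp_compact (C := C + 1) (fun n => ?_) (fun x => ?_) hK
      · exact (norm_sub_le _ _).trans (add_le_add (hC n) ContinuousLinearMap.norm_id_le)
      · have := (hq x).sub_const x
        rwa [sub_self] at this
    obtain ⟨N, hN⟩ := Metric.tendsto_atTop.1 hpk (ε / (2 * (‖T‖ + 1))) (by positivity)
    refine ⟨N, fun n hn => ?_⟩
    have h1 := hN n hn
    rw [dist_zero_right] at h1
    rw [dist_eq_norm]
    set p := ∑ i ∈ Finset.range n, Q i with hp
    have hdec : p * T - T = tensorOp s ((∑ i ∈ Finset.range n, q i - .id ℂ (L2 E)) ∘L K)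
        (.id ℂ (L2 F)) ∘L T - (p ∘L (tensorOp s K (.id ℂ (L2 F)) ∘L T - T) -
          (tensorOp s K (.id ℂ (L2 F)) ∘L T - T)) := by
      have : tensorOp s ((∑ i ∈ Finset.range n, q i - .id ℂ (L2 E)) ∘L K) (.id ℂ (L2 F)) =
          p ∘L tensorOp s K (.id ℂ (L2 F)) - tensorOp s K (.id ℂ (L2 F)) := by
        rw [hp, hsum, tensorOp_comp, ContinuousLinearMap.id_comp, ← tensorOp_sub_left,
          ContinuousLinearMap.sub_comp, ContinuousLinearMap.id_comp]
      rw [this]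
      ext1 x
      simp only [_root_.sub_apply, ContinuousLinearMap.comp_apply, ContinuousLinearMap.mul_def,
        map_sub]
      abel
    rw [hdec]
    refine lt_of_le_of_lt (norm_sub_le _ _) ?_
    have h2 : ‖tensorOp s ((∑ i ∈ Finset.range n, q i - .id ℂ (L2 E)) ∘L K) (.id ℂ (L2 F)) ∘L T‖ ≤
        ε / (2 * (‖T‖ + 1)) * ‖T‖ := by
      refine (ContinuousLinearMap.opNorm_comp_le _ _).trans ?_
      gcongr
      exact (norm_tensorOp_le s _ _).trans
        ((mul_le_of_le_one_right (norm_nonneg _) hidn).trans h1.le)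
    have h3 : ε / (2 * (‖T‖ + 1)) * ‖T‖ < ε / 2 := by
      rw [div_mul_eq_mul_div, div_lt_div_iff₀ (by positivity) (by positivity)]
      nlinarith [norm_nonneg T]
    have h4 : ‖p ∘L (tensorOp s K (.id ℂ (L2 F)) ∘L T - T) -
          (tensorOp s K (.id ℂ (L2 F)) ∘L T - T)‖ ≤ (C + 2) * (ε / (2 * (C + 2))) := by
      refine (norm_sub_le _ _).trans ?_
      have := (ContinuousLinearMap.opNorm_comp_le p
        (tensorOp s K (.id ℂ (L2 F)) ∘L T - T)).trans
        (mul_le_mul (hCP n) hKT (norm_nonneg _) hC0)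
      have h5 : (0:ℝ) ≤ ε / (2 * (C + 2)) := by positivity
      linarith
    have h6 : (C + 2) * (ε / (2 * (C + 2))) = ε / 2 := by field_simp
    linarith
  -- The adjoint of the preceding limit; this is where selfadjointness of `T` and of the partial
  -- sums enters.
  have hr : Tendsto (fun n => T * ∑ i ∈ Finset.range n, Q i) atTop (𝓝 T) := by
    have := (continuous_star.tendsto _).comp hl
    rw [hT.star_eq] at this
    refine this.congr fun n => ?_
    simp only [Function.comp_apply, star_mul, hT.star_eq, star_sum]
    congr 1
    refine Finset.sum_congr rfl fun i _ => ?_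
    rw [ContinuousLinearMap.star_eq_adjoint, adjoint_tensorOp, hqa]
    congr 1
    exact ContinuousLinearMap.adjoint_id
  -- With `L_i g = b_i ⊗ g`, the product `(q_i ⊗ 1) T (q_k ⊗ 1)` equals `L_i (L_i* T L_k) L_k*`,
  -- that is, `|b_i⟩⟨b_k| ⊗ (L_i* T L_k)`.
  refine ⟨fun j => rankOne (b j.unpair.1) (b j.unpair.2),
    fun j => (tensorLeft s (b j.unpair.1)).adjoint ∘L T ∘L tensorLeft s (b j.unpair.2),
    fun j => isCompactOperator_rankOne _ _, ?_⟩
  refine (tendsto_sum_unpair Q T hCP hl hr).congr fun N => Finset.sum_congr rfl fun j _ => ?_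
  rw [tensorOp_rankOne]
  simp only [Q, q, tensorOp_rankOne_eq, ContinuousLinearMap.mul_def,
    ContinuousLinearMap.comp_assoc]

end Semicompact

end

end ManyBody

namespace ManyBody

open scoped FourierTransform ENNReal

noncomputable section

/-! ### Asymptotic commutation in norm -/

section AsympComm

variable {A : Type*} [NormedRing A] {ι : Type*}

/-- The family `U` commutes asymptotically with `X` in norm. -/
def AsympComm (U : ι → A) (l : Filter ι) (X : A) : Prop :=
  Tendsto (fun i => U i * X - X * U i) l (𝓝 0)

variable {U : ι → A} {l : Filter ι}

theorem AsympComm.add {X Y : A} (hX : AsympComm U l X) (hY : AsympComm U l Y) :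
    AsympComm U l (X + Y) := by
  have := Tendsto.add hX hY
  rw [add_zero] at this
  refine this.congr fun i => ?_
  noncomm_ring

theorem tendsto_zero_mul_of_bounded {a b : ι → A} (ha : Tendsto a l (𝓝 0)) {C : ℝ}
    (hb : ∀ i, ‖b i‖ ≤ C) : Tendsto (fun i => a i * b i) l (𝓝 0) := by
  rw [tendsto_zero_iff_norm_tendsto_zero] at ha ⊢
  have := ha.mul_const C
  rw [zero_mul] at this
  exact squeeze_zero (fun _ => norm_nonneg _) (fun i => (norm_mul_le _ _).trans
    (mul_le_mul_of_nonneg_left (hb i) (norm_nonneg _))) this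

theorem tendsto_bounded_mul_zero {a b : ι → A} (hb : Tendsto b l (𝓝 0)) {C : ℝ}
    (ha : ∀ i, ‖a i‖ ≤ C) : Tendsto (fun i => a i * b i) l (𝓝 0) := by
  rw [tendsto_zero_iff_norm_tendsto_zero] at hb ⊢
  have := hb.const_mul C
  rw [mul_zero] at this
  exact squeeze_zero (fun _ => norm_nonneg _) (fun i => (norm_mul_le _ _).trans
    (mul_le_mul_of_nonneg_right (ha i) (norm_nonneg _))) this

theorem AsympComm.mul {X Y : A} (hX : AsympComm U l X) (hY : AsympComm U l Y) :
    AsympComm U l (X * Y) := by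
  have h1 := tendsto_zero_mul_of_bounded (b := fun _ => Y) hX (fun _ => le_rfl)
  have h2 := tendsto_bounded_mul_zero (a := fun _ => X) hY (fun _ => le_rfl)
  have := h1.add h2
  rw [add_zero] at this
  refine this.congr fun i => ?_
  noncomm_ring

/-- The commutators satisfy `[U, Y] = -Y [U, X] Y`. -/
theorem AsympComm.inverse {X Y : A} (hX : AsympComm U l X) (h1 : X * Y = 1) (h2 : Y * X = 1) :
    AsympComm U l Y := by
  have h3 := tendsto_zero_mul_of_bounded (b := fun _ => Y) hX (fun _ => le_rfl)
  have h4 := tendsto_bounded_mul_zero (a := fun _ => -Y) h3 (fun _ => le_rfl)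
  refine h4.congr fun i => ?_
  have : -Y * ((U i * X - X * U i) * Y) = Y * X * U i * Y - Y * U i * (X * Y) := by noncomm_ring
  rw [this, h1, h2, one_mul, mul_one]

/-- For contractions `U i`, the map `X ↦ [U i, X]` is Lipschitz with constant two, uniformly in `i`.
-/
theorem isClosed_asympComm (hU : ∀ i, ‖U i‖ ≤ 1) : IsClosed {X | AsympComm U l X} := by
  refine isClosed_of_closure_subset fun X hX => ?_
  rw [Set.mem_ofPred_eq, AsympComm, Metric.tendsto_nhds]
  intro ε hε
  obtain ⟨Y, hY, hXY⟩ := Metric.mem_closure_iff.1 hX (ε / 4) (by positivity)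
  filter_upwards [(Metric.tendsto_nhds.1 hY) (ε / 2) (by positivity)] with i hi
  rw [dist_zero_right] at hi ⊢
  rw [dist_eq_norm] at hXY
  have h1 : U i * X - X * U i = U i * (X - Y) - (X - Y) * U i + (U i * Y - Y * U i) := by
    noncomm_ring
  have h2 : ‖U i * (X - Y)‖ ≤ ‖X - Y‖ :=
    (norm_mul_le _ _).trans (mul_le_of_le_one_left (norm_nonneg _) (hU i))
  have h3 : ‖(X - Y) * U i‖ ≤ ‖X - Y‖ :=
    (norm_mul_le _ _).trans (mul_le_of_le_one_right (norm_nonneg _) (hU i))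
  rw [h1]
  linarith [norm_add_le (U i * (X - Y) - (X - Y) * U i) (U i * Y - Y * U i),
    norm_sub_le (U i * (X - Y)) ((X - Y) * U i)]

theorem asympComm_of_commute {X : A} (h : ∀ i, U i * X = X * U i) : AsympComm U l X := by
  refine tendsto_const_nhds.congr fun i => ?_
  rw [h, sub_self]

/-- The elements that, together with their adjoints, commute asymptotically with `U`. -/
def asympCommSubalgebra {H : Type*} [NormedAddCommGroup H] [InnerProductSpace ℂ H]
    [CompleteSpace H] (U : ι → H →L[ℂ] H) (l : Filter ι) : StarSubalgebra ℂ (H →L[ℂ] H) where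
  carrier := {X | AsympComm U l X ∧ AsympComm U l (star X)}
  mul_mem' hX hY := ⟨hX.1.mul hY.1, by rw [star_mul]; exact hY.2.mul hX.2⟩
  add_mem' hX hY := ⟨hX.1.add hY.1, by rw [star_add]; exact hX.2.add hY.2⟩
  algebraMap_mem' c := by
    have h : ∀ c : ℂ, AsympComm U l (algebraMap ℂ (H →L[ℂ] H) c) :=
      fun c => asympComm_of_commute fun i => (Algebra.commutes c (U i)).symm
    refine ⟨h c, ?_⟩
    rw [← algebraMap_star_comm]
    exact h _
  star_mem' hX := ⟨hX.2, by rw [star_star]; exact hX.1⟩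

/-- The square root lies in the closed star algebra generated by `S`, and the operators that commute
asymptotically together with their adjoints form a closed star algebra containing `S`. -/
theorem asympComm_sqrt {H : Type*} [NormedAddCommGroup H] [InnerProductSpace ℂ H]
    [CompleteSpace H] {U : ι → H →L[ℂ] H} (hU : ∀ i, ‖U i‖ ≤ 1) {S : H →L[ℂ] H} (hS : 0 ≤ S)
    (h : AsympComm U l S) : AsympComm U l (CFC.sqrt S) := by
  have hsa : IsSelfAdjoint S := IsSelfAdjoint.of_nonneg hS
  have hcl : IsClosed (asympCommSubalgebra U l : Set (H →L[ℂ] H)) :=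
    (isClosed_asympComm hU).inter ((isClosed_asympComm hU).preimage continuous_star)
  have hmem : S ∈ asympCommSubalgebra U l := ⟨h, by rw [hsa.star_eq]; exact h⟩
  have hle := StarAlgebra.elemental.le_of_mem hcl hmem
  have hR : CFC.sqrt S ∈ StarAlgebra.elemental ℂ S := by
    rw [CFC.sqrt_eq_real_sqrt S, cfcₙ_eq_cfc, cfc_real_eq_complex]
    exact cfc_mem_elemental _ _
  exact (hle hR).1

end AsympComm

/-! ### The inverse of a sum of commuting positive inverses -/

section InverseSum

variable {H : Type*} [NormedAddCommGroup H] [InnerProductSpace ℂ H] [CompleteSpace H]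

/-- The orthogonal complement of the range is the kernel of the adjoint. Inverses that need not be
bounded are replaced below by such dense ranges. -/
theorem denseRange_of_selfAdjoint_injective {A : H →L[ℂ] H} (hA : IsSelfAdjoint A)
    (h : ∀ x, A x = 0 → x = 0) : DenseRange A := by
  have h1 : (A : H →ₗ[ℂ] H).rangeᗮ = ⊥ := by
    rw [ContinuousLinearMap.orthogonal_range, ← ContinuousLinearMap.star_eq_adjoint, hA.star_eq,
      Submodule.eq_bot_iff]
    exact fun x hx => h x hx
  exact (Submodule.dense_iff_topologicalClosure_eq_top).2
    ((Submodule.topologicalClosure_eq_top_iff).2 h1)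

theorem IsSelfAdjoint.inner_left {A : H →L[ℂ] H} (hA : IsSelfAdjoint A) (x y : H) :
    ⟪A x, y⟫_ℂ = ⟪x, A y⟫_ℂ := by
  rw [← ContinuousLinearMap.adjoint_inner_right, ← ContinuousLinearMap.star_eq_adjoint, hA.star_eq]

variable {A₁ A₂ : H →L[ℂ] H}

/-- By commutation the cross term is `‖A₁ A₂ z‖²`, which is nonnegative. Hence each summand alone is
dominated in norm by the sum. -/
theorem norm_sq_sum_squares (h₁ : IsSelfAdjoint A₁) (h₂ : IsSelfAdjoint A₂)
    (hc : A₁ * A₂ = A₂ * A₁) (z : H) :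
    ‖(A₁ * A₁ + A₂ * A₂) z‖ ^ 2 =
      ‖(A₁ * A₁) z‖ ^ 2 + 2 * ‖(A₁ * A₂) z‖ ^ 2 + ‖(A₂ * A₂) z‖ ^ 2 := by
  have hc' : ∀ x, A₁ (A₂ x) = A₂ (A₁ x) := fun x => DFunLike.congr_fun hc x
  rw [_root_.add_apply, @norm_add_sq ℂ]
  have : ⟪(A₁ * A₁) z, (A₂ * A₂) z⟫_ℂ = ((‖(A₁ * A₂) z‖ ^ 2 : ℝ) : ℂ) := by
    simp only [mul_apply_eq_comp]
    rw [IsSelfAdjoint.inner_left h₁, hc', ← IsSelfAdjoint.inner_left h₂, ← hc',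
      inner_self_eq_norm_sq_to_K]
    simp
  rw [this]
  simp only [RCLike.re_to_complex, Complex.ofReal_re]

theorem sum_squares_injective (h₁ : IsSelfAdjoint A₁) (h₂ : IsSelfAdjoint A₂)
    (hi : ∀ x, A₁ x = 0 → x = 0) (x : H) (hx : (A₁ * A₁ + A₂ * A₂) x = 0) : x = 0 := by
  refine hi x ?_
  have h : ⟪x, (A₁ * A₁ + A₂ * A₂) x⟫_ℂ = ((‖A₁ x‖ ^ 2 + ‖A₂ x‖ ^ 2 : ℝ) : ℂ) := by
    simp only [_root_.add_apply, mul_apply_eq_comp, inner_add_right]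
    rw [← IsSelfAdjoint.inner_left h₁, ← IsSelfAdjoint.inner_left h₂, inner_self_eq_norm_sq_to_K,
      inner_self_eq_norm_sq_to_K]
    simp
  rw [hx, inner_zero_right] at h
  have h' : ‖A₁ x‖ ^ 2 + ‖A₂ x‖ ^ 2 = 0 := by exact_mod_cast h.symm
  have : ‖A₁ x‖ ^ 2 = 0 := by nlinarith [sq_nonneg ‖A₁ x‖, sq_nonneg ‖A₂ x‖]
  simpa using this

/-- The bounded operator `S = (G₁⁻¹ + G₂⁻¹)⁻¹ = G₁ G₂ (G₁ + G₂)⁻¹` for the commuting positive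
operators `G₁ = A₁²` and `G₂ = A₂²`, with its factorizations through `G₁` and `G₂`. -/
theorem exists_inverse_sum (h₁ : IsSelfAdjoint A₁) (h₂ : IsSelfAdjoint A₂)
    (hc : A₁ * A₂ = A₂ * A₁) (hi₁ : ∀ x, A₁ x = 0 → x = 0) (hi₂ : ∀ x, A₂ x = 0 → x = 0) :
    ∃ S C C' : H →L[ℂ] H, 0 ≤ S ∧ S * (A₁ * A₁ + A₂ * A₂) = A₁ * A₁ * (A₂ * A₂) ∧
      ‖C‖ ≤ 1 ∧ S = C * (A₁ * A₁) ∧ S = A₁ * A₁ * C ∧ S = A₂ * A₂ * C' ∧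
      (∀ x, S x = 0 → x = 0) := by
  set N := A₁ * A₁ + A₂ * A₂ with hN
  have hNsa : IsSelfAdjoint N := by
    have h3 : IsSelfAdjoint (A₁ * A₁) := by rw [IsSelfAdjoint, star_mul, h₁.star_eq]
    have h4 : IsSelfAdjoint (A₂ * A₂) := by rw [IsSelfAdjoint, star_mul, h₂.star_eq]
    exact h3.add h4
  have hNd : DenseRange N :=
    denseRange_of_selfAdjoint_injective hNsa (sum_squares_injective h₁ h₂ hi₁)
  -- This domination lets `C = G₂ N⁻¹` be defined as a contraction on the dense range of `N`,
  -- although `N` need not have a bounded inverse.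
  have hbd : ∀ z, ‖(A₂ * A₂) z‖ ≤ 1 * ‖N z‖ := fun z => by
    rw [one_mul, ← sq_le_sq₀ (norm_nonneg _) (norm_nonneg _), hN, norm_sq_sum_squares h₁ h₂ hc]
    nlinarith [sq_nonneg ‖(A₁ * A₁) z‖, sq_nonneg ‖(A₁ * A₂) z‖]
  have hext : ∀ {X Y : H →L[ℂ] H}, X * N = Y * N → X = Y := fun {X Y} h => by
    ext1 x
    exact hNd.induction_on (p := fun x => X x = Y x) x (isClosed_eq X.continuous Y.continuous)
      fun z => DFunLike.congr_fun h z
  let C : H →L[ℂ] H := LinearMap.extendOfNorm ((A₂ * A₂ : H →L[ℂ] H) : H →ₗ[ℂ] H)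
    (N : H →ₗ[ℂ] H)
  have hC1 : ‖C‖ ≤ 1 := LinearMap.opNorm_extendOfNorm_le hNd zero_le_one hbd
  have hCN : C * N = A₂ * A₂ := by
    ext1 z
    exact LinearMap.extendOfNorm_eq (f := ((A₂ * A₂ : H →L[ℂ] H) : H →ₗ[ℂ] H))
      (e := (N : H →ₗ[ℂ] H)) hNd ⟨1, hbd⟩ z
  have hcm : Commute A₁ A₂ := hc
  have hc₁ : A₁ * A₁ * N = N * (A₁ * A₁) :=
    (((Commute.refl A₁).mul_left (Commute.refl A₁)).mul_right
      ((Commute.refl A₁).mul_left (Commute.refl A₁))).add_right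
      ((hcm.mul_left hcm).mul_right (hcm.mul_left hcm))
  have hc₂ : A₁ * A₁ * (A₂ * A₂) = A₂ * A₂ * (A₁ * A₁) :=
    (hcm.mul_left hcm).mul_right (hcm.mul_left hcm)
  have hSN : C * (A₁ * A₁) * N = A₁ * A₁ * (A₂ * A₂) := by
    rw [mul_assoc, hc₁, ← mul_assoc, hCN, hc₂]
  have hS2 : C * (A₁ * A₁) = A₁ * A₁ * C := hext (by rw [hSN, mul_assoc _ C, hCN])
  -- Here `1 - C = G₁ N⁻¹`, which gives the factorization through the other particle.
  have hS3 : C * (A₁ * A₁) = A₂ * A₂ * (1 - C) := hext (by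
    rw [hSN, mul_assoc _ (1 - C), sub_mul, hCN, one_mul, hN, add_sub_cancel_right, hc₂])
  -- On the dense range of `N` the form is `⟨G₁ G₂ z, (G₁ + G₂) z⟩`, a sum of two squares;
  -- positivity extends by continuity.
  have hpos : (C * (A₁ * A₁)).IsPositive := by
    rw [ContinuousLinearMap.isPositive_iff_complex]
    intro x
    refine hNd.induction_on (p := fun x => ((RCLike.re ⟪(C * (A₁ * A₁)) x, x⟫_ℂ : ℝ) : ℂ) =
      ⟪(C * (A₁ * A₁)) x, x⟫_ℂ ∧ 0 ≤ RCLike.re ⟪(C * (A₁ * A₁)) x, x⟫_ℂ) x ?_ fun z => ?_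
    · have hre : Continuous fun x => RCLike.re ⟪(C * (A₁ * A₁)) x, x⟫_ℂ :=
        Complex.continuous_re.comp (by fun_prop)
      exact (isClosed_eq (Complex.continuous_ofReal.comp hre) (by fun_prop)).inter
        (isClosed_Ici.preimage hre)
    · have hz : (C * (A₁ * A₁)) (N z) = (A₁ * A₁ * (A₂ * A₂)) z := DFunLike.congr_fun hSN z
      have hc' : ∀ x, A₁ (A₂ x) = A₂ (A₁ x) := fun x => DFunLike.congr_fun hc x
      have hval : ⟪(C * (A₁ * A₁)) (N z), N z⟫_ℂ =
          ((‖A₂ (A₁ (A₁ z))‖ ^ 2 + ‖A₁ (A₂ (A₂ z))‖ ^ 2 : ℝ) : ℂ) := by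
        rw [hz, hN]
        simp only [_root_.add_apply, mul_apply_eq_comp, inner_add_right]
        have e1 : ⟪A₁ (A₁ (A₂ (A₂ z))), A₁ (A₁ z)⟫_ℂ = ((‖A₂ (A₁ (A₁ z))‖ ^ 2 : ℝ) : ℂ) := by
          simp only [hc']
          rw [IsSelfAdjoint.inner_left h₂, inner_self_eq_norm_sq_to_K]
          simp
        have e2 : ⟪A₁ (A₁ (A₂ (A₂ z))), A₂ (A₂ z)⟫_ℂ = ((‖A₁ (A₂ (A₂ z))‖ ^ 2 : ℝ) : ℂ) := by
          rw [IsSelfAdjoint.inner_left h₁, inner_self_eq_norm_sq_to_K]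
          simp
        rw [e1, e2]
        simp
      rw [hval]
      refine ⟨rfl, ?_⟩
      simp only [RCLike.re_to_complex, Complex.ofReal_re]
      positivity
  refine ⟨C * (A₁ * A₁), C, 1 - C, (ContinuousLinearMap.nonneg_iff_isPositive _).2 hpos, hSN, hC1,
    rfl, hS2, hS3, fun x hx => ?_⟩
  -- Adjoints show that `S` commutes with `N`. So `S x = 0` forces `G₁ G₂ x = N S x = 0`, and `G₁`,
  -- `G₂` are injective.
  have hNS : N * (C * (A₁ * A₁)) = C * (A₁ * A₁) * N := by
    have := congrArg star hSN
    rw [star_mul, hpos.isSelfAdjoint.star_eq, hNsa.star_eq] at this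
    rw [this, hSN]
    simp only [star_mul, h₁.star_eq, h₂.star_eq]
    exact hc₂.symm
  have h0 : (A₁ * A₁ * (A₂ * A₂)) x = 0 := by
    rw [← hSN, ← hNS, mul_apply_eq_comp, hx, map_zero]
  exact hi₂ _ (hi₂ _ (hi₁ _ (hi₁ _ h0)))

/-- A nonnegative form plus `ε` is coercive. The shift makes the rule for bounded inverses
applicable to a regularization of `G₁ + G₂`. -/
theorem isUnit_add_smul_one (h₁ : IsSelfAdjoint A₁) (h₂ : IsSelfAdjoint A₂) {ε : ℝ} (hε : 0 < ε) :
    IsUnit (A₁ * A₁ + A₂ * A₂ + (ε : ℂ) • (1 : H →L[ℂ] H)) := by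
  refine ContinuousLinearMap.isUnit_of_forall_le_norm_inner_map _ (c := ⟨ε, hε.le⟩) hε fun x => ?_
  have h : ⟪(A₁ * A₁ + A₂ * A₂ + (ε : ℂ) • (1 : H →L[ℂ] H)) x, x⟫_ℂ =
      ((‖A₁ x‖ ^ 2 + ‖A₂ x‖ ^ 2 + ε * ‖x‖ ^ 2 : ℝ) : ℂ) := by
    simp only [_root_.add_apply, mul_apply_eq_comp, inner_add_left,
      _root_.smul_apply, inner_smul_left, one_apply_eq_self, Complex.conj_ofReal]
    rw [IsSelfAdjoint.inner_left h₁, IsSelfAdjoint.inner_left h₂, inner_self_eq_norm_sq_to_K,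
      inner_self_eq_norm_sq_to_K, inner_self_eq_norm_sq_to_K]
    simp
  rw [h, Complex.norm_real, Real.norm_of_nonneg (by positivity)]
  have h1 := sq_nonneg ‖A₁ x‖
  have h2 := sq_nonneg ‖A₂ x‖
  change ‖x‖ ^ 2 * ε ≤ _
  linarith [mul_comm (‖x‖ ^ 2) ε]

/-- Whatever commutes asymptotically with `G₁` and `G₂` also does so with `(G₁⁻¹ + G₂⁻¹)⁻¹`. -/
theorem asympComm_inverse_sum {ι : Type*} {U : ι → H →L[ℂ] H} {l : Filter ι}
    (hU : ∀ i, ‖U i‖ ≤ 1) (h₁ : IsSelfAdjoint A₁) (h₂ : IsSelfAdjoint A₂)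
    (hc : A₁ * A₂ = A₂ * A₁) {S C : H →L[ℂ] H}
    (hSN : S * (A₁ * A₁ + A₂ * A₂) = A₁ * A₁ * (A₂ * A₂)) (hC : ‖C‖ ≤ 1)
    (hS : S = C * (A₁ * A₁)) (hU₁ : AsympComm U l (A₁ * A₁)) (hU₂ : AsympComm U l (A₂ * A₂)) :
    AsympComm U l S := by
  refine (isClosed_asympComm hU).closure_subset (Metric.mem_closure_iff.2 fun ε hε => ?_)
  set N := A₁ * A₁ + A₂ * A₂ with hN
  obtain ⟨M, hM⟩ := isUnit_add_smul_one h₁ h₂ (half_pos hε)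
  rw [← hN] at hM
  have hMinv : AsympComm U l (↑M⁻¹ : H →L[ℂ] H) := by
    refine AsympComm.inverse (X := (M : H →L[ℂ] H)) ?_ M.mul_inv M.inv_mul
    rw [hM]
    refine (hU₁.add hU₂).add (asympComm_of_commute fun i => ?_)
    rw [mul_smul_comm, smul_mul_assoc, mul_one, one_mul]
  refine ⟨A₁ * A₁ * (A₂ * A₂) * (↑M⁻¹ : H →L[ℂ] H), (hU₁.mul hU₂).mul hMinv, ?_⟩
  rw [dist_eq_norm]
  -- The regularization error is `(ε/2) S M⁻¹` with `M = N + ε/2`. For `y = M⁻¹ x`, `‖S y‖ ≤ ‖G₁ y‖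
  -- ≤ ‖N y‖ ≤ ‖M y‖ = ‖x‖`, so `S M⁻¹` is a contraction.
  have hd : S - A₁ * A₁ * (A₂ * A₂) * (↑M⁻¹ : H →L[ℂ] H) =
      ((ε / 2 : ℝ) : ℂ) • (S * (↑M⁻¹ : H →L[ℂ] H)) := by
    have h3 : S = S * (M : H →L[ℂ] H) * (↑M⁻¹ : H →L[ℂ] H) := by
      rw [mul_assoc, M.mul_inv, mul_one]
    conv_lhs => rw [← hSN]; lhs; rw [h3]
    rw [← sub_mul, hM, mul_add, add_sub_cancel_left, mul_smul_comm, mul_one, smul_mul_assoc]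
  rw [hd]
  refine lt_of_le_of_lt (ContinuousLinearMap.opNorm_le_bound _ (half_pos hε).le fun x => ?_)
    (half_lt_self hε)
  rw [_root_.smul_apply, norm_smul, Complex.norm_real, Real.norm_of_nonneg (half_pos hε).le]
  refine mul_le_mul_of_nonneg_left ?_ (half_pos hε).le
  set y := (↑M⁻¹ : H →L[ℂ] H) x with hy
  have hxy : x = N y + ((ε / 2 : ℝ) : ℂ) • y := by
    have : x = ((M : H →L[ℂ] H) * (↑M⁻¹ : H →L[ℂ] H)) x := by rw [M.mul_inv]; rfl
    rw [this, mul_apply_eq_comp, ← hy, hM]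
    rfl
  have e1 : ‖(S * (↑M⁻¹ : H →L[ℂ] H)) x‖ ≤ ‖(A₁ * A₁) y‖ := by
    rw [mul_apply_eq_comp, hS, mul_apply_eq_comp]
    exact (C.le_opNorm _).trans (mul_le_of_le_one_left (norm_nonneg _) hC)
  refine e1.trans ?_
  rw [← sq_le_sq₀ (norm_nonneg _) (norm_nonneg _)]
  have e2 := norm_sq_sum_squares h₁ h₂ hc y
  rw [← hN] at e2
  have e3 : ‖N y‖ ^ 2 ≤ ‖x‖ ^ 2 := by
    rw [hxy, @norm_add_sq ℂ, inner_smul_right]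
    have e4 : ⟪N y, y⟫_ℂ = ((‖A₁ y‖ ^ 2 + ‖A₂ y‖ ^ 2 : ℝ) : ℂ) := by
      rw [hN]
      simp only [_root_.add_apply, mul_apply_eq_comp, inner_add_left]
      rw [IsSelfAdjoint.inner_left h₁, IsSelfAdjoint.inner_left h₂, inner_self_eq_norm_sq_to_K,
        inner_self_eq_norm_sq_to_K]
      simp
    rw [e4, ← Complex.ofReal_mul]
    simp only [RCLike.re_to_complex, Complex.ofReal_re]
    have : 0 ≤ ε / 2 * (‖A₁ y‖ ^ 2 + ‖A₂ y‖ ^ 2) := by positivity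
    nlinarith [sq_nonneg ‖((ε / 2 : ℝ) : ℂ) • y‖]
  nlinarith [sq_nonneg ‖(A₁ * A₂) y‖, sq_nonneg ‖(A₂ * A₂) y‖]

/-- If `(V - 1) S → 0` in norm then also `(V - 1) √S → 0`, by the C⋆-identity. -/
theorem tendsto_mul_sqrt {ι : Type*} {V : ι → H →L[ℂ] H} {l : Filter ι}
    (hV : ∀ i, ‖V i‖ ≤ 1) {S : H →L[ℂ] H} (hS : 0 ≤ S)
    (h : Tendsto (fun i => V i * S - S) l (𝓝 0)) :
    Tendsto (fun i => V i * CFC.sqrt S - CFC.sqrt S) l (𝓝 0) := by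
  set R := CFC.sqrt S with hR
  have hRR : R * R = S := CFC.sqrt_mul_sqrt_self S
  have hRs : star R = R := (IsSelfAdjoint.of_nonneg (CFC.sqrt_nonneg S)).star_eq
  have h1 := (tendsto_zero_mul_of_bounded (b := fun i => star (V i) - 1) (C := 1 + ‖(1 : H →L[ℂ] H)‖)
    h fun i => (norm_sub_le _ _).trans (by rw [norm_star]; gcongr; exact hV i)).norm
  rw [norm_zero] at h1
  have h2 := h1.sqrt
  rw [Real.sqrt_zero] at h2
  rw [tendsto_zero_iff_norm_tendsto_zero]
  refine h2.congr fun i => ?_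
  have : (V i * S - S) * (star (V i) - 1) = (V i * R - R) * star (V i * R - R) := by
    rw [star_sub, star_mul, hRs, ← hRR]
    noncomm_ring
  rw [this, CStarRing.norm_self_mul_star, Real.sqrt_mul_self (norm_nonneg _)]

end InverseSum

end

end ManyBody

namespace ManyBody

open scoped FourierTransform ENNReal

noncomputable section

/-! ### A Sobolev inequality for potentials in `L^p` -/

section Sobolev

variable {E : Type*} [NormedAddCommGroup E] [InnerProductSpace ℝ E] [FiniteDimensional ℝ E]
  [MeasurableSpace E] [BorelSpace E]

/-- The square of the `H¹` norm of a function, in terms of its Fourier transform. -/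
def sobolevSq (u : L2 E) : ℝ≥0∞ := ∫⁻ k, ENNReal.ofReal (1 + ‖k‖ ^ 2) * ‖(𝓕 u : L2 E) k‖ₑ ^ 2

theorem enorm_sq_le_sobolevSq (u : L2 E) : ‖u‖ₑ ^ 2 ≤ sobolevSq u := by
  have h : ‖u‖ₑ = ‖(𝓕 u : L2 E)‖ₑ := by
    rw [← ofReal_norm, ← ofReal_norm, Lp.norm_fourier_eq]
  rw [h, enorm_sq_eq_lintegral]
  refine lintegral_mono fun k => le_mul_of_one_le_left' ?_
  rw [← ENNReal.ofReal_one]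
  exact ENNReal.ofReal_le_ofReal (by nlinarith [sq_nonneg ‖k‖])

/-- The constant in the bound for the low frequency part of an `H¹` function. -/
def freqConst (E : Type*) [NormedAddCommGroup E] [InnerProductSpace ℝ E] [FiniteDimensional ℝ E]
    [MeasurableSpace E] [BorelSpace E] (s : ℝ) : ℝ≥0∞ :=
  ∫⁻ k : E, ENNReal.ofReal ((1 + ‖k‖ ^ 2) ^ (-s))

theorem freqConst_lt_top {s : ℝ} (hs : (Module.finrank ℝ E : ℝ) < 2 * s) : freqConst E s < ⊤ := by
  have h := (integrable_rpow_neg_one_add_norm_sq (E := E) (μ := volume) hs).lintegral_lt_top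
  simpa [freqConst, neg_mul, mul_comm, neg_div] using h

/-- Splitting a function into its low and high frequency parts. -/
theorem exists_frequency_split {s : ℝ} (hs : (Module.finrank ℝ E : ℝ) < 2 * s) (hs1 : 1 ≤ s)
    (u : L2 E) {L : ℝ} (hL : 0 < L) :
    ∃ v w : L2 E, u = v + w ∧
      (∀ᵐ x, ‖v x‖ₑ ^ 2 ≤ freqConst E s * ENNReal.ofReal (L ^ (s - 1)) * sobolevSq u) ∧
      ENNReal.ofReal L * ‖w‖ₑ ^ 2 ≤ sobolevSq u := by
  set A : Set E := {k | 1 + ‖k‖ ^ 2 ≤ L} with hA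
  have hAm : MeasurableSet A := measurableSet_le (by fun_prop) measurable_const
  have hAf : volume A ≠ ⊤ := by
    refine ((measure_mono fun k hk => ?_).trans_lt
      (measure_closedBall_lt_top (x := (0 : E)) (r := √L))).ne
    rw [mem_closedBall_zero_iff]
    refine Real.le_sqrt_of_sq_le ?_
    have hk' : 1 + ‖k‖ ^ 2 ≤ L := hk
    linarith
  set m : E → ℂ := A.indicator 1 with hm
  have hmt : MemLp m ⊤ volume := memLp_top_of_bound
    (measurable_one.indicator hAm).aestronglyMeasurable 1 (Eventually.of_forall fun k => by
      by_cases hk : k ∈ A <;> simp [hm, hk])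
  have hm2 : MemLp m 2 volume := memLp_indicator_const 2 hAm (1 : ℂ) (Or.inr hAf)
  set g := mulOp m (𝓕 u) with hg
  have hgae : g =ᵐ[volume] fun k => m k * (𝓕 u : L2 E) k := coeFn_mulOp hmt _
  have hgi : Integrable g volume := (hm2.integrable_mul (Lp.memLp (𝓕 u : L2 E))).congr hgae.symm
  have hum : AEMeasurable (fun k => ‖(𝓕 u : L2 E) k‖ₑ ^ 2) volume :=
    (Lp.memLp (𝓕 u : L2 E)).1.enorm.pow_const 2
  refine ⟨𝓕⁻ g, u - 𝓕⁻ g, by abel, ?_, ?_⟩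
  -- Cauchy–Schwarz with the weight `1 + |k|²`. On `A` its reciprocal is at most `(1 + |k|²)^{-s}
  -- L^{s-1}`, and the first factor has integral `freqConst E s`.
  · have hL1 : ∫⁻ k, ‖g k‖ₑ ≤
        (freqConst E s * ENNReal.ofReal (L ^ (s - 1))) ^ (1 / 2 : ℝ) *
          (sobolevSq u) ^ (1 / 2 : ℝ) := by
      have hcs := ENNReal.lintegral_mul_norm_pow_le (μ := (volume : Measure E))
        (f := fun k => A.indicator (fun k => ENNReal.ofReal ((1 + ‖k‖ ^ 2)⁻¹)) k)
        (g := fun k => ENNReal.ofReal (1 + ‖k‖ ^ 2) * ‖(𝓕 u : L2 E) k‖ₑ ^ 2)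
        (p := 1 / 2) (q := 1 / 2)
        (Measurable.indicator (by fun_prop) hAm).aemeasurable
        (AEMeasurable.mul (by fun_prop) hum) (by norm_num) (by norm_num) (by norm_num)
      refine le_trans ?_ (hcs.trans ?_)
      · refine lintegral_mono_ae ?_
        filter_upwards [hgae] with k hk
        rw [hk, ← ENNReal.mul_rpow_of_nonneg _ _ (by norm_num)]
        by_cases hkA : k ∈ A
        · have hpos : (0 : ℝ) < 1 + ‖k‖ ^ 2 := by positivity
          rw [Set.indicator_of_mem hkA, ← mul_assoc, ← ENNReal.ofReal_mul (by positivity),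
            inv_mul_cancel₀ hpos.ne', ENNReal.ofReal_one, one_mul, ← ENNReal.rpow_natCast,
            ← ENNReal.rpow_mul]
          simp [hm, hkA]
        · simp [hm, hkA]
      · rw [sobolevSq]
        gcongr
        rw [freqConst, ← lintegral_mul_const' _ _ ENNReal.ofReal_ne_top]
        refine lintegral_mono fun k => ?_
        by_cases hkA : k ∈ A
        · have hpos : (0 : ℝ) < 1 + ‖k‖ ^ 2 := by positivity
          rw [Set.indicator_of_mem hkA, ← ENNReal.ofReal_mul (by positivity)]
          apply ENNReal.ofReal_le_ofReal
          have hkA' : 1 + ‖k‖ ^ 2 ≤ L := hkA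
          calc (1 + ‖k‖ ^ 2)⁻¹ = (1 + ‖k‖ ^ 2) ^ (-s) * (1 + ‖k‖ ^ 2) ^ (s - 1) := by
                rw [← Real.rpow_add hpos, ← Real.rpow_neg_one]
                congr 1
                ring
            _ ≤ (1 + ‖k‖ ^ 2) ^ (-s) * L ^ (s - 1) := by
                gcongr
        · rw [Set.indicator_of_notMem hkA]
          exact zero_le
    filter_upwards [coeFn_fourierInv_of_integrable hgi] with x hx
    have hle : ‖(𝓕⁻ g : L2 E) x‖ₑ ≤ ∫⁻ k, ‖g k‖ₑ := by
      rw [hx, Real.fourierInv_eq]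
      refine (enorm_integral_le_lintegral_enorm _).trans (lintegral_mono fun k => ?_)
      rw [← ofReal_norm, ← ofReal_norm, Circle.norm_smul]
    calc ‖(𝓕⁻ g : L2 E) x‖ₑ ^ 2 ≤ ((freqConst E s * ENNReal.ofReal (L ^ (s - 1))) ^ (1 / 2 : ℝ) *
          (sobolevSq u) ^ (1 / 2 : ℝ)) ^ 2 := by
          gcongr
          exact hle.trans hL1
      _ = freqConst E s * ENNReal.ofReal (L ^ (s - 1)) * sobolevSq u := by
          rw [mul_pow, ← ENNReal.rpow_natCast, ← ENNReal.rpow_natCast, ← ENNReal.rpow_mul,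
            ← ENNReal.rpow_mul]
          norm_num
  · have hFw : ‖u - 𝓕⁻ g‖ₑ = ‖(𝓕 u : L2 E) - g‖ₑ := by
      have : (𝓕 (u - 𝓕⁻ g) : L2 E) = 𝓕 u - g := by
        refine ((Lp.fourierTransformₗᵢ E ℂ).map_sub u (𝓕⁻ g)).trans ?_
        exact congrArg (fun z => (𝓕 u : L2 E) - z)
          ((Lp.fourierTransformₗᵢ E ℂ).apply_symm_apply g)
      rw [← this, ← ofReal_norm, ← ofReal_norm, Lp.norm_fourier_eq]
    rw [hFw, enorm_sq_eq_lintegral, ← lintegral_const_mul' _ _ ENNReal.ofReal_ne_top]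
    refine lintegral_mono_ae ?_
    filter_upwards [hgae, Lp.coeFn_sub (𝓕 u : L2 E) g] with k h1 h2
    rw [h2, Pi.sub_apply, h1]
    by_cases hkA : k ∈ A
    · simp [hm, hkA]
    · have : L ≤ 1 + ‖k‖ ^ 2 := (not_le.1 hkA).le
      simp only [hm, hkA, not_false_eq_true, Set.indicator_of_notMem, zero_mul, sub_zero]
      gcongr

/-- The constant in the Sobolev inequality below. -/
def sobolevConst (E : Type*) [NormedAddCommGroup E] [InnerProductSpace ℝ E] [FiniteDimensional ℝ E]
    [MeasurableSpace E] [BorelSpace E] (s p : ℝ) : ℝ≥0∞ :=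
  1 + 4 * (freqConst E s + 1) * (1 - 2 ^ (-((p - s) / s)))⁻¹

theorem sobolevConst_lt_top {s p : ℝ} (hs : (Module.finrank ℝ E : ℝ) < 2 * s) (hs0 : 0 < s)
    (hsp : s < p) : sobolevConst E s p < ⊤ := by
  have h1 : (2 : ℝ≥0∞) ^ (-((p - s) / s)) < 1 := by
    refine ENNReal.rpow_lt_one_of_one_lt_of_neg (by norm_num) ?_
    have := div_pos (sub_pos.2 hsp) hs0
    linarith
  have h2 : (1 - (2 : ℝ≥0∞) ^ (-((p - s) / s)))⁻¹ < ⊤ :=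
    ENNReal.inv_lt_top.2 (tsub_pos_of_lt h1)
  have h3 := freqConst_lt_top hs
  exact ENNReal.add_lt_top.2 ⟨ENNReal.one_lt_top, ENNReal.mul_lt_top
    (ENNReal.mul_lt_top (by norm_num) (ENNReal.add_lt_top.2 ⟨h3, ENNReal.one_lt_top⟩)) h2⟩

/-- Cut `f` into dyadic level sets. Chebyshev bounds the volume of the level `t = 2^j` by `t^{-p}`;
there the low frequencies of `u` are estimated in sup norm and the high ones in `L²`. The
contributions form a geometric series because `p > s`. -/
theorem lintegral_mul_sq_le_of_norm_le_one {s p : ℝ} (hs : (Module.finrank ℝ E : ℝ) < 2 * s)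
    (hs1 : 1 ≤ s) (hsp : s < p) {f : E → ℝ} (hf : AEStronglyMeasurable f volume)
    (hfp : ∫⁻ x, ‖f x‖ₑ ^ p ≤ 1) (u : L2 E) :
    ∫⁻ x, ‖f x‖ₑ * ‖u x‖ₑ ^ 2 ≤ sobolevConst E s p * sobolevSq u := by
  set M := sobolevSq u
  have hs0 : 0 < s := by linarith
  set c := (p - s) / s with hc
  have hc0 : 0 < c := div_pos (sub_pos.2 hsp) hs0
  let a : ℕ → ℝ := fun j => (2 : ℝ) ^ j
  have ha0 : ∀ j, 0 < a j := fun j => by positivity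
  let A : ℕ → Set E := fun j => {x | a j ≤ ‖f x‖ ∧ ‖f x‖ < a (j + 1)}
  let A₀ : Set E := {x | ‖f x‖ < 1}
  have hcover : (Set.univ : Set E) ⊆ A₀ ∪ ⋃ j, A j := fun x _ => by
    by_cases hx : ‖f x‖ < 1
    · exact Or.inl hx
    · obtain ⟨n, hn⟩ := exists_nat_pow_near (not_lt.1 hx) one_lt_two
      exact Or.inr (Set.mem_iUnion.2 ⟨n, hn⟩)
  have hA₀ : ∫⁻ x in A₀, ‖f x‖ₑ * ‖u x‖ₑ ^ 2 ≤ M := by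
    refine le_trans ?_ (enorm_sq_le_sobolevSq u)
    rw [enorm_sq_eq_lintegral]
    refine le_trans (setLIntegral_mono_ae (f := fun x => ‖f x‖ₑ * ‖u x‖ₑ ^ 2)
      (g := fun x => ‖u x‖ₑ ^ 2) ((Lp.memLp u).1.enorm.pow_const 2).restrict
      (Eventually.of_forall fun x hx => ?_)) (setLIntegral_le_lintegral _ _)
    refine mul_le_of_le_one_left' ?_
    rw [← ofReal_norm, ← ENNReal.ofReal_one]
    exact ENNReal.ofReal_le_ofReal (le_of_lt hx)
  have hAj : ∀ j, ∫⁻ x in A j, ‖f x‖ₑ * ‖u x‖ₑ ^ 2 ≤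
      4 * (freqConst E s + 1) * M * ((2 : ℝ≥0∞) ^ (-c)) ^ j := fun j => by
    set t := a j with ht
    have ht0 : 0 < t := ha0 j
    -- This threshold balances the two parts: `t L^{s-1} t^{-p}` and `t L⁻¹` both equal
    -- `t^{-(p-s)/s}`.
    set L := t ^ (p / s) with hL
    have hL0 : 0 < L := Real.rpow_pos_of_pos ht0 _
    obtain ⟨v, w, huvw, hv, hw⟩ := exists_frequency_split hs hs1 u hL0
    have hvol : ENNReal.ofReal (t ^ p) * volume (A j) ≤ 1 := by
      refine le_trans ?_ hfp
      refine le_trans ?_ (mul_meas_ge_le_lintegral₀ (hf.enorm.pow_const p)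
        (ENNReal.ofReal (t ^ p)))
      gcongr
      intro x hx
      have hp : 0 ≤ p := by linarith
      rw [Set.mem_ofPred_eq]
      rw [← ENNReal.ofReal_rpow_of_nonneg ht0.le hp, ← ofReal_norm]
      exact ENNReal.rpow_le_rpow (ENNReal.ofReal_le_ofReal hx.1) hp
    have hexp1 : t * (L ^ (s - 1) * (t ^ p)⁻¹) = t ^ (-c) := by
      rw [hL, ← Real.rpow_mul ht0.le, ← Real.rpow_neg ht0.le, ← Real.rpow_add ht0]
      nth_rw 1 [← Real.rpow_one t]
      rw [← Real.rpow_add ht0]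
      congr 1
      rw [hc]
      field_simp
      ring
    have hexp2 : t * L⁻¹ = t ^ (-c) := by
      rw [hL, ← Real.rpow_neg ht0.le]
      nth_rw 1 [← Real.rpow_one t]
      rw [← Real.rpow_add ht0]
      congr 1
      rw [hc]
      field_simp
      ring
    have hgeo : ((2 : ℝ≥0∞) ^ (-c)) ^ j = ENNReal.ofReal (t ^ (-c)) := by
      rw [← ENNReal.ofReal_rpow_of_pos ht0, ht]
      simp only [a]
      rw [ENNReal.ofReal_pow (by norm_num), ENNReal.ofReal_ofNat, ← ENNReal.rpow_natCast,
        ← ENNReal.rpow_natCast, ← ENNReal.rpow_mul, ← ENNReal.rpow_mul, mul_comm]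
    have hvol' : volume (A j) ≤ ENNReal.ofReal ((t ^ p)⁻¹) := by
      have htp : 0 < t ^ p := Real.rpow_pos_of_pos ht0 _
      rw [ENNReal.ofReal_inv_of_pos htp]
      rw [mul_comm] at hvol
      exact ENNReal.le_inv_iff_mul_le.2 hvol
    have hw' : ‖w‖ₑ ^ 2 ≤ ENNReal.ofReal L⁻¹ * M := by
      calc ‖w‖ₑ ^ 2 = ENNReal.ofReal L⁻¹ * (ENNReal.ofReal L * ‖w‖ₑ ^ 2) := by
            rw [← mul_assoc, ← ENNReal.ofReal_mul (by positivity), inv_mul_cancel₀ hL0.ne',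
              ENNReal.ofReal_one, one_mul]
        _ ≤ _ := by gcongr
    have hpt : ∀ᵐ x ∂(volume.restrict (A j)), ‖f x‖ₑ * ‖u x‖ₑ ^ 2 ≤ ENNReal.ofReal (2 * t) *
        (2 * (freqConst E s * ENNReal.ofReal (L ^ (s - 1)) * M + ‖w x‖ₑ ^ 2)) := by
      have hadd : ∀ᵐ x, u x = v x + w x := by
        rw [huvw]
        exact Lp.coeFn_add v w
      have hmem : ∀ᵐ x ∂(volume.restrict (A j)), ‖f x‖ ≤ 2 * t := by
        have hnull : NullMeasurableSet (A j) volume :=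
          (nullMeasurableSet_le aemeasurable_const hf.norm.aemeasurable).inter
            (nullMeasurableSet_lt hf.norm.aemeasurable aemeasurable_const)
        filter_upwards [ae_restrict_mem₀ hnull] with x hx
        have := hx.2.le
        simp only [a, pow_succ] at this
        rw [ht]
        simp only [a]
        linarith
      filter_upwards [ae_restrict_of_ae hadd, ae_restrict_of_ae hv, hmem] with x h1 h2 h3
      have h4 : ‖u x‖ₑ ^ 2 ≤ 2 * (‖v x‖ₑ ^ 2 + ‖w x‖ₑ ^ 2) := by
        have h5 : ‖u x‖ ^ 2 ≤ 2 * (‖v x‖ ^ 2 + ‖w x‖ ^ 2) := by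
          rw [h1]
          nlinarith [norm_add_le (v x) (w x), norm_nonneg (v x + w x), norm_nonneg (v x),
            norm_nonneg (w x), sq_nonneg (‖v x‖ - ‖w x‖)]
        have h6 := ENNReal.ofReal_le_ofReal h5
        rw [ENNReal.ofReal_mul (by norm_num), ENNReal.ofReal_add (by positivity) (by positivity),
          ENNReal.ofReal_pow (norm_nonneg _), ENNReal.ofReal_pow (norm_nonneg _),
          ENNReal.ofReal_pow (norm_nonneg _), ofReal_norm, ofReal_norm, ofReal_norm,
          ENNReal.ofReal_ofNat] at h6
        exact h6
      have h7 : ‖f x‖ₑ ≤ ENNReal.ofReal (2 * t) := by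
        rw [← ofReal_norm]
        exact ENNReal.ofReal_le_ofReal h3
      refine mul_le_mul' h7 (h4.trans ?_)
      gcongr
    calc ∫⁻ x in A j, ‖f x‖ₑ * ‖u x‖ₑ ^ 2
        ≤ ∫⁻ x in A j, ENNReal.ofReal (2 * t) *
          (2 * (freqConst E s * ENNReal.ofReal (L ^ (s - 1)) * M + ‖w x‖ₑ ^ 2)) :=
          lintegral_mono_ae hpt
      _ = ENNReal.ofReal (2 * t) * (2 * (freqConst E s * ENNReal.ofReal (L ^ (s - 1)) * M *
          volume (A j) + ∫⁻ x in A j, ‖w x‖ₑ ^ 2)) := by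
          rw [lintegral_const_mul' _ _ ENNReal.ofReal_ne_top,
            lintegral_const_mul' _ _ (by norm_num), lintegral_add_left measurable_const,
            setLIntegral_const]
      _ ≤ ENNReal.ofReal (2 * t) * (2 * (freqConst E s * ENNReal.ofReal (L ^ (s - 1)) * M *
          ENNReal.ofReal ((t ^ p)⁻¹) + ENNReal.ofReal L⁻¹ * M)) := by
          gcongr
          refine (setLIntegral_le_lintegral _ _).trans ?_
          rw [← enorm_sq_eq_lintegral]
          exact hw'
      _ = 4 * M * (freqConst E s * (ENNReal.ofReal t * (ENNReal.ofReal (L ^ (s - 1)) *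
          ENNReal.ofReal ((t ^ p)⁻¹))) + ENNReal.ofReal t * ENNReal.ofReal L⁻¹) := by
          rw [ENNReal.ofReal_mul (by norm_num), ENNReal.ofReal_ofNat]
          ring
      _ = 4 * (freqConst E s + 1) * M * ((2 : ℝ≥0∞) ^ (-c)) ^ j := by
          rw [← ENNReal.ofReal_mul (by positivity), ← ENNReal.ofReal_mul (by positivity),
            ← ENNReal.ofReal_mul (by positivity), hexp1, hexp2, hgeo]
          ring
  calc ∫⁻ x, ‖f x‖ₑ * ‖u x‖ₑ ^ 2
      ≤ ∫⁻ x in A₀ ∪ ⋃ j, A j, ‖f x‖ₑ * ‖u x‖ₑ ^ 2 := by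
        rw [← setLIntegral_univ]
        exact lintegral_mono_set hcover
    _ ≤ (∫⁻ x in A₀, ‖f x‖ₑ * ‖u x‖ₑ ^ 2) + ∑' j, ∫⁻ x in A j, ‖f x‖ₑ * ‖u x‖ₑ ^ 2 :=
        (lintegral_union_le _ _ _).trans (by gcongr; exact lintegral_iUnion_le _ _)
    _ ≤ M + ∑' j, 4 * (freqConst E s + 1) * M * ((2 : ℝ≥0∞) ^ (-c)) ^ j := by
        gcongr with j
        exact hAj j
    _ = sobolevConst E s p * M := by
        rw [ENNReal.tsum_mul_left, ENNReal.tsum_geometric, sobolevConst]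
        ring

/-- The Sobolev inequality, in the form of a bound for potentials in `L^p`. -/
theorem lintegral_mul_sq_le {s p : ℝ} (hs : (Module.finrank ℝ E : ℝ) < 2 * s)
    (hs1 : 1 ≤ s) (hsp : s < p) {f : E → ℝ} (hf : MemLp f (ENNReal.ofReal p) volume) (u : L2 E) :
    ∫⁻ x, ‖f x‖ₑ * ‖u x‖ₑ ^ 2 ≤
      sobolevConst E s p * eLpNorm f (ENNReal.ofReal p) volume * sobolevSq u := by
  have hp0 : 0 < p := by linarith
  have hpne : ENNReal.ofReal p ≠ 0 := by simpa using hp0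
  by_cases h0 : eLpNorm f (ENNReal.ofReal p) volume = 0
  · have hf0 := (eLpNorm_eq_zero_iff hf.1 hpne).1 h0
    have : ∫⁻ x, ‖f x‖ₑ * ‖u x‖ₑ ^ 2 = 0 := by
      rw [← lintegral_zero (μ := (volume : Measure E))]
      apply lintegral_congr_ae
      filter_upwards [hf0] with x hx
      simp [hx]
    rw [this]
    exact zero_le
  set N := eLpNorm f (ENNReal.ofReal p) volume with hN
  have hNt : N ≠ ⊤ := hf.2.ne
  set r := N.toReal with hr
  have hr0 : 0 < r := ENNReal.toReal_pos h0 hNt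
  have hNr : N = ‖r‖ₑ := by rw [Real.enorm_of_nonneg hr0.le, hr, ENNReal.ofReal_toReal hNt]
  have h1 : ∫⁻ x, ‖(r⁻¹ • f) x‖ₑ ^ p ≤ 1 := by
    have h2 : eLpNorm (r⁻¹ • f) (ENNReal.ofReal p) volume = 1 := by
      rw [eLpNorm_const_smul, ← hN, hNr, ← enorm_mul, inv_mul_cancel₀ hr0.ne']
      simp
    rw [eLpNorm_eq_lintegral_rpow_enorm_toReal hpne ENNReal.ofReal_ne_top,
      ENNReal.toReal_ofReal hp0.le] at h2
    have h3 := congrArg (· ^ p) h2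
    simp only [ENNReal.one_rpow, ← ENNReal.rpow_mul, one_div, inv_mul_cancel₀ hp0.ne',
      ENNReal.rpow_one] at h3
    exact h3.le
  have h2 := lintegral_mul_sq_le_of_norm_le_one hs hs1 hsp (hf.1.const_smul r⁻¹) h1 u
  calc ∫⁻ x, ‖f x‖ₑ * ‖u x‖ₑ ^ 2 = ∫⁻ x, N * (‖(r⁻¹ • f) x‖ₑ * ‖u x‖ₑ ^ 2) := by
        apply lintegral_congr
        intro x
        rw [Pi.smul_apply, smul_eq_mul, enorm_mul, hNr, ← mul_assoc, ← mul_assoc, ← enorm_mul,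
          mul_inv_cancel₀ hr0.ne', enorm_one, one_mul]
    _ = N * ∫⁻ x, ‖(r⁻¹ • f) x‖ₑ * ‖u x‖ₑ ^ 2 := lintegral_const_mul' _ _ hNt
    _ ≤ N * (sobolevConst E s p * sobolevSq u) := by gcongr
    _ = _ := by ring

end Sobolev

end

end ManyBody

namespace ManyBody

open scoped FourierTransform ENNReal

noncomputable section

/-! ### The operator `(1 - Δ)^{-1/2}` -/

section Bessel

variable {E : Type*} [NormedAddCommGroup E] [InnerProductSpace ℝ E] [FiniteDimensional ℝ E]
  [MeasurableSpace E] [BorelSpace E]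

/-- The Fourier transform turns plane waves into translations. -/
theorem fourierOp_comp_phaseOp (v : E) :
    fourierOp E ∘L phaseOp v = transOp (-v) ∘L fourierOp E := by
  ext1 f
  refine (SchwartzMap.denseRange_toLpCLM (p := 2) (μ := (volume : Measure E)) (F := ℂ)
    ENNReal.ofNat_ne_top).induction_on
    (p := fun f => (fourierOp E ∘L phaseOp v) f = (transOp (-v) ∘L fourierOp E) f) f
    (isClosed_eq (by fun_prop) (by fun_prop)) fun φ => ?_
  simp only [ContinuousLinearMap.comp_apply, SchwartzMap.toLpCLM_apply, fourierOp_apply]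
  have hφ : φ.toLp 2 volume =ᵐ[volume] φ := φ.coeFn_toLp 2 volume
  have hpφ : phaseOp v (φ.toLp 2 volume) =ᵐ[volume] fun x => phase v x * φ x := by
    filter_upwards [coeFn_phaseOp v (φ.toLp 2 volume), hφ] with x h1 h2
    rw [h1, h2]
  have hi : Integrable (φ.toLp 2 (volume : Measure E)) volume := φ.integrable.congr hφ.symm
  have hpi : Integrable (phaseOp v (φ.toLp 2 volume)) volume := by
    refine Integrable.congr ?_ hpφ.symm
    exact φ.integrable.bdd_mul (c := 1) (continuous_phase v).aestronglyMeasurable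
      (Eventually.of_forall fun x => (norm_phase v x).le)
  apply Lp.ext
  have hq := (measurePreserving_add_right (volume : Measure E) (-v)).quasiMeasurePreserving
  filter_upwards [coeFn_fourier_of_integrable hpi, coeFn_transOp (-v) (𝓕 (φ.toLp 2 volume)),
    hq.ae (coeFn_fourier_of_integrable hi)] with x h1 h2 h3
  rw [h1, h2, h3, Real.fourier_eq, Real.fourier_eq]
  refine integral_congr_ae ?_
  filter_upwards [hpφ, hφ] with y h4 h5
  rw [h4, h5, Circle.smul_def, Circle.smul_def, phase, smul_eq_mul, smul_eq_mul, ← mul_assoc,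
    ← Circle.coe_mul, ← AddChar.map_add_eq_mul]
  congr 3
  rw [inner_add_right, inner_neg_right, real_inner_comm v y]
  ring

/-- The symbol `(1 + 4π²|k|²)^{-1/2}` of the operator `(1 - Δ)^{-1/2}`. -/
def besselSymbol (k : E) : ℝ := ‖(1 + (2 * Real.pi * ‖k‖ : ℝ) * Complex.I : ℂ)‖⁻¹

theorem besselSymbol_inv_sq (k : E) : (besselSymbol k)⁻¹ ^ 2 = 1 + (2 * Real.pi * ‖k‖) ^ 2 := by
  have h := Complex.norm_add_mul_I 1 (2 * Real.pi * ‖k‖)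
  rw [Complex.ofReal_one] at h
  rw [besselSymbol, inv_inv, h, Real.sq_sqrt (by positivity), one_pow]

theorem besselSymbol_nonneg (k : E) : 0 ≤ besselSymbol k := inv_nonneg.2 (norm_nonneg _)

theorem one_le_besselSymbol_inv (k : E) : 1 ≤ (besselSymbol k)⁻¹ := by
  have h := besselSymbol_inv_sq k
  have h0 := inv_nonneg.2 (besselSymbol_nonneg k)
  nlinarith [sq_nonneg (2 * Real.pi * ‖k‖)]

theorem besselSymbol_pos (k : E) : 0 < besselSymbol k :=
  inv_pos.1 (zero_lt_one.trans_le (one_le_besselSymbol_inv k))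

theorem besselSymbol_le_one (k : E) : besselSymbol k ≤ 1 :=
  (one_le_inv₀ (besselSymbol_pos k)).1 (one_le_besselSymbol_inv k)

/-- The reciprocal of the symbol is the modulus `|1 + 2πi|k||`, Lipschitz by the reverse triangle
inequality. Passing to the symbol itself costs a product of two symbols, which is at most one. -/
theorem abs_besselSymbol_sub_le (k l : E) :
    |besselSymbol k - besselSymbol l| ≤ 2 * Real.pi * ‖k - l‖ := by
  have h0 : |(besselSymbol l)⁻¹ - (besselSymbol k)⁻¹| ≤ 2 * Real.pi * ‖k - l‖ := by
    rw [besselSymbol, besselSymbol, inv_inv, inv_inv]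
    refine (abs_norm_sub_norm_le _ _).trans ?_
    have h1 : (1 + (2 * Real.pi * ‖l‖ : ℝ) * Complex.I : ℂ) -
        (1 + (2 * Real.pi * ‖k‖ : ℝ) * Complex.I) =
        ((2 * Real.pi * (‖l‖ - ‖k‖) : ℝ) : ℂ) * Complex.I := by
      push_cast
      ring
    rw [h1, norm_mul, Complex.norm_I, mul_one, Complex.norm_real, norm_mul, Real.norm_eq_abs,
      abs_of_pos Real.two_pi_pos]
    have := abs_norm_sub_norm_le l k
    rw [norm_sub_rev k l]
    exact mul_le_mul_of_nonneg_left this Real.two_pi_pos.le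
  have hk := besselSymbol_pos k
  have hl := besselSymbol_pos l
  have h2 : besselSymbol k - besselSymbol l =
      ((besselSymbol l)⁻¹ - (besselSymbol k)⁻¹) * (besselSymbol k * besselSymbol l) := by
    field_simp
  rw [h2, abs_mul, abs_of_pos (mul_pos hk hl)]
  refine le_trans (mul_le_of_le_one_right (abs_nonneg _) ?_) h0
  exact mul_le_one₀ (besselSymbol_le_one k) hl.le (besselSymbol_le_one l)

theorem continuous_besselSymbol : Continuous (besselSymbol : E → ℝ) := by
  refine continuous_iff_continuousAt.2 fun k => tendsto_iff_norm_sub_tendsto_zero.2 ?_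
  refine squeeze_zero (fun _ => norm_nonneg _) (fun l => abs_besselSymbol_sub_le l k) ?_
  have : Continuous fun l => 2 * Real.pi * ‖l - k‖ := by fun_prop
  simpa using this.tendsto k

theorem memLp_besselSymbol : MemLp (fun k : E => (besselSymbol k : ℂ)) ⊤ volume :=
  memLp_top_of_bound (Complex.continuous_ofReal.comp continuous_besselSymbol).aestronglyMeasurable 1
    (Eventually.of_forall fun k => by
      rw [Complex.norm_real, Real.norm_of_nonneg (besselSymbol_nonneg k)]
      exact besselSymbol_le_one k)

/-- The operator `(1 - Δ)^{-1/2}`. -/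
def besselOp (E : Type*) [NormedAddCommGroup E] [InnerProductSpace ℝ E] [FiniteDimensional ℝ E]
    [MeasurableSpace E] [BorelSpace E] : L2 E →L[ℂ] L2 E :=
  (fourierOp E).adjoint ∘L mulOp (fun k => (besselSymbol k : ℂ)) ∘L fourierOp E

theorem fourierOp_comp_adjoint : fourierOp E ∘L (fourierOp E).adjoint = .id ℂ (L2 E) := by
  ext1 f
  obtain ⟨g, rfl⟩ := (Lp.fourierTransformₗᵢ E ℂ).surjective f
  change fourierOp E ((fourierOp E).adjoint (fourierOp E g)) = fourierOp E g
  rw [← ContinuousLinearMap.comp_apply (fourierOp E).adjoint, adjoint_fourierOp_comp]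
  rfl

theorem fourierOp_injective : Function.Injective (fourierOp E) :=
  (Lp.fourierTransformₗᵢ E ℂ).injective

theorem norm_fourierOp_apply (f : L2 E) : ‖fourierOp E f‖ = ‖f‖ :=
  (Lp.fourierTransformₗᵢ E ℂ).norm_map f

theorem fourierOp_besselOp (f : L2 E) :
    fourierOp E (besselOp E f) = mulOp (fun k => (besselSymbol k : ℂ)) (fourierOp E f) := by
  have h := DFunLike.congr_fun (fourierOp_comp_adjoint (E := E))
    (mulOp (fun k => (besselSymbol k : ℂ)) (fourierOp E f))
  exact h

theorem coeFn_fourier_besselOp (f : L2 E) :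
    (𝓕 (besselOp E f) : L2 E) =ᵐ[volume] fun k => (besselSymbol k : ℂ) * (𝓕 f : L2 E) k := by
  rw [← fourierOp_apply, fourierOp_besselOp]
  exact coeFn_mulOp memLp_besselSymbol _

theorem isSelfAdjoint_besselOp : IsSelfAdjoint (besselOp E) := by
  rw [ContinuousLinearMap.isSelfAdjoint_iff_isSymmetric]
  intro f g
  simp only [ContinuousLinearMap.coe_coe, besselOp, ContinuousLinearMap.comp_apply]
  rw [ContinuousLinearMap.adjoint_inner_left, ContinuousLinearMap.adjoint_inner_right,
    inner_mulOp_left memLp_besselSymbol]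
  simp only [Complex.conj_ofReal]

theorem besselOp_injective (f : L2 E) (hf : besselOp E f = 0) : f = 0 := by
  refine fourierOp_injective ?_
  rw [map_zero]
  have h := coeFn_fourier_besselOp f
  rw [hf, ← fourierOp_apply, map_zero] at h
  apply Lp.ext
  filter_upwards [h, Lp.coeFn_zero ℂ 2 (volume : Measure E)] with k h1 h2
  rw [h2, Pi.zero_apply] at h1 ⊢
  have := besselSymbol_pos k
  have h3 : (besselSymbol k : ℂ) ≠ 0 := Complex.ofReal_ne_zero.2 this.ne'
  exact (mul_eq_zero.1 h1.symm).resolve_left h3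

theorem norm_besselOp_apply_le (f : L2 E) : ‖besselOp E f‖ ≤ ‖f‖ := by
  rw [← norm_fourierOp_apply, fourierOp_besselOp, ← norm_fourierOp_apply f]
  refine (norm_mulOp_apply_le memLp_besselSymbol zero_le_one (Eventually.of_forall fun k => ?_)
    _).trans_eq (one_mul _)
  rw [Complex.norm_real, Real.norm_of_nonneg (besselSymbol_nonneg k)]
  exact besselSymbol_le_one k

/-- The weight `1 + |k|²` of `sobolevSq` is at most the inverse square `1 + 4π²|k|²` of the symbol.
-/
theorem sobolevSq_besselOp_le (f : L2 E) : sobolevSq (besselOp E f) ≤ ‖f‖ₑ ^ 2 := by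
  have h : ‖f‖ₑ = ‖(𝓕 f : L2 E)‖ₑ := by
    rw [← ofReal_norm, ← ofReal_norm, Lp.norm_fourier_eq]
  rw [h, enorm_sq_eq_lintegral, sobolevSq]
  refine lintegral_mono_ae ?_
  filter_upwards [coeFn_fourier_besselOp f] with k hk
  rw [hk, enorm_mul, mul_pow, ← mul_assoc]
  refine mul_le_of_le_one_left' ?_
  have hpos := besselSymbol_pos k
  rw [← ofReal_norm, Complex.norm_real, Real.norm_of_nonneg hpos.le,
    ← ENNReal.ofReal_pow hpos.le, ← ENNReal.ofReal_mul (by positivity), ← ENNReal.ofReal_one]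
  refine ENNReal.ofReal_le_ofReal ?_
  have h1 := besselSymbol_inv_sq k
  have h2 : 1 ≤ (2 * Real.pi) ^ 2 := by nlinarith [Real.pi_gt_three]
  have h3 : 1 + ‖k‖ ^ 2 ≤ (besselSymbol k)⁻¹ ^ 2 := by
    rw [h1, mul_pow]
    nlinarith [sq_nonneg ‖k‖]
  calc (1 + ‖k‖ ^ 2) * besselSymbol k ^ 2 ≤ (besselSymbol k)⁻¹ ^ 2 * besselSymbol k ^ 2 := by
        gcongr
    _ = 1 := by field_simp

theorem eq_of_fourierOp_comp {X Y : L2 E →L[ℂ] L2 E}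
    (h : ∀ f, fourierOp E (X f) = fourierOp E (Y f)) : X = Y := by
  ext1 f
  exact fourierOp_injective (h f)

theorem transOp_mul_besselOp (h : E) : transOp h * besselOp E = besselOp E * transOp h := by
  refine eq_of_fourierOp_comp fun f => ?_
  have hT : ∀ g, fourierOp E (transOp h g) = phaseOp h (fourierOp E g) := fun g =>
    DFunLike.congr_fun (fourierOp_comp_transOp h) g
  simp only [mul_apply_eq_comp]
  rw [hT, fourierOp_besselOp, fourierOp_besselOp, hT]
  apply Lp.ext
  filter_upwards [coeFn_phaseOp h (mulOp (fun k => (besselSymbol k : ℂ)) (fourierOp E f)),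
    coeFn_mulOp memLp_besselSymbol (fourierOp E f), coeFn_phaseOp h (fourierOp E f),
    coeFn_mulOp memLp_besselSymbol (phaseOp h (fourierOp E f))] with x h1 h2 h3 h4
  rw [h1, h2, h4, h3]
  ring

/-- In momentum space the difference is multiplication by `(phase - 1)` times the symbol. The decay
of the symbol compensates the growth `2π|h||x|` of the phase difference. -/
theorem norm_transOp_mul_besselOp_sub_le (h : E) :
    ‖transOp h * besselOp E - besselOp E‖ ≤ ‖h‖ := by
  refine ContinuousLinearMap.opNorm_le_bound _ (norm_nonneg h) fun f => ?_
  have hT : ∀ g, fourierOp E (transOp h g) = phaseOp h (fourierOp E g) := fun g =>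
    DFunLike.congr_fun (fourierOp_comp_transOp h) g
  rw [← norm_fourierOp_apply, ← norm_fourierOp_apply f, _root_.sub_apply, map_sub,
    mul_apply_eq_comp, hT, fourierOp_besselOp]
  refine norm_le_of_ae_norm_le (norm_nonneg h) ?_
  filter_upwards [coeFn_phaseOp h (mulOp (fun k => (besselSymbol k : ℂ)) (fourierOp E f)),
    coeFn_mulOp memLp_besselSymbol (fourierOp E f),
    Lp.coeFn_sub (phaseOp h (mulOp (fun k => (besselSymbol k : ℂ)) (fourierOp E f)))
      (mulOp (fun k => (besselSymbol k : ℂ)) (fourierOp E f))] with x h1 h2 h3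
  rw [h3, Pi.sub_apply, h1, h2, ← sub_one_mul, ← mul_assoc, norm_mul]
  refine mul_le_mul_of_nonneg_right ?_ (norm_nonneg _)
  have hpos := besselSymbol_pos x
  rw [norm_mul, Complex.norm_real, Real.norm_of_nonneg hpos.le]
  have h5 : 2 * Real.pi * ‖x‖ ≤ (besselSymbol x)⁻¹ := by
    refine le_of_sq_le_sq ?_ (inv_nonneg.2 hpos.le)
    rw [besselSymbol_inv_sq]
    linarith
  calc ‖phase h x - 1‖ * besselSymbol x ≤ 2 * Real.pi * ‖h‖ * ‖x‖ * besselSymbol x := by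
        gcongr
        exact norm_phase_sub_one_le h x
    _ = ‖h‖ * (2 * Real.pi * ‖x‖ * besselSymbol x) := by ring
    _ ≤ ‖h‖ * ((besselSymbol x)⁻¹ * besselSymbol x) := by gcongr
    _ = ‖h‖ := by rw [inv_mul_cancel₀ hpos.ne', mul_one]

/-- In momentum space the plane wave is a translation, so the commutator multiplies by a difference
of translated symbols; the symbol is Lipschitz. -/
theorem norm_phaseOp_mul_besselOp_sub_le (v : E) :
    ‖phaseOp v * besselOp E - besselOp E * phaseOp v‖ ≤ 2 * Real.pi * ‖v‖ := by
  refine ContinuousLinearMap.opNorm_le_bound _ (by positivity) fun f => ?_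
  have hT : ∀ g, fourierOp E (phaseOp v g) = transOp (-v) (fourierOp E g) := fun g =>
    DFunLike.congr_fun (fourierOp_comp_phaseOp v) g
  have hn : ‖f‖ = ‖transOp (-v) (fourierOp E f)‖ := by
    rw [norm_transOp_apply, norm_fourierOp_apply]
  rw [← norm_fourierOp_apply, hn, _root_.sub_apply, map_sub,
    mul_apply_eq_comp, mul_apply_eq_comp, hT, fourierOp_besselOp, fourierOp_besselOp, hT]
  refine norm_le_of_ae_norm_le (by positivity) ?_
  have hq := (measurePreserving_add_right (volume : Measure E) (-v)).quasiMeasurePreserving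
  filter_upwards [coeFn_transOp (-v) (mulOp (fun k => (besselSymbol k : ℂ)) (fourierOp E f)),
    hq.ae (coeFn_mulOp memLp_besselSymbol (fourierOp E f)), coeFn_transOp (-v) (fourierOp E f),
    coeFn_mulOp memLp_besselSymbol (transOp (-v) (fourierOp E f)),
    Lp.coeFn_sub (transOp (-v) (mulOp (fun k => (besselSymbol k : ℂ)) (fourierOp E f)))
      (mulOp (fun k => (besselSymbol k : ℂ)) (transOp (-v) (fourierOp E f)))] with x h1 h2 h3 h4 h5
  rw [h5, Pi.sub_apply, h1, h2, h4, h3, ← sub_mul, norm_mul, ← Complex.ofReal_sub,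
    Complex.norm_real, Real.norm_eq_abs]
  refine mul_le_mul_of_nonneg_right ((abs_besselSymbol_sub_le _ _).trans_eq ?_) (norm_nonneg _)
  rw [add_sub_cancel_left, norm_neg]

theorem asympComm_besselOp : AsympComm (fun v : E => phaseOp v) (𝓝 0) (besselOp E) := by
  refine squeeze_zero_norm (fun v => norm_phaseOp_mul_besselOp_sub_le v) ?_
  have : Continuous fun v : E => 2 * Real.pi * ‖v‖ := by fun_prop
  simpa using this.tendsto 0

theorem tendsto_transOp_mul_besselOp :
    Tendsto (fun v : E => transOp v * besselOp E - besselOp E) (𝓝 0) (𝓝 0) := by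
  refine squeeze_zero_norm (fun v => norm_transOp_mul_besselOp_sub_le v) ?_
  simpa using (continuous_norm (E := E)).tendsto 0

end Bessel

/-! ### Weak gradients in momentum space -/

section WeakGradient

variable {d : ℕ}

/-- The Fourier transform is injective on tempered distributions and turns `∂_i` into multiplication
by `2πi k_i`; locally integrable functions that agree as distributions agree almost everywhere. -/
theorem isWeakGradient_iff_fourier {u : L2 (Conf d)} {g : Fin d → L2 (Conf d)} :
    IsWeakGradient u g ↔ ∀ i, ∀ᵐ k, (𝓕 (g i) : L2 (Conf d)) k =
      (2 * Real.pi * Complex.I) * ((k i : ℝ) : ℂ) * (𝓕 u : L2 (Conf d)) k := by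
  refine forall_congr' fun i => ?_
  set m : Conf d := EuclideanSpace.single i 1 with hm
  have hinj : (∂_{m} (u : 𝓢'(Conf d, ℂ)) = (g i : 𝓢'(Conf d, ℂ))) ↔
      𝓕 (∂_{m} (u : 𝓢'(Conf d, ℂ))) = 𝓕 (g i : 𝓢'(Conf d, ℂ)) := by
    refine ⟨fun h => by rw [h], fun h => ?_⟩
    have := congrArg (fun T : 𝓢'(Conf d, ℂ) => (𝓕⁻ T : 𝓢'(Conf d, ℂ))) h
    simpa only [FourierTransform.fourierInv_fourier_eq] using this
  have htemp : (fun k : Conf d => ((inner ℝ k m : ℝ) : ℂ)).HasTemperateGrowth := by fun_prop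
  have hki : ∀ k : Conf d, inner ℝ k m = k i := fun k => by
    rw [hm, EuclideanSpace.inner_single_right]
    simp
  rw [hinj, TemperedDistribution.fourier_lineDerivOp_eq, Lp.fourier_toTemperedDistribution_eq,
    Lp.fourier_toTemperedDistribution_eq]
  have hval : ∀ φ : 𝓢(Conf d, ℂ), ((2 * Real.pi * Complex.I) •
      TemperedDistribution.smulLeftCLM ℂ (fun k => ((inner ℝ k m : ℝ) : ℂ))
        ((𝓕 u : L2 (Conf d)) : 𝓢'(Conf d, ℂ))) φ =
      ∫ k, φ k * ((2 * Real.pi * Complex.I) * ((k i : ℝ) : ℂ) * (𝓕 u : L2 (Conf d)) k) := by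
    intro φ
    rw [_root_.smul_apply, TemperedDistribution.smulLeftCLM_apply_apply,
      Lp.toTemperedDistribution_apply, smul_eq_mul, ← integral_const_mul]
    refine integral_congr_ae (Eventually.of_forall fun k => ?_)
    beta_reduce
    rw [SchwartzMap.smulLeftCLM_apply_apply htemp, hki, smul_eq_mul, smul_eq_mul]
    ring
  constructor
  · intro h
    refine ae_eq_of_forall_schwartz (locallyIntegrable_L2 _) ?_ fun φ => ?_
    · refine (locallyIntegrable_L2 (𝓕 u : L2 (Conf d))).continuous_smul
        (g := fun k : Conf d => (2 * Real.pi * Complex.I) * ((k i : ℝ) : ℂ)) ?_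
      fun_prop
    · rw [← hval, h, Lp.toTemperedDistribution_apply]
      rfl
  · intro h
    ext φ
    rw [hval, Lp.toTemperedDistribution_apply]
    refine integral_congr_ae ?_
    filter_upwards [h] with k hk
    rw [hk, smul_eq_mul]

end WeakGradient

end

end ManyBody

namespace ManyBody

open scoped FourierTransform ENNReal

noncomputable section

/-! ### Potentials as quadratic forms -/

section Forms

variable {P : Type*} [NormedAddCommGroup P] [InnerProductSpace ℝ P] [FiniteDimensional ℝ P]
  [MeasurableSpace P] [BorelSpace P] {m m' : P → ℝ} {R T T' : L2 P →L[ℂ] L2 P}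

/-- `T = R m R` in the sense of quadratic forms. -/
def IsFormOp (m : P → ℝ) (R T : L2 P →L[ℂ] L2 P) : Prop :=
  ∀ φ ψ : L2 P, Integrable (fun x => (m x : ℂ) * (conj (R φ x) * R ψ x)) ∧
    ⟪φ, T ψ⟫_ℂ = ∫ x, (m x : ℂ) * (conj (R φ x) * R ψ x)

/-- The form of the potential `m` is bounded by `C` in terms of the operator `R`. -/
def FormBound (m : P → ℝ) (R : L2 P →L[ℂ] L2 P) (C : ℝ) : Prop :=
  ∀ φ : L2 P, ∫⁻ x, ‖m x‖ₑ * ‖R φ x‖ₑ ^ 2 ≤ ENNReal.ofReal C * ‖φ‖ₑ ^ 2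

theorem exists_mul_operator {a : P → ℂ} (ha : AEStronglyMeasurable a volume)
    (R : L2 P →L[ℂ] L2 P) {C : ℝ} (hC : 0 ≤ C)
    (h : ∀ φ : L2 P, ∫⁻ x, ‖a x‖ₑ ^ 2 * ‖R φ x‖ₑ ^ 2 ≤ ENNReal.ofReal C * ‖φ‖ₑ ^ 2) :
    ∃ Q : L2 P →L[ℂ] L2 P, (∀ φ, Q φ =ᵐ[volume] fun x => a x * R φ x) ∧ ‖Q‖ ≤ √C := by
  have hsq : ∀ φ : L2 P, eLpNorm (fun x => a x * R φ x) 2 volume ^ 2 ≤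
      ENNReal.ofReal C * ‖φ‖ₑ ^ 2 := fun φ => by
    have h1 := eLpNorm_nnreal_pow_eq_lintegral (f := fun x => a x * R φ x) (μ := volume)
      (p := 2) (by norm_num)
    simp only [ENNReal.coe_ofNat, NNReal.coe_ofNat] at h1
    rw [← ENNReal.rpow_ofNat, h1]
    refine le_trans (le_of_eq (lintegral_congr fun x => ?_)) (h φ)
    rw [ENNReal.rpow_ofNat, enorm_mul, mul_pow]
  have hmem : ∀ φ : L2 P, MemLp (fun x => a x * R φ x) 2 volume := fun φ => by
    refine ⟨ha.mul (Lp.memLp (R φ)).1, lt_top_iff_ne_top.2 fun htop => ?_⟩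
    have := hsq φ
    rw [htop] at this
    simp only [ne_eq, OfNat.ofNat_ne_zero, not_false_eq_true, ENNReal.top_pow, top_le_iff] at this
    exact ENNReal.mul_ne_top ENNReal.ofReal_ne_top (by simp) this
  let Q₀ : L2 P →ₗ[ℂ] L2 P :=
    { toFun := fun φ => (hmem φ).toLp _
      map_add' := fun φ ψ => by
        apply Lp.ext
        filter_upwards [(hmem (φ + ψ)).coeFn_toLp, (hmem φ).coeFn_toLp, (hmem ψ).coeFn_toLp,
          Lp.coeFn_add ((hmem φ).toLp _) ((hmem ψ).toLp _), Lp.coeFn_add (R φ) (R ψ)]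
          with x h1 h2 h3 h4 h5
        rw [h1, h4, Pi.add_apply, h2, h3, map_add, h5, Pi.add_apply, mul_add]
      map_smul' := fun c φ => by
        apply Lp.ext
        filter_upwards [(hmem (c • φ)).coeFn_toLp, (hmem φ).coeFn_toLp,
          Lp.coeFn_smul c ((hmem φ).toLp _), Lp.coeFn_smul c (R φ)] with x h1 h2 h3 h4
        rw [h1, RingHom.id_apply, h3, Pi.smul_apply, h2, map_smul, h4, Pi.smul_apply, smul_eq_mul,
          smul_eq_mul, mul_left_comm] }
  have hbound : ∀ φ, ‖Q₀ φ‖ ≤ √C * ‖φ‖ := fun φ => by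
    rw [← sq_le_sq₀ (norm_nonneg _) (by positivity), mul_pow, Real.sq_sqrt hC]
    have h1 := hsq φ
    have h2 : ‖Q₀ φ‖ₑ = eLpNorm (fun x => a x * R φ x) 2 volume := Lp.enorm_toLp (hmem φ)
    rw [← h2, ← ofReal_norm, ← ofReal_norm, ← ENNReal.ofReal_pow (norm_nonneg _),
      ← ENNReal.ofReal_pow (norm_nonneg _), ← ENNReal.ofReal_mul hC] at h1
    exact (ENNReal.ofReal_le_ofReal_iff (by positivity)).1 h1
  exact ⟨Q₀.mkContinuous _ hbound, fun φ => (hmem φ).coeFn_toLp,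
    LinearMap.mkContinuous_norm_le _ (Real.sqrt_nonneg _) _⟩

/-- Factor `m = √|m| · (m / √|m|)`. Both factors times `R` are bounded operators of norm at most
`√C`, and `T` is the adjoint of the first times the second. The quotient is zero where `m = 0`. -/
theorem exists_isFormOp (hm : AEStronglyMeasurable m volume) {C : ℝ} (hC : 0 ≤ C)
    (h : FormBound m R C) : ∃ T, IsFormOp m R T ∧ ‖T‖ ≤ C := by
  let a : P → ℂ := fun x => (√|m x| : ℝ)
  let b : P → ℂ := fun x => (m x / √|m x| : ℝ)
  have hm' := hm.aemeasurable
  have ha : AEStronglyMeasurable a volume :=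
    (Complex.measurable_ofReal.comp_aemeasurable hm'.norm.sqrt).aestronglyMeasurable
  have hb : AEStronglyMeasurable b volume :=
    (Complex.measurable_ofReal.comp_aemeasurable (hm'.div hm'.norm.sqrt)).aestronglyMeasurable
  have hsa : ∀ x, ‖a x‖ ^ 2 = |m x| := fun x => by
    rw [Complex.norm_real, Real.norm_of_nonneg (Real.sqrt_nonneg _), Real.sq_sqrt (abs_nonneg _)]
  have hsb : ∀ x, ‖b x‖ ^ 2 = |m x| := fun x => by
    rw [Complex.norm_real, norm_div, div_pow, Real.norm_of_nonneg (Real.sqrt_nonneg _),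
      Real.sq_sqrt (abs_nonneg _), Real.norm_eq_abs, sq]
    by_cases h0 : |m x| = 0
    · rw [h0, zero_mul, zero_div]
    · field_simp
  have hea : ∀ {c : P → ℂ}, (∀ x, ‖c x‖ ^ 2 = |m x|) → ∀ x, ‖c x‖ₑ ^ 2 = ‖m x‖ₑ :=
    fun {c} hc x => by
      rw [← ofReal_norm, ← ENNReal.ofReal_pow (norm_nonneg _), hc, ← ofReal_norm,
        Real.norm_eq_abs]
  obtain ⟨Qa, hQa, hna⟩ := exists_mul_operator ha R hC (by simpa only [FormBound, hea hsa] using h)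
  obtain ⟨Qb, hQb, hnb⟩ := exists_mul_operator hb R hC (by simpa only [FormBound, hea hsb] using h)
  have hab : ∀ x, conj (a x) * b x = m x := fun x => by
    simp only [a, b, Complex.conj_ofReal, ← Complex.ofReal_mul]
    congr 1
    by_cases h0 : √|m x| = 0
    · have : m x = 0 := by simpa using h0
      simp [this]
    · field_simp
  have hpt : ∀ φ ψ : L2 P, (fun x => ⟪Qa φ x, Qb ψ x⟫_ℂ) =ᵐ[volume]
      fun x => (m x : ℂ) * (conj (R φ x) * R ψ x) := fun φ ψ => by
    filter_upwards [hQa φ, hQb ψ] with x h1 h2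
    rw [h1, h2, ← hab, RCLike.inner_apply, map_mul]
    ring
  refine ⟨Qa.adjoint ∘L Qb, fun φ ψ => ⟨(L2.integrable_inner (Qa φ) (Qb ψ)).congr (hpt φ ψ), ?_⟩,
    ?_⟩
  · rw [ContinuousLinearMap.comp_apply, ContinuousLinearMap.adjoint_inner_right, L2.inner_def]
    exact integral_congr_ae (hpt φ ψ)
  · refine (ContinuousLinearMap.opNorm_comp_le _ _).trans ?_
    rw [LinearIsometryEquiv.norm_map]
    calc ‖Qa‖ * ‖Qb‖ ≤ √C * √C := by gcongr
      _ = C := Real.mul_self_sqrt hC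

theorem IsFormOp.unique (h : IsFormOp m R T) (h' : IsFormOp m R T') : T = T' := by
  ext1 ψ
  exact ext_inner_left ℂ fun φ => (h φ ψ).2.trans (h' φ ψ).2.symm

theorem IsFormOp.sub (h : IsFormOp m R T) (h' : IsFormOp m' R T') :
    IsFormOp (fun x => m x - m' x) R (T - T') := fun φ ψ => by
  have hpt : (fun x => (((m x - m' x : ℝ)) : ℂ) * (conj (R φ x) * R ψ x)) = fun x =>
      (m x : ℂ) * (conj (R φ x) * R ψ x) - (m' x : ℂ) * (conj (R φ x) * R ψ x) := by
    ext x
    push_cast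
    ring
  rw [hpt]
  refine ⟨(h φ ψ).1.sub (h' φ ψ).1, ?_⟩
  rw [integral_sub (h φ ψ).1 (h' φ ψ).1, ← (h φ ψ).2, ← (h' φ ψ).2, _root_.sub_apply,
    inner_sub_right]

theorem IsFormOp.isSelfAdjoint (h : IsFormOp m R T) : IsSelfAdjoint T := by
  rw [ContinuousLinearMap.isSelfAdjoint_iff_isSymmetric]
  intro φ ψ
  simp only [ContinuousLinearMap.coe_coe]
  rw [(h φ ψ).2, ← inner_conj_symm, (h ψ φ).2, ← integral_conj]
  refine integral_congr_ae (Eventually.of_forall fun x => ?_)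
  simp only [map_mul, Complex.conj_ofReal, Complex.conj_conj]
  ring

/-- By uniqueness `T - T'` is the operator of the difference potential. Form approximation of a
potential thus becomes norm approximation of the sandwiched operator. -/
theorem IsFormOp.norm_sub_le (h : IsFormOp m R T) (h' : IsFormOp m' R T')
    (hm : AEStronglyMeasurable (fun x => m x - m' x) volume) {C : ℝ} (hC : 0 ≤ C)
    (hb : FormBound (fun x => m x - m' x) R C) : ‖T - T'‖ ≤ C := by
  obtain ⟨T₁, h1, h2⟩ := exists_isFormOp hm hC hb
  rwa [(h.sub h').unique h1]

theorem isFormOp_of_bounded (hm : MemLp (fun x => (m x : ℂ)) ⊤ volume) (hR : IsSelfAdjoint R) :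
    IsFormOp m R (R * mulOp (fun x => (m x : ℂ)) * R) := fun φ ψ => by
  have hpt : (fun x => ⟪R φ x, mulOp (fun x => (m x : ℂ)) (R ψ) x⟫_ℂ) =ᵐ[volume]
      fun x => (m x : ℂ) * (conj (R φ x) * R ψ x) := by
    filter_upwards [coeFn_mulOp hm (R ψ)] with x h1
    rw [h1, RCLike.inner_apply]
    ring
  refine ⟨(L2.integrable_inner (R φ) (mulOp (fun x => (m x : ℂ)) (R ψ))).congr hpt, ?_⟩
  rw [mul_apply_eq_comp, mul_apply_eq_comp, ← IsSelfAdjoint.inner_left hR, L2.inner_def]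
  exact integral_congr_ae hpt

theorem formBound_of_norm_le {C : ℝ} (h : ∀ᵐ x, ‖m x‖ ≤ C)
    (hR : ∀ φ, ‖R φ‖ ≤ ‖φ‖) : FormBound m R C := fun φ => by
  calc ∫⁻ x, ‖m x‖ₑ * ‖R φ x‖ₑ ^ 2 ≤ ∫⁻ x, ENNReal.ofReal C * ‖R φ x‖ₑ ^ 2 := by
        refine lintegral_mono_ae ?_
        filter_upwards [h] with x hx
        gcongr
        rw [← ofReal_norm]
        exact ENNReal.ofReal_le_ofReal hx
    _ = ENNReal.ofReal C * ‖R φ‖ₑ ^ 2 := by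
        rw [lintegral_const_mul' _ _ ENNReal.ofReal_ne_top, enorm_sq_eq_lintegral]
    _ ≤ ENNReal.ofReal C * ‖φ‖ₑ ^ 2 := by
        gcongr
        rw [← ofReal_norm, ← ofReal_norm]
        exact ENNReal.ofReal_le_ofReal (hR φ)

theorem FormBound.of_le_add {n : P → ℝ} {C D : ℝ} (hC : 0 ≤ C) (hD : 0 ≤ D)
    (hm : AEStronglyMeasurable m volume) (h : FormBound m R C) (h' : FormBound m' R D)
    (hle : ∀ᵐ x, ‖n x‖ ≤ ‖m x‖ + ‖m' x‖) : FormBound n R (C + D) := fun φ => by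
  calc ∫⁻ x, ‖n x‖ₑ * ‖R φ x‖ₑ ^ 2
      ≤ ∫⁻ x, ‖m x‖ₑ * ‖R φ x‖ₑ ^ 2 + ‖m' x‖ₑ * ‖R φ x‖ₑ ^ 2 := by
        refine lintegral_mono_ae ?_
        filter_upwards [hle] with x hx
        rw [← add_mul]
        gcongr
        rw [← ofReal_norm, ← ofReal_norm, ← ofReal_norm,
          ← ENNReal.ofReal_add (norm_nonneg _) (norm_nonneg _)]
        exact ENNReal.ofReal_le_ofReal hx
    _ = (∫⁻ x, ‖m x‖ₑ * ‖R φ x‖ₑ ^ 2) + ∫⁻ x, ‖m' x‖ₑ * ‖R φ x‖ₑ ^ 2 :=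
        lintegral_add_left' (hm.enorm.mul ((Lp.memLp (R φ)).1.enorm.pow_const 2)) _
    _ ≤ ENNReal.ofReal C * ‖φ‖ₑ ^ 2 + ENNReal.ofReal D * ‖φ‖ₑ ^ 2 := add_le_add (h φ) (h' φ)
    _ = ENNReal.ofReal (C + D) * ‖φ‖ₑ ^ 2 := by rw [ENNReal.ofReal_add hC hD, add_mul]

/-- The form bound in terms of `(1 - Δ)^{-1/2}` is invariant under translations. -/
theorem FormBound.translate {C : ℝ} (h : FormBound m (besselOp P) C) (y : P) :
    FormBound (fun x => m (x - y)) (besselOp P) C := fun φ => by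
  have h1 := h (transOp y φ)
  have h2 : besselOp P (transOp y φ) = transOp y (besselOp P φ) :=
    (DFunLike.congr_fun (transOp_mul_besselOp y) φ).symm
  have h3 : ‖transOp y φ‖ₑ = ‖φ‖ₑ := by
    rw [← ofReal_norm, norm_transOp_apply, ofReal_norm]
  rw [h2, h3] at h1
  refine le_trans (le_of_eq ?_) h1
  rw [← lintegral_add_right_eq_self (fun x => ‖m (x - y)‖ₑ * ‖besselOp P φ x‖ₑ ^ 2) y]
  refine lintegral_congr_ae ?_
  filter_upwards [coeFn_transOp y (besselOp P φ)] with x hx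
  rw [hx, add_sub_cancel_right]

end Forms

/-! ### Approximation of admissible potentials -/

section Admissible

variable {d : ℕ}

/-- Bounded measurable functions of bounded support. -/
structure IsNice (g : Conf d → ℝ) : Prop where
  measurable : Measurable g
  bounded : ∃ C, ∀ x, ‖g x‖ ≤ C
  support : ∃ r, ∀ x, r < ‖x‖ → g x = 0

theorem IsNice.add {f g : Conf d → ℝ} (hf : IsNice f) (hg : IsNice g) : IsNice (f + g) := by
  obtain ⟨C, hC⟩ := hf.bounded
  obtain ⟨D, hD⟩ := hg.bounded
  obtain ⟨r, hr⟩ := hf.support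
  obtain ⟨r', hr'⟩ := hg.support
  refine ⟨hf.measurable.add hg.measurable, ⟨C + D, fun x => (norm_add_le _ _).trans
    (add_le_add (hC x) (hD x))⟩, ⟨max r r', fun x hx => ?_⟩⟩
  rw [Pi.add_apply, hr x ((le_max_left _ _).trans_lt hx), hr' x ((le_max_right _ _).trans_lt hx),
    add_zero]

/-- For `f ∈ L^p`, compactly supported continuous functions are dense and the Sobolev bound turns
`L^p` smallness into form smallness. For bounded `f` vanishing at infinity, cutting off outside a
large ball leaves a uniformly small remainder. -/
theorem IsAdmissible.exists_isNice {f : Conf d → ℝ} (hf : IsAdmissible f) {ε : ℝ} (hε : 0 < ε) :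
    ∃ g, IsNice g ∧ FormBound (fun x => f x - g x) (besselOp (Conf d)) ε := by
  rcases hf with ⟨p, hp, hfp⟩ | ⟨hft, hf0⟩
  -- The midpoint leaves room on both sides: `s > d/2` for the frequency integral and `s < p` for
  -- the dyadic sum.
  · set s := (max 1 ((d : ℝ) / 2) + p) / 2 with hs
    have h1 : (1 : ℝ) ≤ max 1 ((d : ℝ) / 2) := le_max_left _ _
    have h2 : (d : ℝ) / 2 ≤ max 1 ((d : ℝ) / 2) := le_max_right _ _
    have hsp : s < p := by rw [hs]; linarith
    have hs1 : 1 ≤ s := by rw [hs]; linarith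
    have hsd : (Module.finrank ℝ (Conf d) : ℝ) < 2 * s := by
      rw [finrank_euclideanSpace_fin, hs]; linarith
    set K := sobolevConst (Conf d) s p
    have hK : K < ⊤ := sobolevConst_lt_top hsd (by linarith) hsp
    have hδ : ENNReal.ofReal ε / K ≠ 0 :=
      (ENNReal.div_pos (by simpa using hε) hK.ne).ne'
    obtain ⟨g, hgc, hg, hgcont, -⟩ :=
      hfp.exists_hasCompactSupport_eLpNorm_sub_le ENNReal.ofReal_ne_top hδ
    have hg2 : MemLp g (ENNReal.ofReal p) volume := hgcont.memLp_of_hasCompactSupport hgc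
    refine ⟨g, ⟨hgcont.measurable, ?_, ?_⟩, fun φ => ?_⟩
    · exact hgcont.bounded_above_of_compact_support hgc
    · obtain ⟨r, hr⟩ := hgc.isCompact.isBounded.subset_closedBall 0
      refine ⟨r, fun x hx => image_eq_zero_of_notMem_tsupport fun hx' => ?_⟩
      have := hr hx'
      rw [mem_closedBall_zero_iff] at this
      linarith
    · refine (lintegral_mul_sq_le hsd hs1 hsp (hfp.sub hg2) _).trans ?_
      calc K * eLpNorm (f - g) (ENNReal.ofReal p) volume * sobolevSq (besselOp (Conf d) φ)
          ≤ K * (ENNReal.ofReal ε / K) * ‖φ‖ₑ ^ 2 := by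
            gcongr
            exact sobolevSq_besselOp_le φ
        _ ≤ ENNReal.ofReal ε * ‖φ‖ₑ ^ 2 := by
            gcongr
            exact ENNReal.mul_div_le
  · obtain ⟨t₁, ht₁, t₂, ht₂, hsub⟩ := Filter.mem_inf_iff_superset.1
      ((Metric.tendsto_nhds.1 hf0) ε hε)
    obtain ⟨K, hK, hKt⟩ := mem_cocompact.1 ht₁
    obtain ⟨r, hr⟩ := hK.isBounded.subset_closedBall 0
    set C := (eLpNorm f ⊤ volume).toReal with hC
    have hfC : ∀ᵐ x, ‖f x‖ ≤ C := by
      filter_upwards [ae_le_eLpNormEssSup (f := f) (μ := volume)] with x hx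
      rw [hC, eLpNorm_exponent_top, ← toReal_enorm]
      refine (ENNReal.toReal_le_toReal (by simp) ?_).2 hx
      rw [← eLpNorm_exponent_top]
      exact hft.2.ne
    set f' := hft.1.mk f with hf'
    have hff' : f =ᵐ[volume] f' := hft.1.ae_eq_mk
    have hf'm : Measurable f' := hft.1.stronglyMeasurable_mk.measurable
    have hC0 : 0 ≤ C := ENNReal.toReal_nonneg
    -- A measurable representative is clamped to `[-C, C]`, because `IsNice` asks for measurability
    -- and a bound at every point; almost everywhere the clamp changes nothing.
    set g : Conf d → ℝ := (Metric.closedBall 0 r).indicator fun x => max (-C) (min C (f' x))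
      with hg
    refine ⟨g, ⟨?_, ⟨C, fun x => ?_⟩, ⟨r, fun x hx => ?_⟩⟩, ?_⟩
    · exact (measurable_const.max (measurable_const.min hf'm)).indicator
        Metric.isClosed_closedBall.measurableSet
    · refine (norm_indicator_le_norm_self _ _).trans ?_
      rw [Real.norm_eq_abs, abs_le]
      exact ⟨le_max_left _ _, max_le (by linarith) (min_le_left _ _)⟩
    · refine Set.indicator_of_notMem (fun hx' => ?_) _
      rw [mem_closedBall_zero_iff] at hx'
      linarith
    · refine formBound_of_norm_le ?_ norm_besselOp_apply_le
      filter_upwards [hfC, hff', ht₂] with x h1 h2 h3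
      by_cases hx : x ∈ Metric.closedBall (0 : Conf d) r
      · rw [Real.norm_eq_abs, abs_le] at h1
        rw [hg, Set.indicator_of_mem hx, ← h2, min_eq_right h1.2, max_eq_right h1.1, sub_self,
          norm_zero]
        exact hε.le
      · rw [hg, Set.indicator_of_notMem hx, sub_zero]
        have h4 : dist (f x) 0 < ε := hsub ⟨hKt (fun hxK => hx (hr hxK)), h3⟩
        rw [dist_zero_right] at h4
        exact h4.le

/-- Sums of two admissible functions are, in the sense of forms, limits of bounded functions of
bounded support. -/
theorem exists_isNice_of_sum {w f₁ f₂ : Conf d → ℝ} (h₁ : IsAdmissible f₁) (h₂ : IsAdmissible f₂)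
    (hw : w =ᵐ[volume] f₁ + f₂) {ε : ℝ} (hε : 0 < ε) :
    ∃ g, IsNice g ∧ FormBound (fun x => w x - g x) (besselOp (Conf d)) ε := by
  obtain ⟨g₁, hg₁, hb₁⟩ := h₁.exists_isNice (half_pos hε)
  obtain ⟨g₂, hg₂, hb₂⟩ := h₂.exists_isNice (half_pos hε)
  have hm₁ : AEStronglyMeasurable f₁ volume := by
    rcases h₁ with ⟨p, -, h⟩ | ⟨h, -⟩ <;> exact h.1
  refine ⟨g₁ + g₂, hg₁.add hg₂, ?_⟩
  rw [← add_halves ε]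
  refine hb₁.of_le_add (half_pos hε).le (half_pos hε).le
    (hm₁.sub hg₁.measurable.aestronglyMeasurable) hb₂ ?_
  filter_upwards [hw] with x hx
  rw [hx, Pi.add_apply, Pi.add_apply, add_sub_add_comm]
  exact norm_add_le _ _

theorem aestronglyMeasurable_of_sum {w f₁ f₂ : Conf d → ℝ} (h₁ : IsAdmissible f₁)
    (h₂ : IsAdmissible f₂) (hw : w =ᵐ[volume] f₁ + f₂) : AEStronglyMeasurable w volume := by
  have hm₁ : AEStronglyMeasurable f₁ volume := by
    rcases h₁ with ⟨p, -, h⟩ | ⟨h, -⟩ <;> exact h.1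
  have hm₂ : AEStronglyMeasurable f₂ volume := by
    rcases h₂ with ⟨p, -, h⟩ | ⟨h, -⟩ <;> exact h.1
  exact (hm₁.add hm₂).congr hw.symm

end Admissible

end

end ManyBody

namespace ManyBody

open scoped FourierTransform ENNReal

noncomputable section

/-! ### Fourier multipliers -/

section Multiplier

variable {E : Type*} [NormedAddCommGroup E] [InnerProductSpace ℝ E] [FiniteDimensional ℝ E]
  [MeasurableSpace E] [BorelSpace E]

theorem mulOp_add {m n : E → ℂ} (hm : MemLp m ⊤ volume) (hn : MemLp n ⊤ volume) :
    (mulOp fun x => m x + n x) = mulOp m + mulOp n := by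
  ext1 f
  apply Lp.ext
  rw [_root_.add_apply]
  have hmn : MemLp (fun x => m x + n x) ⊤ volume := hm.add hn
  filter_upwards [coeFn_mulOp hm f, coeFn_mulOp hn f, coeFn_mulOp hmn f,
    Lp.coeFn_add (mulOp m f) (mulOp n f)] with x h1 h2 h3 h4
  rw [h4, Pi.add_apply, h1, h2, h3, add_mul]

theorem mulOp_sum {ι : Type*} (s : Finset ι) {m : ι → E → ℂ} (hm : ∀ i, MemLp (m i) ⊤ volume) :
    (mulOp fun x => ∑ i ∈ s, m i x) = ∑ i ∈ s, mulOp (m i) := by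
  classical
  induction s using Finset.induction_on with
  | empty =>
    ext1 f
    apply Lp.ext
    simp only [Finset.sum_empty]
    filter_upwards [coeFn_mulOp (memLp_top_const (0 : ℂ)) f,
      Lp.coeFn_zero ℂ 2 (volume : Measure E)] with x h1 h2
    rw [h1, zero_mul, _root_.zero_apply, h2, Pi.zero_apply]
  | insert a s ha ih =>
    simp only [Finset.sum_insert ha]
    rw [mulOp_add (hm a) (memLp_finsetSum s fun i _ => hm i), ih]

/-- The Fourier multiplier with a given symbol. -/
def multOp (m : E → ℂ) : L2 E →L[ℂ] L2 E :=
  (fourierOp E).adjoint ∘L mulOp m ∘L fourierOp E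

theorem fourierOp_multOp (m : E → ℂ) (f : L2 E) :
    fourierOp E (multOp m f) = mulOp m (fourierOp E f) :=
  DFunLike.congr_fun (fourierOp_comp_adjoint (E := E)) (mulOp m (fourierOp E f))

theorem coeFn_fourier_multOp {m : E → ℂ} (hm : MemLp m ⊤ volume) (f : L2 E) :
    (𝓕 (multOp m f) : L2 E) =ᵐ[volume] fun k => m k * (𝓕 f : L2 E) k := by
  rw [← fourierOp_apply, fourierOp_multOp]
  exact coeFn_mulOp hm _

theorem multOp_mul {m n : E → ℂ} (hm : MemLp m ⊤ volume) (hn : MemLp n ⊤ volume)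
    (hmn : MemLp (fun x => m x * n x) ⊤ volume) :
    multOp m * multOp n = multOp fun x => m x * n x := by
  refine eq_of_fourierOp_comp fun f => ?_
  rw [mul_apply_eq_comp, fourierOp_multOp, fourierOp_multOp, fourierOp_multOp,
    ← mulOp_comp hm hn hmn, ContinuousLinearMap.comp_apply]

theorem inner_multOp_left {m : E → ℂ} (hm : MemLp m ⊤ volume) (f g : L2 E) :
    ⟪multOp m f, g⟫_ℂ = ⟪f, multOp (fun x => conj (m x)) g⟫_ℂ := by
  simp only [multOp, ContinuousLinearMap.comp_apply]
  rw [ContinuousLinearMap.adjoint_inner_left, ContinuousLinearMap.adjoint_inner_right,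
    inner_mulOp_left hm]

theorem multOp_sum {ι : Type*} (s : Finset ι) {m : ι → E → ℂ} (hm : ∀ i, MemLp (m i) ⊤ volume) :
    (multOp fun x => ∑ i ∈ s, m i x) = ∑ i ∈ s, multOp (m i) := by
  refine eq_of_fourierOp_comp fun f => ?_
  rw [fourierOp_multOp, mulOp_sum s hm, _root_.sum_apply, _root_.sum_apply, map_sum]
  exact Finset.sum_congr rfl fun i _ => (fourierOp_multOp _ _).symm

theorem multOp_add {m n : E → ℂ} (hm : MemLp m ⊤ volume) (hn : MemLp n ⊤ volume) :
    (multOp fun x => m x + n x) = multOp m + multOp n := by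
  refine eq_of_fourierOp_comp fun f => ?_
  rw [fourierOp_multOp, mulOp_add hm hn, _root_.add_apply, _root_.add_apply, map_add,
    fourierOp_multOp, fourierOp_multOp]

theorem multOp_one : multOp (fun _ : E => (1 : ℂ)) = 1 := by
  refine eq_of_fourierOp_comp fun f => ?_
  rw [fourierOp_multOp, mulOp_one]
  rfl

end Multiplier

/-! ### The range of `(1 - Δ)^{-1/2}` as a Sobolev space -/

section Riesz

variable {d : ℕ}

/-- The symbol of `∂_i (1 - Δ)^{-1/2}`. -/
def rieszSymbol (i : Fin d) (k : Conf d) : ℂ :=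
  (2 * Real.pi * Complex.I) * ((k i : ℝ) : ℂ) * (besselSymbol k : ℂ)

/-- The symbol form of `J (1 - Δ) J = 1`, which lets a function with a weak gradient be written as
`J f`. -/
theorem rieszSymbol_sum (k : Conf d) :
    (∑ i, conj (rieszSymbol i k) * rieszSymbol i k) +
      (besselSymbol k : ℂ) * (besselSymbol k : ℂ) = 1 := by
  have h1 : ∀ i, conj (rieszSymbol i k) * rieszSymbol i k =
      (((2 * Real.pi) ^ 2 * (k i) ^ 2 * besselSymbol k ^ 2 : ℝ) : ℂ) := fun i => by
    simp only [rieszSymbol, map_mul, Complex.conj_ofReal, Complex.conj_I, map_ofNat]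
    push_cast
    linear_combination (-(2 * Real.pi) ^ 2 * (k i : ℂ) ^ 2 * (besselSymbol k : ℂ) ^ 2) *
      Complex.I_sq
  have h2 : ∑ i, (k i) ^ 2 = ‖k‖ ^ 2 := by
    rw [EuclideanSpace.norm_sq_eq]
    simp
  have h3 := besselSymbol_inv_sq k
  have h4 := (besselSymbol_pos k).ne'
  rw [Finset.sum_congr rfl fun i _ => h1 i, ← Complex.ofReal_sum, ← Finset.sum_mul,
    ← Finset.mul_sum, h2, ← Complex.ofReal_mul, ← Complex.ofReal_add, ← Complex.ofReal_one]
  congr 1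
  calc (2 * Real.pi) ^ 2 * ‖k‖ ^ 2 * besselSymbol k ^ 2 + besselSymbol k * besselSymbol k
      = (besselSymbol k)⁻¹ ^ 2 * besselSymbol k ^ 2 := by rw [h3]; ring
    _ = 1 := by field_simp

theorem norm_rieszSymbol_le (i : Fin d) (k : Conf d) : ‖rieszSymbol i k‖ ≤ 1 := by
  have h := besselSymbol_inv_sq k
  have hpos := besselSymbol_pos k
  have h5 : 2 * Real.pi * ‖k‖ ≤ (besselSymbol k)⁻¹ := by
    refine le_of_sq_le_sq ?_ (inv_nonneg.2 hpos.le)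
    linarith
  have h6 : ‖k i‖ ≤ ‖k‖ := PiLp.norm_apply_le k i
  rw [rieszSymbol, norm_mul, norm_mul, norm_mul, norm_mul, Complex.norm_I, Complex.norm_real,
    Complex.norm_real, Complex.norm_real, Real.norm_of_nonneg hpos.le, mul_one,
    Real.norm_of_nonneg Real.pi_pos.le, Complex.norm_ofNat]
  calc 2 * Real.pi * ‖k i‖ * besselSymbol k ≤ 2 * Real.pi * ‖k‖ * besselSymbol k := by gcongr
    _ ≤ (besselSymbol k)⁻¹ * besselSymbol k := by gcongr
    _ = 1 := inv_mul_cancel₀ hpos.ne'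

theorem memLp_rieszSymbol (i : Fin d) : MemLp (rieszSymbol i) ⊤ volume := by
  refine memLp_top_of_bound (Continuous.aestronglyMeasurable ?_) 1
    (Eventually.of_forall (norm_rieszSymbol_le i))
  unfold rieszSymbol
  have := continuous_besselSymbol (E := Conf d)
  fun_prop

theorem memLp_conj_rieszSymbol (i : Fin d) :
    MemLp (fun k => conj (rieszSymbol i k)) ⊤ volume := (memLp_rieszSymbol i).star

theorem memLp_top_mul {m n : Conf d → ℂ} (hm : MemLp m ⊤ volume) (hn : MemLp n ⊤ volume) :
    MemLp (fun k => m k * n k) ⊤ volume := hn.mul' hm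

/-- The operator `∂_i (1 - Δ)^{-1/2}`. -/
def rieszOp (i : Fin d) : L2 (Conf d) →L[ℂ] L2 (Conf d) := multOp (rieszSymbol i)

theorem besselOp_eq_multOp :
    besselOp (Conf d) = multOp fun k => (besselSymbol k : ℂ) := rfl

theorem sum_riesz_add_bessel :
    (∑ i : Fin d, multOp (fun k => conj (rieszSymbol i k)) * rieszOp i) +
      besselOp (Conf d) * besselOp (Conf d) = 1 := by
  have h1 : ∀ i : Fin d, multOp (fun k => conj (rieszSymbol i k)) * rieszOp i =
      multOp fun k => conj (rieszSymbol i k) * rieszSymbol i k := fun i =>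
    multOp_mul (memLp_conj_rieszSymbol i) (memLp_rieszSymbol i)
      (memLp_top_mul (memLp_conj_rieszSymbol i) (memLp_rieszSymbol i))
  have hb := memLp_top_mul (memLp_besselSymbol (E := Conf d)) memLp_besselSymbol
  rw [Finset.sum_congr rfl fun i _ => h1 i, ← multOp_sum _ fun i =>
    memLp_top_mul (memLp_conj_rieszSymbol i) (memLp_rieszSymbol i), besselOp_eq_multOp,
    multOp_mul memLp_besselSymbol memLp_besselSymbol hb, ← multOp_add
      (memLp_finsetSum _ fun i _ => memLp_top_mul (memLp_conj_rieszSymbol i) (memLp_rieszSymbol i))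
      hb, ← multOp_one]
  congr 1
  ext k
  exact rieszSymbol_sum k

theorem isWeakGradient_besselOp (f : L2 (Conf d)) :
    IsWeakGradient (besselOp (Conf d) f) fun i => rieszOp i f := by
  rw [isWeakGradient_iff_fourier]
  intro i
  filter_upwards [coeFn_fourier_multOp (memLp_rieszSymbol i) f, coeFn_fourier_besselOp f]
    with k h1 h2
  rw [rieszOp, h1, h2, rieszSymbol]
  ring

theorem IsWeakGradient.unique {u : L2 (Conf d)} {g g' : Fin d → L2 (Conf d)}
    (h : IsWeakGradient u g) (h' : IsWeakGradient u g') (i : Fin d) : g i = g' i := by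
  rw [isWeakGradient_iff_fourier] at h h'
  refine fourierOp_injective (Lp.ext ?_)
  filter_upwards [h i, h' i] with k h1 h2
  rw [fourierOp_apply, fourierOp_apply, h1, h2]

/-- The range of `(1 - Δ)^{-1/2}` is `H¹`. -/
theorem IsWeakGradient.exists_besselOp {u : L2 (Conf d)} {g : Fin d → L2 (Conf d)}
    (h : IsWeakGradient u g) : ∃ f, u = besselOp (Conf d) f := by
  have h1 : ∀ i, rieszOp i u = besselOp (Conf d) (g i) := fun i => by
    refine fourierOp_injective (Lp.ext ?_)
    rw [isWeakGradient_iff_fourier] at h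
    filter_upwards [h i, coeFn_fourier_multOp (memLp_rieszSymbol i) u,
      coeFn_fourier_besselOp (g i)] with k h1 h2 h3
    rw [fourierOp_apply, fourierOp_apply, rieszOp, h2, h3, h1, rieszSymbol]
    ring
  have h2 : ∀ i (f : L2 (Conf d)), multOp (fun k => conj (rieszSymbol i k)) (besselOp (Conf d) f) =
      besselOp (Conf d) (multOp (fun k => conj (rieszSymbol i k)) f) := fun i f => by
    have hc := memLp_conj_rieszSymbol i
    have hb := memLp_besselSymbol (E := Conf d)
    rw [besselOp_eq_multOp, ← mul_apply_eq_comp, ← mul_apply_eq_comp,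
      multOp_mul hc hb (memLp_top_mul hc hb), multOp_mul hb hc (memLp_top_mul hb hc)]
    simp only [mul_comm]
  have h3 := DFunLike.congr_fun (sum_riesz_add_bessel (d := d)) u
  -- The witness is `(1 - Δ)^{1/2} u`, written with bounded operators: in `u = ∑ R_i* R_i u + J J u`
  -- replace `R_i u` by `J g_i` and pull `J` to the front.
  refine ⟨(∑ i, multOp (fun k => conj (rieszSymbol i k)) (g i)) + besselOp (Conf d) u, ?_⟩
  rw [one_apply_eq_self, _root_.add_apply, _root_.sum_apply] at h3
  simp only [mul_apply_eq_comp, h1, h2] at h3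
  rw [map_add, map_sum]
  exact h3.symm

/-- `J` is isometric from `L²` to `H¹`, so the kinetic form can be rewritten with bounded operators.
-/
theorem inner_gradient_add (f f' : L2 (Conf d)) :
    (∑ i, ⟪rieszOp i f', rieszOp i f⟫_ℂ) + ⟪besselOp (Conf d) f', besselOp (Conf d) f⟫_ℂ =
      ⟪f', f⟫_ℂ := by
  have h3 := DFunLike.congr_fun (sum_riesz_add_bessel (d := d)) f
  rw [one_apply_eq_self, _root_.add_apply, _root_.sum_apply] at h3
  simp only [mul_apply_eq_comp] at h3
  conv_rhs => rw [← h3, inner_add_right, inner_sum]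
  rw [IsSelfAdjoint.inner_left isSelfAdjoint_besselOp]
  congr 1
  exact Finset.sum_congr rfl fun i _ => inner_multOp_left (memLp_rieszSymbol i) _ _

end Riesz

/-! ### The one-particle resolvent -/

section OneParticle

variable {H : Type*} [NormedAddCommGroup H] [InnerProductSpace ℂ H] [CompleteSpace H]

/-- A symmetric form on the form domain `ran J` that is semibounded, and bounded below by one on
its operator domain, is coercive. -/
theorem exists_coercive {J B : H →L[ℂ] H} (hJ : IsSelfAdjoint J) (hJi : ∀ x, J x = 0 → x = 0)
    {c l : ℝ} (hc : 0 < c) (hl : 0 ≤ l)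
    (hB : ∀ f, c * ‖f‖ ^ 2 ≤ (⟪f, B f⟫_ℂ).re + l * ‖J f‖ ^ 2)
    (h : ∀ f v, B f = J v → ‖J f‖ ^ 2 ≤ (⟪f, B f⟫_ℂ).re) :
    ∃ c' : ℝ, 0 < c' ∧ ∀ f, c' * ‖f‖ ^ 2 ≤ (⟪f, B f⟫_ℂ).re := by
  have hJJ : ∀ f, ⟪f, J (J f)⟫_ℂ = ((‖J f‖ ^ 2 : ℝ) : ℂ) := fun f => by
    rw [← IsSelfAdjoint.inner_left hJ, inner_self_eq_norm_sq_to_K]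
    simp
  set D := B + (l : ℂ) • (J * J) with hD
  have hDf : ∀ f, D f = B f + (l : ℂ) • J (J f) := fun f => rfl
  have hDre : ∀ f, (⟪f, D f⟫_ℂ).re = (⟪f, B f⟫_ℂ).re + l * ‖J f‖ ^ 2 := fun f => by
    rw [hDf, inner_add_right, inner_smul_right, hJJ, Complex.add_re, ← Complex.ofReal_mul,
      Complex.ofReal_re]
  have hu : IsUnit D := by
    refine ContinuousLinearMap.isUnit_of_forall_le_norm_inner_map _ (c := ⟨c, hc.le⟩) hc
      fun x => ?_
    change ‖x‖ ^ 2 * c ≤ _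
    rw [norm_inner_symm, mul_comm]
    refine (hB x).trans ?_
    rw [← hDre]
    exact Complex.re_le_norm _
  obtain ⟨D', hD1⟩ := hu.exists_right_inv
  obtain ⟨D'', hD2⟩ := hu.exists_left_inv
  -- The vectors `f = D⁻¹ J v` are dense and satisfy `B f = J (v - l J f)`. So `J f` is in the
  -- operator domain, where the lower bound is assumed; it extends by continuity.
  have key : ∀ f, ‖J f‖ ^ 2 ≤ (⟪f, B f⟫_ℂ).re := by
    have hdense : DenseRange (fun v => D' (J v)) := by
      refine DenseRange.comp (g := D') (f := J) ?_ (denseRange_of_selfAdjoint_injective hJ hJi)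
        D'.continuous
      refine Function.Surjective.denseRange fun x => ⟨D x, ?_⟩
      have : D' = D'' := by
        calc D' = D'' * D * D' := by rw [hD2, one_mul]
          _ = D'' := by rw [mul_assoc, hD1, mul_one]
      rw [this, ← mul_apply_eq_comp, hD2, one_apply_eq_self]
    refine fun f => hdense.induction_on (p := fun f => ‖J f‖ ^ 2 ≤ (⟪f, B f⟫_ℂ).re) f
      (isClosed_le (by fun_prop) (Complex.continuous_re.comp (by fun_prop))) fun v => ?_
    refine h _ (v - (l : ℂ) • J (D' (J v))) ?_
    have h1 : D (D' (J v)) = J v := by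
      rw [← mul_apply_eq_comp, hD1, one_apply_eq_self]
    rw [hDf] at h1
    rw [map_sub, map_smul]
    exact eq_sub_of_add_eq h1
  -- Combine `c‖f‖² ≤ q(f) + l‖J f‖²` with `‖J f‖² ≤ q(f)`.
  refine ⟨c / (1 + l), by positivity, fun f => ?_⟩
  rw [div_mul_eq_mul_div, div_le_iff₀ (by positivity)]
  have h1 := hB f
  have h2 := mul_le_mul_of_nonneg_left (key f) hl
  linarith

/-- Here `J B⁻¹ J` plays the role of `h⁻¹` and `A` of `h^{-1/2}`. Coercivity at `B⁻¹ J f` gives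
`c‖B⁻¹ J f‖² ≤ ⟨J B⁻¹ J f, f⟩ = ‖A f‖²`. This lets `B⁻¹ J` be factored through `A` later. -/
theorem exists_sqrt_of_coercive {J B : H →L[ℂ] H} (hJ : IsSelfAdjoint J)
    (hJi : ∀ x, J x = 0 → x = 0) (hBsa : IsSelfAdjoint B) {c : ℝ} (hc : 0 < c)
    (hcB : ∀ f, c * ‖f‖ ^ 2 ≤ (⟪f, B f⟫_ℂ).re) :
    ∃ A B' : H →L[ℂ] H, B * B' = 1 ∧ B' * B = 1 ∧ IsSelfAdjoint A ∧ (∀ x, A x = 0 → x = 0) ∧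
      A * A = J * (B' * J) ∧ ∀ f, ‖(B' * J) f‖ ^ 2 ≤ c⁻¹ * ‖A f‖ ^ 2 := by
  have hu : IsUnit B := by
    refine ContinuousLinearMap.isUnit_of_forall_le_norm_inner_map _ (c := ⟨c, hc.le⟩) hc
      fun x => ?_
    change ‖x‖ ^ 2 * c ≤ _
    rw [norm_inner_symm, mul_comm]
    exact (hcB x).trans (Complex.re_le_norm _)
  obtain ⟨⟨B, B', hBB', hB'B⟩, hBu⟩ := hu
  simp only at hBu
  subst hBu
  have hB'sa : IsSelfAdjoint B' := by
    have h1 : star B' * B = 1 := by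
      have := congrArg star hBB'
      rwa [star_mul, star_one, hBsa.star_eq] at this
    calc star B' = star B' * (B * B') := by rw [hBB', mul_one]
      _ = B' := by rw [← mul_assoc, h1, one_mul]
  have hBB'x : ∀ x, B (B' x) = x := fun x => DFunLike.congr_fun hBB' x
  set G := J * (B' * J) with hG
  have hGx : ∀ x, G x = J (B' (J x)) := fun x => rfl
  have hGsa : IsSelfAdjoint G := by
    rw [isSelfAdjoint_iff, hG, star_mul, star_mul, hJ.star_eq, hB'sa.star_eq, mul_assoc]
  have hGre : ∀ x, c * ‖B' (J x)‖ ^ 2 ≤ (⟪G x, x⟫_ℂ).re := fun x => by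
    have h1 := hcB (B' (J x))
    rwa [hBB'x, ← IsSelfAdjoint.inner_left hJ, ← hGx] at h1
  have hG0 : 0 ≤ G := by
    rw [ContinuousLinearMap.nonneg_iff_isPositive, ContinuousLinearMap.isPositive_def]
    refine ⟨ContinuousLinearMap.isSelfAdjoint_iff_isSymmetric.1 hGsa, fun x => ?_⟩
    exact le_trans (by positivity) (hGre x)
  have hAA : CFC.sqrt G * CFC.sqrt G = G := CFC.sqrt_mul_sqrt_self G
  have hAsa : IsSelfAdjoint (CFC.sqrt G) := IsSelfAdjoint.of_nonneg (CFC.sqrt_nonneg G)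
  have hAAx : ∀ x, CFC.sqrt G (CFC.sqrt G x) = G x := fun x => DFunLike.congr_fun hAA x
  refine ⟨CFC.sqrt G, B', hBB', hB'B, hAsa, fun x hx => ?_, hAA, fun f => ?_⟩
  · have h1 : G x = 0 := by rw [← hAAx, hx, map_zero]
    refine hJi x ?_
    have h2 : B' (J x) = 0 := hJi _ h1
    rw [← hBB'x (J x), h2, map_zero]
  · have h1 := hGre f
    rw [← hAAx, IsSelfAdjoint.inner_left hAsa, inner_self_eq_norm_sq_to_K] at h1
    have h2 : c * ‖B' (J f)‖ ^ 2 ≤ ‖CFC.sqrt G f‖ ^ 2 := by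
      refine h1.trans_eq ?_
      norm_cast
    rw [inv_mul_eq_div, le_div_iff₀ hc, mul_comm]
    exact h2

variable {d : ℕ} {V f₁ f₂ : Conf d → ℝ} {e : ℝ}

/-- Parametrize `H¹` as the range of `J`. For `u = J f` and `φ = J f'` the form is `⟨f', (1 + W + (e
- 1) J²) f⟩`; the shift by one arises because `∇J` accounts for `1 - J²` only. -/
theorem mem_hGraph_iff {W : L2 (Conf d) →L[ℂ] L2 (Conf d)}
    (hW : IsFormOp V (besselOp (Conf d)) W) (u v : L2 (Conf d)) :
    (u, v) ∈ hGraph V e ↔ ∃ f, u = besselOp (Conf d) f ∧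
      (1 + W + ((e - 1 : ℝ) : ℂ) • (besselOp (Conf d) * besselOp (Conf d))) f =
        besselOp (Conf d) v := by
  have hJ := isSelfAdjoint_besselOp (E := Conf d)
  have key : ∀ f f' : L2 (Conf d),
      (∑ i, ⟪rieszOp i f', rieszOp i f⟫_ℂ) +
        (∫ x, (V x : ℂ) * (conj (besselOp (Conf d) f' x) * besselOp (Conf d) f x)) +
        (e : ℂ) * ⟪besselOp (Conf d) f', besselOp (Conf d) f⟫_ℂ =
      ⟪f', (1 + W + ((e - 1 : ℝ) : ℂ) • (besselOp (Conf d) * besselOp (Conf d))) f⟫_ℂ := by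
    intro f f'
    simp only [_root_.add_apply, _root_.smul_apply, mul_apply_eq_comp, one_apply_eq_self,
      inner_add_right, inner_smul_right]
    rw [← (hW f' f).2, ← inner_gradient_add f f', ← IsSelfAdjoint.inner_left hJ f']
    push_cast
    ring
  constructor
  · rintro ⟨g, hg, h⟩
    obtain ⟨f, hf⟩ := hg.exists_besselOp
    simp only at hf h hg
    refine ⟨f, hf, ext_inner_left ℂ fun f' => ?_⟩
    have h1 := (h _ _ (isWeakGradient_besselOp f')).2
    rw [hf] at hg h1
    rw [← key, ← IsSelfAdjoint.inner_left hJ f' v, ← h1]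
    congr 3
    ext i
    rw [hg.unique (isWeakGradient_besselOp f) i]
  · rintro ⟨f, rfl, hf⟩
    refine ⟨fun i => rieszOp i f, isWeakGradient_besselOp f, fun φ G hG => ?_⟩
    obtain ⟨f', rfl⟩ := hG.exists_besselOp
    refine ⟨(hW f' f).1, ?_⟩
    simp only
    rw [IsSelfAdjoint.inner_left hJ f' v, ← hf, ← key]
    congr 3
    ext i
    rw [hG.unique (isWeakGradient_besselOp f') i]

/-- The resolvent of the one-particle operator: it is the square of a selfadjoint operator `A`, it
maps to `H¹`, it commutes asymptotically with plane waves, and it absorbs small translations. -/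
theorem exists_sqrt_resolvent (h₁ : IsAdmissible f₁) (h₂ : IsAdmissible f₂)
    (hV : V =ᵐ[volume] f₁ + f₂)
    (he : ∀ u v, (u, v) ∈ hGraph V e → ‖u‖ ^ 2 ≤ (⟪u, v⟫_ℂ).re) :
    ∃ A Z : L2 (Conf d) →L[ℂ] L2 (Conf d), IsSelfAdjoint A ∧ (∀ x, A x = 0 → x = 0) ∧
      (∀ u v, (u, v) ∈ hGraph V e ↔ u = A (A v)) ∧
      AsympComm (fun k : Conf d => phaseOp k) (𝓝 0) (A * A) ∧
      Tendsto (fun k : Conf d => transOp k * (A * A) - A * A) (𝓝 0) (𝓝 0) ∧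
      A * A = besselOp (Conf d) * Z ∧ ∃ c : ℝ, 0 ≤ c ∧ ∀ f, ‖Z f‖ ^ 2 ≤ c * ‖A f‖ ^ 2 := by
  set J := besselOp (Conf d) with hJdef
  have hJ : IsSelfAdjoint J := isSelfAdjoint_besselOp
  have hJi : ∀ x, J x = 0 → x = 0 := besselOp_injective
  have hVm := aestronglyMeasurable_of_sum h₁ h₂ hV
  have hnice : ∀ {g : Conf d → ℝ}, IsNice g → MemLp (fun x => (g x : ℂ)) ⊤ volume :=
    fun {g} hg => by
      obtain ⟨C, hC⟩ := hg.bounded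
      refine memLp_top_of_bound (Complex.measurable_ofReal.comp
        hg.measurable).aestronglyMeasurable C (Eventually.of_forall fun x => ?_)
      rw [Complex.norm_real]
      exact hC x
  -- Error `1/2` keeps the unbounded part of `V` below half of the identity; the other half is the
  -- constant given to `exists_coercive`, and the bound `C` of `g` goes into `l`.
  obtain ⟨g, hg, hgb⟩ := exists_isNice_of_sum h₁ h₂ hV (half_pos zero_lt_one)
  obtain ⟨C, hC⟩ := hg.bounded
  have hC0 : 0 ≤ C := (norm_nonneg _).trans (hC 0)
  have hVb : FormBound V J (1 / 2 + C) :=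
    hgb.of_le_add (by norm_num) hC0 (hVm.sub hg.measurable.aestronglyMeasurable)
      (formBound_of_norm_le (Eventually.of_forall hC) norm_besselOp_apply_le)
      (Eventually.of_forall fun x => by
        have := norm_add_le (V x - g x) (g x)
        rwa [sub_add_cancel] at this)
  obtain ⟨W, hW, -⟩ := exists_isFormOp hVm (by positivity) hVb
  have hWsub : ∀ {g : Conf d → ℝ} {ε : ℝ}, 0 < ε → IsNice g →
      FormBound (fun x => V x - g x) J ε → ‖W - J * mulOp (fun x => (g x : ℂ)) * J‖ ≤ ε :=
    fun hε hg hb => hW.norm_sub_le (isFormOp_of_bounded (hnice hg) hJ)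
      (hVm.sub hg.measurable.aestronglyMeasurable) hε.le hb
  -- `W` is a norm limit of operators `J g J` with bounded `g`, and multiplication by `g` commutes
  -- exactly with plane waves.
  have hWcomm : AsympComm (fun k : Conf d => phaseOp k) (𝓝 0) W := by
    refine (isClosed_asympComm norm_phaseOp_le).closure_subset
      (Metric.mem_closure_iff.2 fun ε hε => ?_)
    obtain ⟨g, hg, hgb⟩ := exists_isNice_of_sum h₁ h₂ hV (half_pos hε)
    refine ⟨J * mulOp (fun x => (g x : ℂ)) * J, ?_, ?_⟩
    · refine (asympComm_besselOp.mul (asympComm_of_commute fun k => ?_)).mul asympComm_besselOp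
      have hgk := memLp_top_mul (hnice hg) (memLp_phase k)
      have hkg := memLp_top_mul (memLp_phase k) (hnice hg)
      have h1 := mulOp_comp (memLp_phase k) (hnice hg) hkg
      have h2 := mulOp_comp (hnice hg) (memLp_phase k) hgk
      simp only [mul_comm (phase k _)] at h1
      exact h1.trans h2.symm
    · rw [dist_eq_norm]
      exact (hWsub (half_pos hε) hg hgb).trans_lt (half_lt_self hε)
  set B := 1 + W + ((e - 1 : ℝ) : ℂ) • (J * J) with hB
  have hBf : ∀ f, B f = f + W f + ((e - 1 : ℝ) : ℂ) • J (J f) := fun f => rfl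
  have hBsa : IsSelfAdjoint B := by
    have h1 : IsSelfAdjoint (J * J) := by
      rw [isSelfAdjoint_iff, star_mul, hJ.star_eq]
    have h2 : IsSelfAdjoint ((e - 1 : ℝ) : ℂ) := Complex.conj_ofReal _
    exact ((IsSelfAdjoint.one _).add hW.isSelfAdjoint).add (h2.smul h1)
  have hJJ : ∀ f, ⟪f, J (J f)⟫_ℂ = ((‖J f‖ ^ 2 : ℝ) : ℂ) := fun f => by
    rw [← IsSelfAdjoint.inner_left hJ, inner_self_eq_norm_sq_to_K]
    simp
  have hgraph := mem_hGraph_iff (e := e) hW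
  have hWlow : ∀ f, -(1 / 2 * ‖f‖ ^ 2) - C * ‖J f‖ ^ 2 ≤ (⟪f, W f⟫_ℂ).re := fun f => by
    set M := mulOp (fun x => (g x : ℂ)) with hM
    have h1 : ‖(⟪f, (W - J * M * J) f⟫_ℂ)‖ ≤ 1 / 2 * ‖f‖ ^ 2 := by
      refine (norm_inner_le_norm _ _).trans ?_
      have := ContinuousLinearMap.le_of_opNorm_le _ (hWsub (by norm_num) hg hgb) f
      nlinarith [norm_nonneg f]
    have h2 : ‖(⟪f, (J * M * J) f⟫_ℂ)‖ ≤ C * ‖J f‖ ^ 2 := by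
      rw [mul_apply_eq_comp, mul_apply_eq_comp, ← IsSelfAdjoint.inner_left hJ]
      refine (norm_inner_le_norm _ _).trans ?_
      have := norm_mulOp_apply_le (hnice hg) hC0 (Eventually.of_forall fun x => by
        rw [Complex.norm_real]; exact hC x) (J f)
      nlinarith [norm_nonneg (J f)]
    have h3 : ⟪f, W f⟫_ℂ = ⟪f, (W - J * M * J) f⟫_ℂ + ⟪f, (J * M * J) f⟫_ℂ := by
      rw [← inner_add_right, ← _root_.add_apply, sub_add_cancel]
    rw [h3, Complex.add_re]
    have h4 := (abs_le.1 ((Complex.abs_re_le_norm _).trans h1)).1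
    have h5 := (abs_le.1 ((Complex.abs_re_le_norm _).trans h2)).1
    linarith
  have hBre : ∀ f, (⟪f, B f⟫_ℂ).re = ‖f‖ ^ 2 + (⟪f, W f⟫_ℂ).re + (e - 1) * ‖J f‖ ^ 2 :=
    fun f => by
      rw [hBf, inner_add_right, inner_add_right, inner_smul_right, hJJ, ← Complex.ofReal_mul,
        Complex.add_re, Complex.add_re, Complex.ofReal_re, inner_self_eq_norm_sq_to_K]
      norm_cast
  obtain ⟨c, hc, hcB⟩ := exists_coercive (B := B) hJ hJi (c := 1 / 2) (l := C + |e - 1|)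
    (by norm_num) (by positivity) (fun f => by
      rw [hBre]
      have h1 := hWlow f
      have h2 : -(e - 1) * ‖J f‖ ^ 2 ≤ |e - 1| * ‖J f‖ ^ 2 := by
        gcongr
        exact neg_le_abs _
      nlinarith) (fun f v hfv => by
      have := he _ _ ((hgraph _ _).2 ⟨f, rfl, hfv⟩)
      rwa [IsSelfAdjoint.inner_left hJ, ← hfv] at this)
  obtain ⟨A, B', hBB', hB'B, hAsa, hAi, hAA, hAc⟩ := exists_sqrt_of_coercive hJ hJi hBsa hc hcB
  have hAAx : ∀ x, A (A x) = J (B' (J x)) := fun x => DFunLike.congr_fun hAA x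
  refine ⟨A, B' * J, hAsa, hAi, fun u v => ?_, ?_, ?_, hAA, c⁻¹, by positivity, hAc⟩
  · rw [hAAx, hgraph]
    constructor
    · rintro ⟨f, rfl, hf⟩
      rw [← hf, ← hB]
      exact congrArg J (DFunLike.congr_fun hB'B f).symm
    · rintro rfl
      refine ⟨B' (J v), rfl, ?_⟩
      exact DFunLike.congr_fun hBB' (J v)
  · rw [hAA]
    have hJc : AsympComm (fun k : Conf d => phaseOp k) (𝓝 0) J := asympComm_besselOp
    refine hJc.mul ((AsympComm.inverse (X := B) ?_ hBB' hB'B).mul hJc)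
    refine ((asympComm_of_commute fun k => ?_).add hWcomm).add ?_
    · rw [one_mul, mul_one]
    · have h1 : (((e - 1 : ℝ) : ℂ) • (J * J)) =
          (((e - 1 : ℝ) : ℂ) • (1 : L2 (Conf d) →L[ℂ] L2 (Conf d))) * (J * J) := by
        rw [smul_mul_assoc, one_mul]
      rw [h1]
      refine (asympComm_of_commute fun k => ?_).mul (hJc.mul hJc)
      rw [smul_mul_assoc, one_mul, mul_smul_comm, mul_one]
  · rw [hAA]
    have := tendsto_zero_mul_of_bounded (b := fun _ => B' * J) tendsto_transOp_mul_besselOp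
      (fun _ => le_rfl)
    refine this.congr fun k => ?_
    rw [sub_mul, mul_assoc]

end OneParticle

end

end ManyBody

namespace ManyBody

open scoped FourierTransform ENNReal

noncomputable section

/-! ### Injectivity of tensor products -/

section TensorInjective

variable {E F P : Type*}
  [NormedAddCommGroup E] [InnerProductSpace ℝ E] [FiniteDimensional ℝ E]
  [MeasurableSpace E] [BorelSpace E]
  [NormedAddCommGroup F] [InnerProductSpace ℝ F] [FiniteDimensional ℝ F]
  [MeasurableSpace F] [BorelSpace F]
  [NormedAddCommGroup P] [InnerProductSpace ℝ P] [FiniteDimensional ℝ P]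
  [MeasurableSpace P] [BorelSpace P]
  (s : P ≃ₗᵢ[ℝ] WithLp 2 (E × F))

theorem continuous_elemTensor_left (g : L2 F) : Continuous fun f => elemTensor s f g :=
  AddMonoidHomClass.continuous_of_bound
    (AddMonoidHom.mk' (fun f => elemTensor s f g) fun f f' => elemTensor_add_left s f f' g) ‖g‖
    fun f => ((norm_elemTensor s f g).trans (mul_comm _ _)).le

theorem continuous_elemTensor_right (f : L2 E) : Continuous fun g => elemTensor s f g :=
  AddMonoidHomClass.continuous_of_bound
    (AddMonoidHom.mk' (fun g => elemTensor s f g) fun g g' => elemTensor_add_right s f g g') ‖f‖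
    fun g => (norm_elemTensor s f g).le

theorem isSelfAdjoint_tensorOp {K : L2 E →L[ℂ] L2 E} {B : L2 F →L[ℂ] L2 F}
    (hK : IsSelfAdjoint K) (hB : IsSelfAdjoint B) : IsSelfAdjoint (tensorOp s K B) := by
  rw [isSelfAdjoint_iff, ContinuousLinearMap.star_eq_adjoint, adjoint_tensorOp,
    ← ContinuousLinearMap.star_eq_adjoint, ← ContinuousLinearMap.star_eq_adjoint, hK.star_eq,
    hB.star_eq]

/-- A vector in the kernel is orthogonal to all `K f ⊗ B g`, and the ranges of `K` and `B` are
dense. -/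
theorem tensorOp_injective {K : L2 E →L[ℂ] L2 E} {B : L2 F →L[ℂ] L2 F}
    (hK : IsSelfAdjoint K) (hB : IsSelfAdjoint B) (hKi : ∀ x, K x = 0 → x = 0)
    (hBi : ∀ x, B x = 0 → x = 0) (x : L2 P) (hx : tensorOp s K B x = 0) : x = 0 := by
  have h : innerSL ℂ x = 0 := by
    refine ext_elemTensor (s := s) fun f g => ?_
    rw [innerSL_apply_apply, _root_.zero_apply]
    refine (denseRange_of_selfAdjoint_injective hK hKi).induction_on
      (p := fun f => ⟪x, elemTensor s f g⟫_ℂ = 0) f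
      (isClosed_eq (continuous_const.inner (continuous_elemTensor_left s g)) continuous_const)
      fun f => ?_
    refine (denseRange_of_selfAdjoint_injective hB hBi).induction_on
      (p := fun g => ⟪x, elemTensor s (K f) g⟫_ℂ = 0) g
      (isClosed_eq (continuous_const.inner (continuous_elemTensor_right s _)) continuous_const)
      fun g => ?_
    rw [← tensorOp_elemTensor, ← IsSelfAdjoint.inner_left (isSelfAdjoint_tensorOp s hK hB), hx,
      inner_zero_left]
  have h2 : ⟪x, x⟫_ℂ = 0 := by
    rw [← innerSL_apply_apply, h, _root_.zero_apply]
  exact inner_self_eq_zero.1 h2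

end TensorInjective

/-! ### Extending form bounds and factoring operators -/

section FormBounds

variable {P : Type*} [NormedAddCommGroup P] [InnerProductSpace ℝ P] [FiniteDimensional ℝ P]
  [MeasurableSpace P] [BorelSpace P] {m : P → ℝ} {R : L2 P →L[ℂ] L2 P}

/-- A form bound extends from a dense set, by Fatou's lemma. -/
theorem formBound_of_denseRange (hm : AEStronglyMeasurable m volume) {C : ℝ} {X : Type*}
    {e : X → L2 P} (he : DenseRange e)
    (h : ∀ z, ∫⁻ x, ‖m x‖ₑ * ‖R (e z) x‖ₑ ^ 2 ≤ ENNReal.ofReal C * ‖e z‖ₑ ^ 2) :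
    FormBound m R C := fun φ => by
  obtain ⟨y, hy, hyφ⟩ := mem_closure_iff_seq_limit.1 (he φ)
  have hR : Tendsto (fun n => R (y n)) atTop (𝓝 (R φ)) := (R.continuous.tendsto φ).comp hyφ
  obtain ⟨k, hk, hkae⟩ := (tendstoInMeasure_of_tendsto_Lp hR).exists_seq_tendsto_ae
  have hle : ∀ n, ∫⁻ x, ‖m x‖ₑ * ‖R (y n) x‖ₑ ^ 2 ≤ ENNReal.ofReal C * ‖y n‖ₑ ^ 2 := fun n => by
    obtain ⟨z, hz⟩ := hy n
    rw [← hz]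
    exact h z
  have hlim : Tendsto (fun n => ENNReal.ofReal C * ‖y (k n)‖ₑ ^ 2) atTop
      (𝓝 (ENNReal.ofReal C * ‖φ‖ₑ ^ 2)) := by
    have h1 : Tendsto (fun n => ‖y (k n)‖ₑ) atTop (𝓝 ‖φ‖ₑ) :=
      (continuous_enorm.tendsto φ).comp (hyφ.comp hk.tendsto_atTop)
    exact ENNReal.Tendsto.const_mul (ENNReal.Tendsto.pow h1) (Or.inr ENNReal.ofReal_ne_top)
  calc ∫⁻ x, ‖m x‖ₑ * ‖R φ x‖ₑ ^ 2
      = ∫⁻ x, liminf (fun n => ‖m x‖ₑ * ‖R (y (k n)) x‖ₑ ^ 2) atTop := by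
        refine lintegral_congr_ae ?_
        filter_upwards [hkae] with x hx
        have h1 : Tendsto (fun n => ‖R (y (k n)) x‖ₑ) atTop (𝓝 ‖R φ x‖ₑ) :=
          (continuous_enorm.tendsto _).comp hx
        exact (ENNReal.Tendsto.const_mul (ENNReal.Tendsto.pow h1)
          (Or.inr enorm_ne_top)).liminf_eq.symm
    _ ≤ liminf (fun n => ∫⁻ x, ‖m x‖ₑ * ‖R (y (k n)) x‖ₑ ^ 2) atTop :=
        lintegral_liminf_le' fun n => hm.enorm.mul ((Lp.memLp (R (y (k n)))).1.enorm.pow_const 2)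
    _ ≤ liminf (fun n => ENNReal.ofReal C * ‖y (k n)‖ₑ ^ 2) atTop :=
        liminf_le_liminf (Eventually.of_forall fun n => hle (k n))
    _ = ENNReal.ofReal C * ‖φ‖ₑ ^ 2 := hlim.liminf_eq

theorem FormBound.comp_le {C D : ℝ} (h : FormBound m R C) (hC : 0 ≤ C) (hD : 0 ≤ D) {f g : L2 P}
    (hfg : ‖f‖ ^ 2 ≤ D * ‖g‖ ^ 2) :
    ∫⁻ x, ‖m x‖ₑ * ‖R f x‖ₑ ^ 2 ≤ ENNReal.ofReal (C * D) * ‖g‖ₑ ^ 2 := by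
  refine (h f).trans ?_
  rw [ENNReal.ofReal_mul hC, mul_assoc]
  gcongr
  rw [← ofReal_norm, ← ofReal_norm, ← ENNReal.ofReal_pow (norm_nonneg _),
    ← ENNReal.ofReal_pow (norm_nonneg _), ← ENNReal.ofReal_mul hD]
  exact ENNReal.ofReal_le_ofReal hfg

/-- An operator dominated by a selfadjoint injective operator factors through it. -/
theorem exists_factor {H : Type*} [NormedAddCommGroup H] [InnerProductSpace ℂ H] [CompleteSpace H]
    {A Z : H →L[ℂ] H} (hA : IsSelfAdjoint A) (hAi : ∀ x, A x = 0 → x = 0) {c : ℝ} (hc : 0 ≤ c)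
    (h : ∀ f, ‖Z f‖ ≤ c * ‖A f‖) : ∃ Y : H →L[ℂ] H, Z = Y * A ∧ ‖Y‖ ≤ c := by
  have hd := denseRange_of_selfAdjoint_injective hA hAi
  refine ⟨LinearMap.extendOfNorm (Z : H →ₗ[ℂ] H) (A : H →ₗ[ℂ] H), ?_,
    LinearMap.opNorm_extendOfNorm_le hd hc h⟩
  ext1 f
  exact (LinearMap.extendOfNorm_eq (f := (Z : H →ₗ[ℂ] H)) (e := (A : H →ₗ[ℂ] H)) hd ⟨c, h⟩ f).symm

end FormBounds

/-! ### From one-particle potentials to pair potentials -/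

section Pair

variable {d : ℕ} {w : Conf d → ℝ}

theorem aestronglyMeasurable_pair (hw : AEStronglyMeasurable w volume) :
    AEStronglyMeasurable (fun z : Conf d × Conf d => w (z.1 - z.2))
      ((volume : Measure (Conf d)).prod volume) :=
  hw.comp_quasiMeasurePreserving (quasiMeasurePreserving_sub_of_right_invariant volume volume)

theorem aestronglyMeasurable_twoConf (hw : AEStronglyMeasurable w volume) :
    AEStronglyMeasurable (fun x : TwoConf d => w (x.fst - x.snd)) volume :=
  (aestronglyMeasurable_pair hw).comp_measurePreserving (measurePreserving_split (particleSplit d))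

theorem lintegral_twoConf (H : Conf d × Conf d → ℝ≥0∞) :
    ∫⁻ x : TwoConf d, H (x.fst, x.snd) = ∫⁻ z, H z ∂((volume : Measure (Conf d)).prod volume) := by
  have hs : MeasurableEmbedding (fun x : TwoConf d => WithLp.ofLp (particleSplit d x)) :=
    ((particleSplit d).toHomeomorph.toMeasurableEquiv.trans
      (MeasurableEquiv.toLp 2 (Conf d × Conf d)).symm).measurableEmbedding
  exact (measurePreserving_split (particleSplit d)).lintegral_comp_emb hs H

theorem coeFn_tensorEmb_sum (S : Finset (L2 (Conf d) × L2 (Conf d))) :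
    tensorEmb (particleSplit d) (∑ i ∈ S, i.1 ⊗ₜ[ℂ] i.2) =ᵐ[volume]
      fun x : TwoConf d => ∑ i ∈ S, i.1 x.fst * i.2 x.snd := by
  rw [map_sum]
  have h : ∀ᵐ x : TwoConf d, ∀ i ∈ S, elemTensor (particleSplit d) i.1 i.2 x =
      i.1 x.fst * i.2 x.snd := by
    rw [Finset.eventually_all]
    exact fun i _ => coeFn_elemTensor (particleSplit d) i.1 i.2
  filter_upwards [Lp.coeFn_finsetSum S fun i => tensorEmb (particleSplit d) (i.1 ⊗ₜ[ℂ] i.2), h]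
    with x h1 h2
  rw [h1, Finset.sum_apply]
  refine Finset.sum_congr rfl fun i hi => ?_
  rw [tensorEmb_tmul]
  exact h2 i hi

theorem coeFn_sum_smul (S : Finset (L2 (Conf d) × L2 (Conf d))) (c : L2 (Conf d) × L2 (Conf d) → ℂ)
    (K : L2 (Conf d) →L[ℂ] L2 (Conf d)) :
    K (∑ i ∈ S, c i • i.1) =ᵐ[volume] fun x => ∑ i ∈ S, K i.1 x * c i := by
  rw [map_sum]
  have h : ∀ᵐ x : Conf d, ∀ i ∈ S, (c i • K i.1) x = K i.1 x * c i := by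
    rw [Finset.eventually_all]
    intro i _
    filter_upwards [Lp.coeFn_smul (c i) (K i.1)] with x hx
    rw [hx, Pi.smul_apply, smul_eq_mul, mul_comm]
  filter_upwards [Lp.coeFn_finsetSum S fun i => K (c i • i.1), h] with x h1 h2
  rw [h1, Finset.sum_apply]
  refine Finset.sum_congr rfl fun i hi => ?_
  rw [map_smul]
  exact h2 i hi

/-- A form bound for a potential in one particle gives one for the pair potential. -/
theorem FormBound.pair {K : L2 (Conf d) →L[ℂ] L2 (Conf d)} (hw : AEStronglyMeasurable w volume)
    {C : ℝ} (h : ∀ y, FormBound (fun x => w (x - y)) K C) :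
    FormBound (fun x : TwoConf d => w (x.fst - x.snd))
      (tensorOp (particleSplit d) K (.id ℂ (L2 (Conf d)))) C := by
  refine formBound_of_denseRange (aestronglyMeasurable_twoConf hw)
    (denseRange_tensorEmb (particleSplit d)) fun z => ?_
  obtain ⟨S, rfl⟩ := TensorProduct.exists_finset z
  have hK : tensorOp (particleSplit d) K (.id ℂ (L2 (Conf d)))
      (tensorEmb (particleSplit d) (∑ i ∈ S, i.1 ⊗ₜ[ℂ] i.2)) =ᵐ[volume]
      fun x : TwoConf d => ∑ i ∈ S, K i.1 x.fst * i.2 x.snd := by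
    simp only [map_sum, tensorEmb_tmul, tensorOp_elemTensor, ContinuousLinearMap.id_apply]
    have h : ∀ᵐ x : TwoConf d, ∀ i ∈ S, elemTensor (particleSplit d) (K i.1) i.2 x =
        K i.1 x.fst * i.2 x.snd := by
      rw [Finset.eventually_all]
      exact fun i _ => coeFn_elemTensor (particleSplit d) (K i.1) i.2
    filter_upwards [Lp.coeFn_finsetSum S fun i => elemTensor (particleSplit d) (K i.1) i.2, h]
      with x h1 h2
    rw [h1, Finset.sum_apply]
    exact Finset.sum_congr rfl fun i hi => h2 i hi
  have hmeas : ∀ B : L2 (Conf d) →L[ℂ] L2 (Conf d), AEMeasurable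
      (fun z : Conf d × Conf d => ‖∑ i ∈ S, B i.1 z.1 * i.2 z.2‖ₑ ^ 2)
      ((volume : Measure (Conf d)).prod volume) := fun B => by
    have : AEStronglyMeasurable (fun z : Conf d × Conf d => ∑ i ∈ S, B i.1 z.1 * i.2 z.2)
        ((volume : Measure (Conf d)).prod volume) :=
      Finset.aestronglyMeasurable_fun_sum S fun i _ =>
        (memLp_mul_prod (B i.1) i.2).1
    exact this.enorm.pow_const 2
  calc ∫⁻ x : TwoConf d, ‖w (x.fst - x.snd)‖ₑ * ‖tensorOp (particleSplit d) K (.id ℂ (L2 (Conf d)))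
        (tensorEmb (particleSplit d) (∑ i ∈ S, i.1 ⊗ₜ[ℂ] i.2)) x‖ₑ ^ 2
      = ∫⁻ x : TwoConf d, ‖w (x.fst - x.snd)‖ₑ * ‖∑ i ∈ S, K i.1 x.fst * i.2 x.snd‖ₑ ^ 2 := by
        refine lintegral_congr_ae ?_
        filter_upwards [hK] with x hx
        rw [hx]
    _ = ∫⁻ z, ‖w (z.1 - z.2)‖ₑ * ‖∑ i ∈ S, K i.1 z.1 * i.2 z.2‖ₑ ^ 2
          ∂((volume : Measure (Conf d)).prod volume) :=
        lintegral_twoConf fun z => ‖w (z.1 - z.2)‖ₑ * ‖∑ i ∈ S, K i.1 z.1 * i.2 z.2‖ₑ ^ 2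
    _ = ∫⁻ y, ∫⁻ x, ‖w (x - y)‖ₑ * ‖∑ i ∈ S, K i.1 x * i.2 y‖ₑ ^ 2 :=
        lintegral_prod_symm _ ((aestronglyMeasurable_pair hw).enorm.mul (hmeas K))
    _ ≤ ∫⁻ y, ENNReal.ofReal C * ∫⁻ x, ‖∑ i ∈ S, i.1 x * i.2 y‖ₑ ^ 2 := by
        refine lintegral_mono fun y => ?_
        -- Freeze the second particle at `y`: the slice of the tensor is a one-particle function, to
        -- which the bound for the shifted potential applies.
        have h1 := h y (∑ i ∈ S, i.2 y • i.1)
        rw [enorm_sq_eq_lintegral] at h1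
        refine le_trans (le_of_eq (lintegral_congr_ae ?_)) (h1.trans (le_of_eq ?_))
        · filter_upwards [coeFn_sum_smul S (fun i => i.2 y) K] with x hx
          rw [hx]
        · congr 1
          refine lintegral_congr_ae ?_
          filter_upwards [coeFn_sum_smul S (fun i => i.2 y) (.id ℂ (L2 (Conf d)))] with x hx
          rw [ContinuousLinearMap.id_apply] at hx
          rw [hx]
          simp only [ContinuousLinearMap.id_apply]
    _ = ENNReal.ofReal C * ∫⁻ z, ‖∑ i ∈ S, i.1 z.1 * i.2 z.2‖ₑ ^ 2
          ∂((volume : Measure (Conf d)).prod volume) := by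
        rw [lintegral_const_mul' _ _ ENNReal.ofReal_ne_top]
        congr 1
        exact (lintegral_prod_symm _ (hmeas (.id ℂ (L2 (Conf d))))).symm
    _ = ENNReal.ofReal C * ‖tensorEmb (particleSplit d) (∑ i ∈ S, i.1 ⊗ₜ[ℂ] i.2)‖ₑ ^ 2 := by
        rw [enorm_sq_eq_lintegral, ← lintegral_twoConf]
        congr 1
        refine lintegral_congr_ae ?_
        filter_upwards [coeFn_tensorEmb_sum S] with x hx
        rw [hx]

end Pair

end

end ManyBody

namespace ManyBody

open scoped FourierTransform ENNReal

noncomputable section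

/-! ### Operator inequalities and limits for the pair -/

section PairAbstract

variable {H : Type*} [NormedAddCommGroup H] [InnerProductSpace ℂ H] [CompleteSpace H]

/-- The inequality `h₁ ≤ h₁ + h₂` without unbounded operators. With `x = N z` one has `S x = G₁ G₂
z`, and `‖R x‖² = ⟨S x, x⟩` is the sum of `‖A₁ A₂² z‖²` and its mirror image. Formally `A₁ A₂² z =
h₁^{1/2} R (R x)`. -/
theorem norm_sq_le_norm_sqrt_sq {A₁ A₂ S R : H →L[ℂ] H} (h₁ : IsSelfAdjoint A₁)
    (h₂ : IsSelfAdjoint A₂) (hc : A₁ * A₂ = A₂ * A₁)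
    (hSN : S * (A₁ * A₁ + A₂ * A₂) = A₁ * A₁ * (A₂ * A₂)) (hR : IsSelfAdjoint R)
    (hRR : R * R = S) (z : H) :
    ‖A₁ (A₂ (A₂ z))‖ ^ 2 ≤ ‖R ((A₁ * A₁ + A₂ * A₂) z)‖ ^ 2 := by
  have hcx : ∀ x, A₁ (A₂ x) = A₂ (A₁ x) := fun x => DFunLike.congr_fun hc x
  have hSNx : R (R ((A₁ * A₁ + A₂ * A₂) z)) = A₁ (A₁ (A₂ (A₂ z))) := by
    have := DFunLike.congr_fun hSN z
    rw [← hRR] at this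
    exact this
  have h : ⟪R ((A₁ * A₁ + A₂ * A₂) z), R ((A₁ * A₁ + A₂ * A₂) z)⟫_ℂ =
      ⟪A₂ (A₁ (A₁ z)), A₂ (A₁ (A₁ z))⟫_ℂ + ⟪A₁ (A₂ (A₂ z)), A₁ (A₂ (A₂ z))⟫_ℂ := by
    have t₁ : ⟪A₁ (A₁ z), A₁ (A₁ (A₂ (A₂ z)))⟫_ℂ = ⟪A₂ (A₁ (A₁ z)), A₂ (A₁ (A₁ z))⟫_ℂ := by
      rw [IsSelfAdjoint.inner_left h₂ (A₁ (A₁ z))]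
      simp only [hcx]
    rw [IsSelfAdjoint.inner_left hR, hSNx, _root_.add_apply, mul_apply_eq_comp,
      mul_apply_eq_comp, inner_add_left, t₁, ← IsSelfAdjoint.inner_left h₁ (A₂ (A₂ z))]
  simp only [inner_self_eq_norm_sq_to_K] at h
  have h' : ‖R ((A₁ * A₁ + A₂ * A₂) z)‖ ^ 2 =
      ‖A₂ (A₁ (A₁ z))‖ ^ 2 + ‖A₁ (A₂ (A₂ z))‖ ^ 2 := by exact_mod_cast h
  rw [h']
  exact le_add_of_nonneg_left (sq_nonneg _)

/-- The maps `X ↦ U i X - X` are uniformly Lipschitz. This carries both limits from bounded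
interactions to `w`. -/
theorem isClosed_tendsto_mul_sub {ι : Type*} {l : Filter ι} {U : ι → H →L[ℂ] H}
    (hU : ∀ i, ‖U i‖ ≤ 1) :
    IsClosed {X : H →L[ℂ] H | Tendsto (fun i => U i * X - X) l (𝓝 0)} := by
  refine isClosed_of_closure_subset fun X hX => ?_
  rw [Set.mem_ofPred_eq, Metric.tendsto_nhds]
  intro ε hε
  obtain ⟨Y, hY, hXY⟩ := Metric.mem_closure_iff.1 hX (ε / 4) (by positivity)
  filter_upwards [(Metric.tendsto_nhds.1 hY) (ε / 2) (by positivity)] with i hi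
  rw [dist_zero_right] at hi ⊢
  rw [dist_eq_norm] at hXY
  have h1 : U i * X - X = U i * (X - Y) - (X - Y) + (U i * Y - Y) := by noncomm_ring
  have h2 : ‖U i * (X - Y)‖ ≤ ‖X - Y‖ :=
    (norm_mul_le _ _).trans (mul_le_of_le_one_left (norm_nonneg _) (hU i))
  rw [h1]
  calc ‖U i * (X - Y) - (X - Y) + (U i * Y - Y)‖
      ≤ ‖U i * (X - Y)‖ + ‖X - Y‖ + ‖U i * Y - Y‖ :=
        (norm_add_le _ _).trans (add_le_add (norm_sub_le _ _) le_rfl)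
    _ < ε := by linarith

end PairAbstract

/-! ### Plane waves and translations on two particles -/

section TensorAsymptotics

variable {E F P : Type*}
  [NormedAddCommGroup E] [InnerProductSpace ℝ E] [FiniteDimensional ℝ E]
  [MeasurableSpace E] [BorelSpace E]
  [NormedAddCommGroup F] [InnerProductSpace ℝ F] [FiniteDimensional ℝ F]
  [MeasurableSpace F] [BorelSpace F]
  [NormedAddCommGroup P] [InnerProductSpace ℝ P] [FiniteDimensional ℝ P]
  [MeasurableSpace P] [BorelSpace P]
  (s : P ≃ₗᵢ[ℝ] WithLp 2 (E × F))

theorem tensorOp_mul (K K' : L2 E →L[ℂ] L2 E) (B B' : L2 F →L[ℂ] L2 F) :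
    tensorOp s K B * tensorOp s K' B' = tensorOp s (K * K') (B * B') :=
  tensorOp_comp s K K' B B'

theorem tendsto_fst : Tendsto (fun v : P => (s v).fst) (𝓝 0) (𝓝 0) := by
  have : Continuous fun v : P => (s v).fst :=
    (WithLp.prod_continuous_ofLp 2 E F).fst.comp s.continuous
  simpa using this.tendsto 0

theorem tendsto_snd : Tendsto (fun v : P => (s v).snd) (𝓝 0) (𝓝 0) := by
  have : Continuous fun v : P => (s v).snd :=
    (WithLp.prod_continuous_ofLp 2 E F).snd.comp s.continuous
  simpa using this.tendsto 0

theorem tendsto_tensorOp_left {ι : Type*} {l : Filter ι} {X : ι → L2 E →L[ℂ] L2 E}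
    {Y : ι → L2 F →L[ℂ] L2 F} (hX : Tendsto X l (𝓝 0)) (hY : ∀ i, ‖Y i‖ ≤ 1) :
    Tendsto (fun i => tensorOp s (X i) (Y i)) l (𝓝 0) :=
  squeeze_zero_norm (fun i => (norm_tensorOp_le s _ _).trans
    (mul_le_of_le_one_right (norm_nonneg _) (hY i))) (tendsto_zero_iff_norm_tendsto_zero.1 hX)

theorem tendsto_tensorOp_right {ι : Type*} {l : Filter ι} {X : ι → L2 E →L[ℂ] L2 E}
    {Y : ι → L2 F →L[ℂ] L2 F} (hX : ∀ i, ‖X i‖ ≤ 1) (hY : Tendsto Y l (𝓝 0)) :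
    Tendsto (fun i => tensorOp s (X i) (Y i)) l (𝓝 0) :=
  squeeze_zero_norm (fun i => (norm_tensorOp_le s _ _).trans
    (mul_le_of_le_one_left (norm_nonneg _) (hX i))) (tendsto_zero_iff_norm_tendsto_zero.1 hY)

theorem asympComm_tensorOp_left {X : L2 E →L[ℂ] L2 E}
    (hX : AsympComm (fun k : E => phaseOp k) (𝓝 0) X) :
    AsympComm (fun v : P => phaseOp v) (𝓝 0) (tensorOp s X 1) := by
  refine (tendsto_tensorOp_left s (hX.comp (tendsto_fst s))
    (fun v : P => norm_phaseOp_le (s v).snd)).congr fun v => ?_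
  change tensorOp s (phaseOp (s v).fst * X - X * phaseOp (s v).fst) _ =
    phaseOp v * _ - _ * phaseOp v
  rw [phaseOp_eq_tensorOp s v, tensorOp_mul, tensorOp_mul, mul_one, one_mul, ← tensorOp_sub_left]

theorem asympComm_tensorOp_right {Y : L2 F →L[ℂ] L2 F}
    (hY : AsympComm (fun k : F => phaseOp k) (𝓝 0) Y) :
    AsympComm (fun v : P => phaseOp v) (𝓝 0) (tensorOp s 1 Y) := by
  refine (tendsto_tensorOp_right s (fun v : P => norm_phaseOp_le (s v).fst)
    (hY.comp (tendsto_snd s))).congr fun v => ?_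
  change tensorOp s _ (phaseOp (s v).snd * Y - Y * phaseOp (s v).snd) =
    phaseOp v * _ - _ * phaseOp v
  rw [phaseOp_eq_tensorOp s v, tensorOp_mul, tensorOp_mul, mul_one, one_mul, ← tensorOp_sub_right]

/-- Translate one particle at a time. The first translation is absorbed through the factorization
with `X ⊗ 1`, the second through the one with `1 ⊗ Y`. -/
theorem tendsto_transOp_mul_sub {X : L2 E →L[ℂ] L2 E} {Y : L2 F →L[ℂ] L2 F}
    (hX : Tendsto (fun k : E => transOp k * X - X) (𝓝 0) (𝓝 0))
    (hY : Tendsto (fun k : F => transOp k * Y - Y) (𝓝 0) (𝓝 0)) {S C C' : L2 P →L[ℂ] L2 P}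
    (hS : S = tensorOp s X 1 * C) (hS' : S = tensorOp s 1 Y * C') :
    Tendsto (fun v : P => transOp v * S - S) (𝓝 0) (𝓝 0) := by
  have h1 := tendsto_zero_mul_of_bounded (b := fun _ => C) (tendsto_tensorOp_left s
    (hX.comp (tendsto_fst s)) (fun v : P => norm_transOp_le (s v).snd)) (fun _ => le_rfl)
  have h2 := tendsto_zero_mul_of_bounded (b := fun _ => C') (tendsto_tensorOp_right s
    (X := fun _ => 1) (fun v : P => ContinuousLinearMap.norm_id_le) (hY.comp (tendsto_snd s)))
    (fun _ => le_rfl)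
  have h3 := h1.add h2
  rw [add_zero] at h3
  refine h3.congr fun v => ?_
  have e1 : tensorOp s (transOp (s v).fst * X - X) (transOp (s v).snd) * C =
      transOp v * S - tensorOp s 1 (transOp (s v).snd) * S := by
    rw [tensorOp_sub_left, sub_mul, transOp_eq_tensorOp s v, hS, ← mul_assoc, ← mul_assoc,
      tensorOp_mul, tensorOp_mul, mul_one, one_mul]
  have e2 : tensorOp s 1 (transOp (s v).snd * Y - Y) * C' =
      tensorOp s 1 (transOp (s v).snd) * S - S := by
    rw [tensorOp_sub_right, sub_mul, hS', ← mul_assoc, tensorOp_mul, one_mul]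
  simp only [Function.comp_apply]
  rw [e1, e2]
  abel

end TensorAsymptotics

/-! ### The two-particle resolvent and its square root -/

section PairResolvent

variable {d : ℕ} {V w : Conf d → ℝ} {e : ℝ} {A Z : L2 (Conf d) →L[ℂ] L2 (Conf d)}

local notation "A₁" => tensorOp (particleSplit d) A 1
local notation "A₂" => tensorOp (particleSplit d) 1 A

theorem exists_pair_resolvent (hA : IsSelfAdjoint A) (hAi : ∀ x, A x = 0 → x = 0)
    (hc : AsympComm (fun k : Conf d => phaseOp k) (𝓝 0) (A * A))
    (ht : Tendsto (fun k : Conf d => transOp k * (A * A) - A * A) (𝓝 0) (𝓝 0)) :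
    ∃ S : L2 (TwoConf d) →L[ℂ] L2 (TwoConf d), 0 ≤ S ∧ (∀ x, S x = 0 → x = 0) ∧
      S * (A₁ * A₁ + A₂ * A₂) = A₁ * A₁ * (A₂ * A₂) ∧
      AsympComm (fun v : TwoConf d => phaseOp v) (𝓝 0) S ∧
      Tendsto (fun v : TwoConf d => transOp v * S - S) (𝓝 0) (𝓝 0) := by
  have h₁ : IsSelfAdjoint A₁ := isSelfAdjoint_tensorOp _ hA (.one _)
  have h₂ : IsSelfAdjoint A₂ := isSelfAdjoint_tensorOp _ (.one _) hA
  have hcc : A₁ * A₂ = A₂ * A₁ := by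
    simp only [tensorOp_mul, mul_one, one_mul]
  have e₁ : A₁ * A₁ = tensorOp (particleSplit d) (A * A) 1 := by rw [tensorOp_mul, mul_one]
  have e₂ : A₂ * A₂ = tensorOp (particleSplit d) 1 (A * A) := by rw [tensorOp_mul, mul_one]
  obtain ⟨S, C, C', hS0, hSN, hC, hS, hS', hS'', hSi⟩ := exists_inverse_sum h₁ h₂ hcc
    (tensorOp_injective _ hA (.one _) hAi fun x hx => hx)
    (tensorOp_injective _ (.one _) hA (fun x hx => hx) hAi)
  refine ⟨S, hS0, hSi, hSN, ?_, ?_⟩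
  · refine asympComm_inverse_sum norm_phaseOp_le h₁ h₂ hcc hSN hC hS ?_ ?_
    · rw [e₁]
      exact asympComm_tensorOp_left _ hc
    · rw [e₂]
      exact asympComm_tensorOp_right _ hc
  · rw [e₁] at hS'
    rw [e₂] at hS''
    exact tendsto_transOp_mul_sub _ ht ht hS' hS''

/-- On `f = G f₀`, `g = G g₀` the generating pairs are `(S N z, N z)` with `z = f₀ ⊗ g₀`, since `S N
= G₁ G₂`. The graph of the bounded `S` is closed, and `N` maps the span of elementary tensors onto a
dense set, so nothing else lies in the closure and nothing is missing. -/
theorem mem_hSumGraph_iff (hA : IsSelfAdjoint A) (hAi : ∀ x, A x = 0 → x = 0)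
    (hgraph : ∀ u v, (u, v) ∈ hGraph V e ↔ u = A (A v))
    {S : L2 (TwoConf d) →L[ℂ] L2 (TwoConf d)}
    (hSN : S * (A₁ * A₁ + A₂ * A₂) = A₁ * A₁ * (A₂ * A₂)) (u v : L2 (TwoConf d)) :
    (u, v) ∈ hSumGraph V e ↔ u = S v := by
  have h₁ : IsSelfAdjoint A₁ := isSelfAdjoint_tensorOp _ hA (.one _)
  have h₂ : IsSelfAdjoint A₂ := isSelfAdjoint_tensorOp _ (.one _) hA
  set N := A₁ * A₁ + A₂ * A₂ with hN
  have hNsa : IsSelfAdjoint N := by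
    rw [isSelfAdjoint_iff, hN, star_add, star_mul, star_mul, h₁.star_eq, h₂.star_eq]
  have hNi : ∀ x, N x = 0 → x = 0 := sum_squares_injective h₁ h₂
    (tensorOp_injective _ hA (.one _) hAi fun x hx => hx)
  have hNe : ∀ f g, N (elemTensor (particleSplit d) f g) =
      elemTensor (particleSplit d) f (A (A g)) + elemTensor (particleSplit d) (A (A f)) g := by
    intro f g
    simp only [hN, _root_.add_apply, mul_apply_eq_comp, tensorOp_elemTensor, one_apply_eq_self]
    rw [add_comm]
  have hSNe : ∀ f g, S (N (elemTensor (particleSplit d) f g)) =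
      elemTensor (particleSplit d) (A (A f)) (A (A g)) := fun f g => by
    have := DFunLike.congr_fun hSN (elemTensor (particleSplit d) f g)
    simpa only [mul_apply_eq_comp, tensorOp_elemTensor, one_apply_eq_self] using this
  constructor
  · intro h
    let Γ : Submodule ℂ (L2 (TwoConf d) × L2 (TwoConf d)) :=
      LinearMap.ker (LinearMap.fst ℂ (L2 (TwoConf d)) (L2 (TwoConf d)) -
        (S : L2 (TwoConf d) →ₗ[ℂ] L2 (TwoConf d)) ∘ₗ LinearMap.snd ℂ _ _)
    have hΓ : ∀ q, q ∈ Γ ↔ q.1 = S q.2 := fun q => by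
      simp only [Γ, LinearMap.mem_ker, LinearMap.sub_apply, LinearMap.fst_apply,
        LinearMap.comp_apply, LinearMap.snd_apply, ContinuousLinearMap.coe_coe, sub_eq_zero]
    have hcl : IsClosed (Γ : Set (L2 (TwoConf d) × L2 (TwoConf d))) := by
      have : (Γ : Set (L2 (TwoConf d) × L2 (TwoConf d))) = {q | q.1 = S q.2} := Set.ext hΓ
      rw [this]
      exact isClosed_eq continuous_fst (S.continuous.comp continuous_snd)
    have hle : hSumGraph V e ≤ Γ := by
      refine Submodule.topologicalClosure_minimal _ (Submodule.span_le.2 ?_) hcl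
      rintro q ⟨f, hf, g, hg, hff, hgg, rfl⟩
      rw [hgraph] at hff hgg
      rw [SetLike.mem_coe, hΓ]
      subst hff hgg
      rw [← hNe, hSNe]
    exact (hΓ _).1 (hle h)
  · rintro rfl
    have hcl : IsClosed {v : L2 (TwoConf d) | (S v, v) ∈ hSumGraph V e} :=
      (Submodule.isClosed_topologicalClosure _).preimage (S.continuous.prodMk continuous_id)
    refine (denseRange_of_selfAdjoint_injective hNsa hNi).induction_on
      (p := fun v => (S v, v) ∈ hSumGraph V e) v hcl fun x => ?_
    refine (denseRange_tensorEmb (particleSplit d)).induction_on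
      (p := fun x => (S (N x), N x) ∈ hSumGraph V e) x (hcl.preimage N.continuous) fun z => ?_
    induction z with
    | zero =>
      simp only [map_zero]
      exact (hSumGraph V e).zero_mem
    | add a b ha hb =>
      simp only [map_add]
      exact (hSumGraph V e).add_mem ha hb
    | tmul f g =>
      rw [tensorEmb_tmul, hSNe, hNe]
      refine Submodule.le_topologicalClosure _ (Submodule.subset_span ?_)
      exact ⟨A (A f), f, A (A g), g, (hgraph _ _).2 rfl, (hgraph _ _).2 rfl, rfl⟩

/-- For `φ = R N z` the vector `R φ` equals `(J ⊗ 1)(Y ⊗ 1) A₁ A₂² z` with `‖Y‖ ≤ √c`. The pair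
bound handles `J ⊗ 1`, and `‖A₁ A₂² z‖ ≤ ‖φ‖` completes the estimate. Such `φ` are dense. -/
theorem formBound_pair_sqrt (hA : IsSelfAdjoint A) (hAi : ∀ x, A x = 0 → x = 0)
    (hAZ : A * A = besselOp (Conf d) * Z) {c : ℝ} (hc : 0 ≤ c)
    (hZ : ∀ f, ‖Z f‖ ^ 2 ≤ c * ‖A f‖ ^ 2) {S R : L2 (TwoConf d) →L[ℂ] L2 (TwoConf d)}
    (hSN : S * (A₁ * A₁ + A₂ * A₂) = A₁ * A₁ * (A₂ * A₂)) (hR : IsSelfAdjoint R)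
    (hRR : R * R = S) (hRi : ∀ x, R x = 0 → x = 0) (hw : AEStronglyMeasurable w volume)
    {C : ℝ} (hC : 0 ≤ C) (hb : FormBound w (besselOp (Conf d)) C) :
    FormBound (fun x : TwoConf d => w (x.fst - x.snd)) R (C * c) := by
  have h₁ : IsSelfAdjoint A₁ := isSelfAdjoint_tensorOp _ hA (.one _)
  have h₂ : IsSelfAdjoint A₂ := isSelfAdjoint_tensorOp _ (.one _) hA
  have hcc : A₁ * A₂ = A₂ * A₁ := by
    simp only [tensorOp_mul, mul_one, one_mul]
  have hNsa : IsSelfAdjoint (A₁ * A₁ + A₂ * A₂) := by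
    rw [isSelfAdjoint_iff, star_add, star_mul, star_mul, h₁.star_eq, h₂.star_eq]
  have hNi := sum_squares_injective h₁ h₂
    (tensorOp_injective _ hA (.one _) hAi fun x hx => hx)
  obtain ⟨Y, hY, hYn⟩ := exists_factor hA hAi (Real.sqrt_nonneg c) (Z := Z) fun f => by
    rw [← sq_le_sq₀ (norm_nonneg _) (by positivity), mul_pow, Real.sq_sqrt hc]
    exact hZ f
  have hpair := FormBound.pair hw fun y => hb.translate y
  refine formBound_of_denseRange (aestronglyMeasurable_twoConf hw)
    ((denseRange_of_selfAdjoint_injective hR hRi).comp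
      (denseRange_of_selfAdjoint_injective hNsa hNi) R.continuous) fun z => ?_
  simp only [Function.comp_apply]
  have hRφ : R (R ((A₁ * A₁ + A₂ * A₂) z)) =
      tensorOp (particleSplit d) (besselOp (Conf d)) (.id ℂ (L2 (Conf d)))
        (tensorOp (particleSplit d) Z 1 (A₂ (A₂ z))) := by
    have h3 := DFunLike.congr_fun hSN z
    have h4 : A₁ * A₁ = tensorOp (particleSplit d) (besselOp (Conf d)) 1 *
        tensorOp (particleSplit d) Z 1 := by
      rw [tensorOp_mul, tensorOp_mul, hAZ]
    rw [← hRR, h4] at h3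
    rw [← h4] at h3
    refine Eq.trans h3 ?_
    rw [h4]
    rfl
  rw [hRφ]
  refine hpair.comp_le hC hc ?_
  have h5 : tensorOp (particleSplit d) Z 1 (A₂ (A₂ z)) =
      tensorOp (particleSplit d) Y 1 (A₁ (A₂ (A₂ z))) := by
    have : tensorOp (particleSplit d) Z 1 = tensorOp (particleSplit d) Y 1 * A₁ := by
      rw [tensorOp_mul, mul_one, hY]
    rw [this]
    rfl
  have h6 : ‖tensorOp (particleSplit d) Y 1‖ ≤ √c :=
    (norm_tensorOp_le _ _ _).trans ((mul_le_of_le_one_right (norm_nonneg _)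
      ContinuousLinearMap.norm_id_le).trans hYn)
  have h7 := norm_sq_le_norm_sqrt_sq h₁ h₂ hcc hSN hR hRR z
  calc ‖tensorOp (particleSplit d) Z 1 (A₂ (A₂ z))‖ ^ 2
      ≤ (√c * ‖A₁ (A₂ (A₂ z))‖) ^ 2 := by
        rw [h5]
        gcongr
        exact ContinuousLinearMap.le_of_opNorm_le _ h6 _
    _ = c * ‖A₁ (A₂ (A₂ z))‖ ^ 2 := by rw [mul_pow, Real.sq_sqrt hc]
    _ ≤ _ := by gcongr

end PairResolvent

/-! ### Plane waves in the relative coordinate -/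

section Sandwich

variable {d : ℕ}

theorem IsNice.memLp_twoConf {g : Conf d → ℝ} (hg : IsNice g) :
    MemLp (fun x : TwoConf d => (g (x.fst - x.snd) : ℂ)) ⊤ volume := by
  obtain ⟨C, hC⟩ := hg.bounded
  refine memLp_top_of_bound (Complex.continuous_ofReal.comp_aestronglyMeasurable
    (aestronglyMeasurable_twoConf hg.measurable.aestronglyMeasurable)) C
    (Eventually.of_forall fun x => ?_)
  rw [Complex.norm_real]
  exact hC _

theorem memLp_phase_mul {P : Type*} [NormedAddCommGroup P] [InnerProductSpace ℝ P]
    [FiniteDimensional ℝ P] [MeasurableSpace P] [BorelSpace P] (v : P) {m : P → ℂ}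
    (hm : MemLp m ⊤ volume) : MemLp (fun x => phase v x * m x) ⊤ volume := hm.mul' (memLp_phase v)

/-- Plane waves in the relative coordinate converge to one on the support of the interaction. -/
theorem tendsto_phaseOp_mul_mulOp {g : Conf d → ℝ} (hg : IsNice g) :
    Tendsto (fun v : relSubspace d => phaseOp (v : TwoConf d) *
      mulOp (fun x : TwoConf d => (g (x.fst - x.snd) : ℂ)) -
      mulOp (fun x : TwoConf d => (g (x.fst - x.snd) : ℂ))) (𝓝 0) (𝓝 0) := by
  obtain ⟨C, hC⟩ := hg.bounded
  obtain ⟨r, hr⟩ := hg.support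
  have hm := hg.memLp_twoConf
  have hC0 : 0 ≤ C := (norm_nonneg _).trans (hC 0)
  have hbound : ∀ v : relSubspace d, ‖phaseOp (v : TwoConf d) *
      mulOp (fun x : TwoConf d => (g (x.fst - x.snd) : ℂ)) -
      mulOp (fun x : TwoConf d => (g (x.fst - x.snd) : ℂ))‖ ≤
      2 * Real.pi * ‖(v : TwoConf d).fst‖ * |r| * C := fun v => by
    have h1 : phaseOp (v : TwoConf d) * mulOp (fun x : TwoConf d => (g (x.fst - x.snd) : ℂ)) =
        mulOp fun x => phase (v : TwoConf d) x * (g (x.fst - x.snd) : ℂ) :=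
      mulOp_comp (memLp_phase _) hm (memLp_phase_mul _ hm)
    rw [h1, mulOp_sub (memLp_phase_mul _ hm) hm]
    refine norm_mulOp_le ((memLp_phase_mul _ hm).sub hm) (by positivity)
      (Eventually.of_forall fun x => ?_)
    -- Vectors of `relSubspace d` have the form `(a, -a)`, so the plane wave depends on `x₁ - x₂`
    -- only, which is bounded on the support of the interaction.
    have h2 : phase (v : TwoConf d) x = phase (v : TwoConf d).fst (x.fst - x.snd) := by
      have hv : (v : TwoConf d).snd = -(v : TwoConf d).fst :=
        eq_neg_of_add_eq_zero_right v.2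
      rw [phase, phase, WithLp.prod_inner_apply, inner_sub_right]
      change ((Real.fourierChar (⟪(v : TwoConf d).fst, x.fst⟫_ℝ +
        ⟪(v : TwoConf d).snd, x.snd⟫_ℝ) : Circle) : ℂ) = _
      rw [hv, inner_neg_left, ← sub_eq_add_neg]
    change ‖phase (v : TwoConf d) x * (g (x.fst - x.snd) : ℂ) - (g (x.fst - x.snd) : ℂ)‖ ≤ _
    rw [← sub_one_mul, norm_mul, h2, Complex.norm_real]
    by_cases hx : r < ‖x.fst - x.snd‖
    · rw [hr _ hx, norm_zero, mul_zero]
      positivity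
    · refine mul_le_mul ((norm_phase_sub_one_le _ _).trans ?_) (hC _) (norm_nonneg _)
        (by positivity)
      gcongr
      exact (not_lt.1 hx).trans (le_abs_self r)
  refine squeeze_zero_norm hbound ?_
  have hcont : Continuous fun v : relSubspace d =>
      2 * Real.pi * ‖(v : TwoConf d).fst‖ * |r| * C := by
    have : Continuous fun v : TwoConf d => v.fst := (WithLp.prod_continuous_ofLp 2 _ _).fst
    have := this.comp (continuous_subtype_val (p := fun x => x ∈ relSubspace d))
    simp only [Function.comp_def] at this
    fun_prop
  simpa using hcont.tendsto 0

end Sandwich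

end

end ManyBody

namespace ManyBody

open scoped FourierTransform ENNReal

noncomputable section

/-! ### Semicompactness from asymptotic invariance -/

section Semicompact

variable {P : Type*} [NormedAddCommGroup P] [InnerProductSpace ℝ P] [FiniteDimensional ℝ P]
  [MeasurableSpace P] [BorelSpace P] {U : Submodule ℝ P}

theorem orthogonalDecomposition_fst (k : U) :
    (U.orthogonalDecomposition (k : P)).fst = k := by
  rw [Submodule.fst_orthogonalDecomposition_apply]
  exact Submodule.orthogonalProjectionOnto_mem_subspace_eq_self k

theorem orthogonalDecomposition_snd (k : U) :
    (U.orthogonalDecomposition (k : P)).snd = 0 := by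
  rw [Submodule.snd_orthogonalDecomposition_apply]
  exact Submodule.orthogonalProjectionOnto_orthogonal_apply_eq_zero k.2

/-- A selfadjoint operator that is asymptotically invariant under small translations in position and
in momentum along `U` is a norm convergent sum of tensor products with compact operators on
`L²(U)`. -/
theorem exists_sum_tensorOp_of_tendsto {T : L2 P →L[ℂ] L2 P} (hT : IsSelfAdjoint T)
    (hp : Tendsto (fun v : U => phaseOp (v : P) * T - T) (𝓝 0) (𝓝 0))
    (ht : Tendsto (fun v : U => transOp (v : P) * T - T) (𝓝 0) (𝓝 0)) :
    ∃ (K : ℕ → L2 U →L[ℂ] L2 U) (B : ℕ → L2 Uᗮ →L[ℂ] L2 Uᗮ), (∀ j, IsCompactOperator (K j)) ∧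
      Tendsto (fun n => ∑ j ∈ Finset.range n, tensorOp U.orthogonalDecomposition (K j) (B j))
        atTop (𝓝 T) := by
  have key : ∀ {X : U → L2 P →L[ℂ] L2 P}, Tendsto X (𝓝 0) (𝓝 0) →
      ∀ ε > 0, ∃ δ > 0, ∀ k : U, ‖k‖ < δ → ‖X k‖ ≤ ε := fun {X} hX ε hε => by
    obtain ⟨δ, hδ, h⟩ := Metric.eventually_nhds_iff.1 ((Metric.tendsto_nhds.1 hX) ε hε)
    refine ⟨δ, hδ, fun k hk => ?_⟩
    have := h (y := k) (by rwa [dist_zero_right])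
    rw [dist_zero_right] at this
    exact this.le
  have hpk : ∀ k : U, phaseOp (k : P) =
      tensorOp U.orthogonalDecomposition (phaseOp k) (.id ℂ (L2 Uᗮ)) := fun k => by
    have h := phaseOp_eq_tensorOp U.orthogonalDecomposition (k : P)
    rw [orthogonalDecomposition_fst k, orthogonalDecomposition_snd k, phaseOp_zero] at h
    exact h
  have htk : ∀ k : U, transOp (k : P) =
      tensorOp U.orthogonalDecomposition (transOp k) (.id ℂ (L2 Uᗮ)) := fun k => by
    have h := transOp_eq_tensorOp U.orthogonalDecomposition (k : P)
    rw [orthogonalDecomposition_fst k, orthogonalDecomposition_snd k, transOp_zero] at h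
    exact h
  simp only [hpk] at hp
  simp only [htk] at ht
  have h1 : ∀ ε > 0, ∃ K : L2 U →L[ℂ] L2 U, IsCompactOperator K ∧
      ‖tensorOp U.orthogonalDecomposition K (.id ℂ (L2 Uᗮ)) ∘L T - T‖ ≤ ε := fun ε hε =>
    exists_compact_approx U.orthogonalDecomposition (key hp) (key ht) hε
  exact exists_hasSum_tensorOp U.orthogonalDecomposition hT h1

end Semicompact

theorem isSemicompact_of_tendsto {d : ℕ} {U : Submodule ℝ (TwoConf d)}
    {T : L2 (TwoConf d) →L[ℂ] L2 (TwoConf d)} (hT : IsSelfAdjoint T)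
    (hp : Tendsto (fun v : U => phaseOp (v : TwoConf d) * T - T) (𝓝 0) (𝓝 0))
    (ht : Tendsto (fun v : U => transOp (v : TwoConf d) * T - T) (𝓝 0) (𝓝 0)) :
    IsSemicompact U T :=
  exists_sum_tensorOp_of_tendsto hT hp ht

end

end ManyBody

namespace ManyBody

open scoped FourierTransform ENNReal

noncomputable section

/-! ### Assembly -/

section Main

theorem exists_sqrt_asymptotic {H ι : Type*} [NormedAddCommGroup H] [InnerProductSpace ℂ H]
    [CompleteSpace H] {U V : ι → H →L[ℂ] H} {l : Filter ι} (hU : ∀ i, ‖U i‖ ≤ 1)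
    (hV : ∀ i, ‖V i‖ ≤ 1) {S : H →L[ℂ] H} (hS : 0 ≤ S) (hSU : AsympComm U l S)
    (hSV : Tendsto (fun i => V i * S - S) l (𝓝 0)) :
    ∃ R : H →L[ℂ] H, 0 ≤ R ∧ IsSelfAdjoint R ∧ R * R = S ∧ AsympComm U l R ∧
      Tendsto (fun i => V i * R - R) l (𝓝 0) :=
  ⟨CFC.sqrt S, CFC.sqrt_nonneg S, .of_nonneg (CFC.sqrt_nonneg S), CFC.sqrt_mul_sqrt_self S,
    asympComm_sqrt hU hS hSU, tendsto_mul_sqrt hV hS hSV⟩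

theorem exists_formBound_of_sum {d : ℕ} {w f₁ f₂ : Conf d → ℝ} (h₁ : IsAdmissible f₁)
    (h₂ : IsAdmissible f₂) (hw : w =ᵐ[volume] f₁ + f₂) :
    ∃ C : ℝ, 0 ≤ C ∧ FormBound w (besselOp (Conf d)) C := by
  obtain ⟨g, hg, hgb⟩ := exists_isNice_of_sum h₁ h₂ hw zero_lt_one
  obtain ⟨C, hC⟩ := hg.bounded
  have hC0 : 0 ≤ C := (norm_nonneg _).trans (hC 0)
  exact ⟨1 + C, by positivity, hgb.of_le_add zero_le_one hC0
    ((aestronglyMeasurable_of_sum h₁ h₂ hw).sub hg.measurable.aestronglyMeasurable)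
    (formBound_of_norm_le (Eventually.of_forall hC) norm_besselOp_apply_le)
    (Eventually.of_forall fun x => by
      have := norm_add_le (w x - g x) (g x)
      rwa [sub_add_cancel] at this)⟩

/-- The sandwich of a bounded, compactly supported interaction is asymptotically invariant under
translations and plane waves in the relative coordinate. -/
theorem IsNice.tendsto_sandwich {d : ℕ} {g : Conf d → ℝ} (hg : IsNice g)
    {R : L2 (TwoConf d) →L[ℂ] L2 (TwoConf d)}
    (hp : AsympComm (fun v : TwoConf d => phaseOp v) (𝓝 0) R)
    (ht : Tendsto (fun v : TwoConf d => transOp v * R - R) (𝓝 0) (𝓝 0))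
    {X : L2 (TwoConf d) →L[ℂ] L2 (TwoConf d)}
    (hX : X = R * mulOp (fun x : TwoConf d => (g (x.fst - x.snd) : ℂ)) * R) :
    Tendsto (fun v : relSubspace d => phaseOp (v : TwoConf d) * X - X) (𝓝 0) (𝓝 0) ∧
      Tendsto (fun v : relSubspace d => transOp (v : TwoConf d) * X - X) (𝓝 0) (𝓝 0) := by
  have hM := tendsto_phaseOp_mul_mulOp hg
  generalize mulOp (fun x : TwoConf d => (g (x.fst - x.snd) : ℂ)) = M at hX hM
  have hval : Tendsto (fun v : relSubspace d => (v : TwoConf d)) (𝓝 0) (𝓝 0) :=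
    (continuous_subtype_val (p := fun x => x ∈ relSubspace d)).tendsto 0
  constructor
  -- `U R M R - R M R = [U, R] M R + R (U M - M) R`.
  · have h1 := (hp.comp hval).mul_const (M * R)
    have h2 := (hM.const_mul R).mul_const R
    have h3 := h1.add h2
    simp only [zero_mul, mul_zero, add_zero] at h3
    refine h3.congr fun v => ?_
    simp only [Function.comp_apply, hX]
    noncomm_ring
  · have h1 := (ht.comp hval).mul_const (M * R)
    simp only [zero_mul] at h1
    refine h1.congr fun v => ?_
    simp only [Function.comp_apply, hX]
    noncomm_ring

theorem exists_isInvSqrt_isSandwich {d : ℕ} {V w f₁ f₂ f₃ f₄ : Conf d → ℝ} {e : ℝ}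
    (h₁ : IsAdmissible f₁) (h₂ : IsAdmissible f₂) (hV : V =ᵐ[volume] f₁ + f₂)
    (h₃ : IsAdmissible f₃) (h₄ : IsAdmissible f₄) (hw : w =ᵐ[volume] f₃ + f₄)
    (he : ∀ u v, (u, v) ∈ hGraph V e → ‖u‖ ^ 2 ≤ (⟪u, v⟫_ℂ).re) :
    ∃ R T : L2 (TwoConf d) →L[ℂ] L2 (TwoConf d), IsInvSqrt (hSumGraph V e) R ∧
      IsSandwich w R T ∧ IsSemicompact (relSubspace d) T := by
  obtain ⟨A, Z, hA, hAi, hgraph, hAc, hAt, hAZ, c, hc, hZ⟩ := exists_sqrt_resolvent h₁ h₂ hV he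
  obtain ⟨S, hS, hSi, hSN, hSc, hSt⟩ := exists_pair_resolvent hA hAi hAc hAt
  obtain ⟨R, hR0, hR, hRR, hRc, hRt⟩ :=
    exists_sqrt_asymptotic norm_phaseOp_le norm_transOp_le hS hSc hSt
  have hRi : ∀ x, R x = 0 → x = 0 := fun x hx => hSi x <| by
    rw [← hRR, mul_apply_eq_comp, hx, map_zero]
  have hwm := aestronglyMeasurable_of_sum h₃ h₄ hw
  obtain ⟨C, hC, hwb⟩ := exists_formBound_of_sum h₃ h₄ hw
  obtain ⟨T, hT, -⟩ := exists_isFormOp (aestronglyMeasurable_twoConf hwm) (by positivity)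
    (formBound_pair_sqrt hA hAi hAZ hc hZ hSN hR hRR hRi hwm hC hwb)
  refine ⟨R, T, ⟨(ContinuousLinearMap.nonneg_iff_isPositive R).1 hR0, fun u v => ?_⟩, hT, ?_⟩
  · rw [mem_hSumGraph_iff hA hAi hgraph hSN, ← hRR, mul_apply_eq_comp]
  have happrox : ∀ ε > 0, ∃ X, dist T X < ε ∧
      Tendsto (fun v : relSubspace d => phaseOp (v : TwoConf d) * X - X) (𝓝 0) (𝓝 0) ∧
      Tendsto (fun v : relSubspace d => transOp (v : TwoConf d) * X - X) (𝓝 0) (𝓝 0) := by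
    intro ε hε
    -- The transfer of the form bound from `J` to `R` multiplies it by `c`; adding one keeps the
    -- product strictly below `ε`, also for `c = 0`.
    have hδ : 0 < ε / (c + 1) := by positivity
    obtain ⟨g, hg, hgb⟩ := exists_isNice_of_sum h₃ h₄ hw hδ
    have hwg := hwm.sub hg.measurable.aestronglyMeasurable
    refine ⟨_, ?_, hg.tendsto_sandwich hRc hRt rfl⟩
    rw [dist_eq_norm]
    refine (hT.norm_sub_le (isFormOp_of_bounded hg.memLp_twoConf hR)
      (aestronglyMeasurable_twoConf hwg) (by positivity)
      (formBound_pair_sqrt hA hAi hAZ hc hZ hSN hR hRR hRi hwg hδ.le hgb)).trans_lt ?_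
    rw [div_mul_eq_mul_div, div_lt_iff₀ (by positivity)]
    nlinarith
  refine isSemicompact_of_tendsto hT.isSelfAdjoint ?_ ?_
  · refine (isClosed_tendsto_mul_sub fun v : relSubspace d =>
      norm_phaseOp_le (v : TwoConf d)).closure_subset (Metric.mem_closure_iff.2 fun ε hε => ?_)
    obtain ⟨X, hX, hXp, -⟩ := happrox ε hε
    exact ⟨X, hXp, hX⟩
  · refine (isClosed_tendsto_mul_sub fun v : relSubspace d =>
      norm_transOp_le (v : TwoConf d)).closure_subset (Metric.mem_closure_iff.2 fun ε hε => ?_)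
    obtain ⟨X, hX, -, hXt⟩ := happrox ε hε
    exact ⟨X, hXt, hX⟩

end Main

end

end ManyBody

theorem mainTheorem5 (d : ℕ) (V w : ManyBody.Conf d → ℝ) (e : ℝ)
    (hV : ∃ f₁ f₂ : ManyBody.Conf d → ℝ,
      ManyBody.IsAdmissible f₁ ∧ ManyBody.IsAdmissible f₂ ∧ V =ᵐ[volume] f₁ + f₂)
    (hw : ∃ f₃ f₄ : ManyBody.Conf d → ℝ,
      ManyBody.IsAdmissible f₃ ∧ ManyBody.IsAdmissible f₄ ∧ w =ᵐ[volume] f₃ + f₄)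
    (hw_even : ∀ᵐ x, w (-x) = w x)
    (he : ∀ u v, (u, v) ∈ ManyBody.hGraph V e → ‖u‖ ^ 2 ≤ (⟪u, v⟫_ℂ).re) :
    ∃ R T : ManyBody.L2 (ManyBody.TwoConf d) →L[ℂ] ManyBody.L2 (ManyBody.TwoConf d),
      ManyBody.IsInvSqrt (ManyBody.hSumGraph V e) R ∧
      ManyBody.IsSandwich w R T ∧
      ManyBody.IsSemicompact (ManyBody.relSubspace d) T := by
  obtain ⟨f₁, f₂, h₁, h₂, hV⟩ := hV
  obtain ⟨f₃, f₄, h₃, h₄, hw⟩ := hw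
  exact ManyBody.exists_isInvSqrt_isSandwich h₁ h₂ hV h₃ h₄ hw he
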